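/- **Model.** Let $\nu$ be a measure on $\mathbb{R}$, not concentrated on a single point, with $\int e^{\theta y}\,\nu(dy)<\infty$ for all $\theta\in\mathbb{R}$, and let $\mathbf{b}(\theta)=\log\int e^{\theta y}\,\nu(dy)$. For each sample size $n$ let $p=p_n\ge 1$, let $\phi^*=\phi^*_n\in\mathbb{R}^p$ have support $J^*=\{j:\phi^*_j\neq 0\}$, and let $(X_{1\bullet},Y_1),\dots,(X_{n\bullet},Y_n)$ be i.i.d. with values in $\mathbb{R}^p\times\mathbb{R}$ such that, given $X_{i\bullet}=x$, $Y_i$ has density $\exp\{y\theta-\mathbf{b}(\theta)\}$ with respect to $\nu$, where $\theta=x^T\phi^*$. Put $\kappa_n=\log_n(p_n)$, $\kappa=\limsup\kappa_n\in[0,\infty]$ and $\kappa'=\liminf\kappa_n$. Fix $q\in\mathbb{N}$ and constants $a_1,a_2,a_3>0$ and assume: * (B1) $\log p=o(n)$; (B2) $|J^*|\le q$; (B3) $a_1\mathbf{I}_J\preceq\mathbb{E}[X_{1J}X_{1J}^T]\preceq a_2\mathbf{I}_J$ for all $J\subset[p]$ with $|J|\le 2q$; (B4) $\|\phi^*\|_2\le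 a_3$; (B5) $\sqrt{\log(np)/n}=o(\min\{|\phi^*_j|:j\in J^*\})$, where $\min\emptyset=\infty$; and one of the following two conditions, with constants not depending on $n$: * (A1) $|X_{1j}|\le A$ almost surely for all $j\in[p]$; * (A2) for an even integer $K>2\kappa$, $\mathbb{E}|X_{1j}|^{6K}\le A_K$ for all $j\in[p]$, and for every $t>0$, $\mathbb{E}\big[\sup_{|\theta|\le t|X_{1j}|}|\mathbf{b}'''(\theta)|^{2K}\big]\le B_K(t)<\infty$ for all $j\in[p]$. **Criterion.** Given prior densities $f_J$ on $\mathbb{R}^J$ ($J\subset[p]$, $|J|\le q$; they may depend on $n$) and $\gamma\ge0$, let $$\mathrm{Bayes}_\gamma(J)=\binom{p}{|J|}^{-\gamma}\mathbf{1}\{|J|\le q\}\int_{\mathbb{R}^J}\exp\Big\{\sum_{i=1}^n Y_iX_{iJ}^T\phi_J-\mathbf{b}(X_{iJ}^T\phi_J)\Big\}f_J(\phi_J)\,d\phi_J .$$ **Claim.** There is $R>0$, depending only on $\nu,q,a_1,a_2,a_3$ and on $A$ (under (A1)) or $K,A_K,B_K(\cdot)$ (under (A2)), with the following property. Suppose there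 are constants $0<F_1,F_2,F_3<\infty$ such that, for all $n$ and all $|J|\le q$: $f_J\le F_1$ everywhere, and on the ball $\{\|\phi_J\|_2\le R+1\}$ one has $f_J\ge F_2$ and $f_J$ is differentiable with $\|\nabla f_J\|_2\le F_3$. Let the real numbers $\alpha,\beta$ and $\gamma\ge 0$ satisfy * if $\kappa=0$: $\alpha\in(0,\tfrac12)$ and $\beta>0$; * if $\kappa>0$: $\gamma>1-\frac1{2\kappa}+\beta+\frac\alpha\kappa$ (with $1/\infty=0$) and, in case $\alpha\ge\tfrac12$, also $\kappa'>0$ and $\gamma>1-\frac1{2\kappa'}+\beta+\frac\alpha{\kappa'}$ (which is automatic if $\kappa_n$ converges). Then, for all sufficiently large $n$, the event $$\mathrm{Bayes}_\gamma(J^*)>\mathrm{Bayes}_\gamma(J)\quad\text{for all }J\ne J^*\text{ with }|J|\le q$$ has probability at least $1-n^{-\alpha}p^{-\beta}$ under (A1), and at least $1-4K^{K+1}n^{-(K-2\kappa)/2}-n^{-\alpha}p^{-\beta}$ under (A2). In particular, Bayesian model selection is consistent: if $\gamma\ge0$ and either $\kappa=0$ or $\gamma>1-\frac1{2\kappa}$,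 then the probability of this event tends to $1$ as $n\to\infty$. -/

import Mathlib

open MeasureTheory ProbabilityTheory Filter Topology Asymptotics
open scoped ENNReal

noncomputable section

/-! ### The generalized linear model -/

/-- The cumulant function `b(θ) = log ∫ exp (θ y) ν(dy)` of the exponential family with base
measure `ν`, i.e. the normalizing function for which `y ↦ exp (y θ - b(θ))` is a probability
density with respect to `ν`. -/
def cumulant (ν : Measure ℝ) : ℝ → ℝ := cgf id ν

/-- `ν` is the base measure of a non-degenerate exponential family on `ℝ` whose natural parameter
space is all of `ℝ`: all exponential moments are finite, and `ν` is not concentrated on a point. -/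
structure IsExpFamilyBase (ν : Measure ℝ) : Prop where
  integrable_exp : ∀ θ : ℝ, Integrable (fun y => Real.exp (θ * y)) ν
  not_point : ∀ c : ℝ, ν {c}ᶜ ≠ 0

/-- The joint law of one observation `(x, y)`: the covariate vector `x` has law `Q`, and given `x`
the response `y` has density `exp (y θ - b(θ))` with respect to `ν`, where `θ = xᵀ φ`. -/
def observationLaw (ν : Measure ℝ) {p : ℕ} (Q : Measure (Fin p → ℝ))
    (φ : EuclideanSpace ℝ (Fin p)) : Measure ((Fin p → ℝ) × ℝ) :=
  (Q.prod ν).withDensity fun z =>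
    ENNReal.ofReal
      (Real.exp (z.2 * (∑ j, z.1 j * φ j) - cumulant ν (∑ j, z.1 j * φ j)))

/-- A sequence, indexed by the sample size `n`, of generalized linear regression experiments with
random covariates for the exponential family with base measure `ν`.  The `n`-th experiment has
`p n` covariates and consists of `n` i.i.d. observations `(X i, Y i)`; `Q n` is the law of a
covariate vector and `φ n` is the true parameter vector.  Everything except the family may change
with `n`. -/
structure GLMSequence (ν : Measure ℝ) where
  p : ℕ → ℕ
  one_le_p : ∀ n, 1 ≤ p n
  Q : ∀ n, Measure (Fin (p n) → ℝ)
  isProb_Q : ∀ n, IsProbabilityMeasure (Q n)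
  φ : ∀ n, EuclideanSpace ℝ (Fin (p n))
  Ω : ℕ → Type*
  mΩ : ∀ n, MeasurableSpace (Ω n)
  P : ∀ n, Measure (Ω n)
  isProb_P : ∀ n, IsProbabilityMeasure (P n)
  X : ∀ n, Fin n → Ω n → Fin (p n) → ℝ
  Y : ∀ n, Fin n → Ω n → ℝ
  measurable_X : ∀ n i, Measurable (X n i)
  measurable_Y : ∀ n i, Measurable (Y n i)
  indep : ∀ n, iIndepFun (fun i ω => (X n i ω, Y n i ω)) (P n)
  law : ∀ n i, (P n).map (fun ω => (X n i ω, Y n i ω)) = observationLaw ν (Q n) (φ n)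

attribute [instance] GLMSequence.mΩ GLMSequence.isProb_Q GLMSequence.isProb_P

namespace GLMSequence

variable {ν : Measure ℝ} (S : GLMSequence ν)

/-- The smallest true model: the support of the true parameter vector. -/
def trueModel (n : ℕ) : Finset (Fin (S.p n)) := Finset.univ.filter fun j => S.φ n j ≠ 0

/-- `κ = limsup κ_n` with `κ_n = log_n (p_n)`, in `[0, ∞]`. -/
def kappa : ℝ≥0∞ :=
  limsup (fun n : ℕ => ENNReal.ofReal (Real.logb (n : ℝ) (S.p n : ℝ))) atTop

/-- `liminf κ_n` with `κ_n = log_n (p_n)`, in `[0, ∞]`. -/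
def kappaLow : ℝ≥0∞ :=
  liminf (fun n : ℕ => ENNReal.ofReal (Real.logb (n : ℝ) (S.p n : ℝ))) atTop

/-- The matrix `E [X_{1J} X_{1J}ᵀ]`. -/
def secondMoment (n : ℕ) (J : Finset (Fin (S.p n))) : Matrix J J ℝ :=
  Matrix.of fun j k => ∫ x, x j * x k ∂(S.Q n)

/-- Covariates bounded by `A` with probability one. -/
def BoundedCovariates (A : ℝ) : Prop :=
  ∀ n (j : Fin (S.p n)), ∀ᵐ x ∂(S.Q n), |x j| ≤ A

/-- Covariates with moment bounds: `K` is an even integer with `K > 2κ`, `E |X_{1j}|^{6K} ≤ A`, and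
for all `t > 0`, `E [sup_{|θ| ≤ t |X_{1j}|} |b'''(θ)|^{2K}] ≤ B t`, uniformly in `j` (and `n`). -/
structure MomentCovariates (K : ℕ) (A : ℝ) (B : ℝ → ℝ) : Prop where
  even : Even K
  two_kappa_lt : 2 * S.kappa < (K : ℝ≥0∞)
  moment : ∀ n (j : Fin (S.p n)),
    ∫⁻ x, ENNReal.ofReal (|x j| ^ (6 * K)) ∂(S.Q n) ≤ ENNReal.ofReal A
  third_deriv : ∀ t : ℝ, 0 < t → ∀ n (j : Fin (S.p n)),
    ∫⁻ x, (⨆ θ ∈ Set.Icc (-(t * |x j|)) (t * |x j|),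
      ENNReal.ofReal (|iteratedDeriv 3 (cumulant ν) θ| ^ (2 * K))) ∂(S.Q n)
      ≤ ENNReal.ofReal (B t)

/-- The sparsity, growth, eigenvalue and signal conditions. -/
structure SparseRegime (q : ℕ) (a₁ a₂ a₃ : ℝ) : Prop where
  /-- subexponential growth, `log p = o(n)` -/
  growth : (fun n => Real.log (S.p n : ℝ)) =o[atTop] (fun n => (n : ℝ))
  /-- the true model has size at most `q` -/
  sparse : ∀ n, (S.trueModel n).card ≤ q
  /-- `a₁ I ≼ E [X_{1J} X_{1J}ᵀ] ≼ a₂ I` for all `|J| ≤ 2q` -/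
  eigen_lower : ∀ n (J : Finset (Fin (S.p n))), J.card ≤ 2 * q →
    (S.secondMoment n J - a₁ • (1 : Matrix J J ℝ)).PosSemidef
  eigen_upper : ∀ n (J : Finset (Fin (S.p n))), J.card ≤ 2 * q →
    (a₂ • (1 : Matrix J J ℝ) - S.secondMoment n J).PosSemidef
  /-- bounded signal -/
  signal_upper : ∀ n, ‖S.φ n‖ ≤ a₃
  /-- `√(log (np) / n) = o (min {|φ_j| : j ∈ J*})`, the minimum over the empty set being `∞` -/
  signal_lower : ∀ c : ℝ, 0 < c → ∀ᶠ n : ℕ in atTop, ∀ j ∈ S.trueModel n,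
    Real.sqrt (Real.log ((n : ℝ) * (S.p n : ℝ)) / (n : ℝ)) ≤ c * |S.φ n j|

/-- A family of prior densities, one for each model (for each sample size). -/
abbrev PriorFamily : Type := ∀ n (J : Finset (Fin (S.p n))), EuclideanSpace ℝ J → ℝ

/-- The `f n J` with `|J| ≤ q` are probability densities that are bounded above by `F₁`, bounded
below by `F₂` on the ball of radius `R + 1`, and have gradient bounded by `F₃` on that ball. -/
structure PriorConditions (q : ℕ) (R F₁ F₂ F₃ : ℝ) (f : S.PriorFamily) : Prop where
  measurable : ∀ n J, J.card ≤ q → Measurable (f n J)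
  nonneg : ∀ n J, J.card ≤ q → ∀ x, 0 ≤ f n J x
  lintegral_eq_one : ∀ n J, J.card ≤ q → ∫⁻ x, ENNReal.ofReal (f n J x) = 1
  upper : ∀ n J, J.card ≤ q → ∀ x, f n J x ≤ F₁
  lower : ∀ n J, J.card ≤ q → ∀ x, ‖x‖ ≤ R + 1 → F₂ ≤ f n J x
  differentiable : ∀ n J, J.card ≤ q → ∀ x, ‖x‖ ≤ R + 1 → DifferentiableAt ℝ (f n J) x
  grad : ∀ n J, J.card ≤ q → ∀ x, ‖x‖ ≤ R + 1 → ‖gradient (f n J) x‖ ≤ F₃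

end GLMSequence

/-! ### Bayesian model selection -/

/-- The log-likelihood function
`∑ i, (Y_i X_{iJ}ᵀ φ_J - b(X_{iJ}ᵀ φ_J))` of the model `J` at the data `(X, Y)`. -/
def logLik (ν : Measure ℝ) {n p : ℕ} (X : Fin n → Fin p → ℝ) (Y : Fin n → ℝ)
    (J : Finset (Fin p)) (φ : EuclideanSpace ℝ J) : ℝ :=
  ∑ i, (Y i * (∑ j : J, X i j * φ j) - cumulant ν (∑ j : J, X i j * φ j))

/-- The unnormalized prior `P(J) = (p choose |J|)^{-γ} 1{|J| ≤ q}` on models. -/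
def modelPrior (p q : ℕ) (γ : ℝ) (J : Finset (Fin p)) : ℝ :=
  if J.card ≤ q then (p.choose J.card : ℝ) ^ (-γ) else 0

/-- The unnormalized posterior probability
`Bayes_γ(J) = P(J) ∫ L(φ_J) f_J(φ_J) dφ_J`, where `L` is the likelihood function. -/
def bayes (ν : Measure ℝ) {n p : ℕ} (q : ℕ) (γ : ℝ)
    (f : ∀ J : Finset (Fin p), EuclideanSpace ℝ J → ℝ)
    (X : Fin n → Fin p → ℝ) (Y : Fin n → ℝ) (J : Finset (Fin p)) : ℝ≥0∞ :=
  ENNReal.ofReal (modelPrior p q γ J) *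
    ∫⁻ φ : EuclideanSpace ℝ J, ENNReal.ofReal (Real.exp (logLik ν X Y J φ) * f J φ)

namespace GLMSequence

variable {ν : Measure ℝ} (S : GLMSequence ν)

/-- The event that `Bayes_γ(J*) > Bayes_γ(J)` for all models `J ≠ J*` with `|J| ≤ q`. -/
def selectsTrueModel (q : ℕ) (γ : ℝ) (f : S.PriorFamily) (n : ℕ) : Set (S.Ω n) :=
  {ω | ∀ J : Finset (Fin (S.p n)), J ≠ S.trueModel n → J.card ≤ q →
    bayes ν q γ (f n) (fun i => S.X n i ω) (fun i => S.Y n i ω) J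
      < bayes ν q γ (f n) (fun i => S.X n i ω) (fun i => S.Y n i ω) (S.trueModel n)}

end GLMSequence

/-- `1 - 1/(2κ) + β + α/κ` for `κ ∈ (0, ∞]`, with `1/∞ = 0`. -/
def gammaThreshold (κ : ℝ≥0∞) (α β : ℝ) : ℝ :=
  1 - (κ⁻¹).toReal / 2 + β + α * (κ⁻¹).toReal

/-- The admissible choices of `α, β, γ`.  If `κ = 0`: `α ∈ (0, 1/2)` and `β > 0`.  If `κ > 0`:
`γ > 1 - 1/(2κ) + β + α/κ`; the threshold is a nondecreasing function of `κ` for `α ≤ 1/2` but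
decreasing for `α > 1/2`, and when `α ≥ 1/2` the same inequality is required at
`κ' = liminf κ_n`, which must be positive (this adds nothing if `κ_n` converges). -/
def Admissible (κ' κ : ℝ≥0∞) (α β γ : ℝ) : Prop :=
  (κ = 0 → 0 < α ∧ α < 1 / 2 ∧ 0 < β) ∧
  (κ ≠ 0 → gammaThreshold κ α β < γ ∧
    (1 / 2 ≤ α → κ' ≠ 0 ∧ gammaThreshold κ' α β < γ))

end

/-! All likelihoods are compared with the one at the true parameter φ*. For a fixed shift d the
likelihood ratio of φ* + d to φ* has expectation one, because tilting the density of Y by xᵀd gives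
another density of the family (`lintegral_exp_logRatio`). Markov's inequality for this ratio, taken
at points or, by Fubini, integrated over cubes, takes the place of maximum likelihood theory and of
Laplace approximation.

Write ℓ = log n + log p and r = √(ℓ/n). The log-ratio at d is linear in d through the score, minus a
sum of Bregman remainders of the cumulant function. Three events control it. On the score event the
log-ratios at ±r e_j are below Nℓ; on the tame event the Bregman sums at these points are O(nr²) =
O(ℓ). Together they bound every score coordinate by a multiple of nr (`abs_score_le`). On the
curvature event the Bregman sum is at least c n min(|d|, |d|²) for all sparse d; this follows from
Hoeffding bounds for truncated second moments and from convexity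
(`momentEvent_subset_curvatureEvent`).

Hence, outside the ball of radius Cr, the log-ratio is at most -N₂ℓ, while on the cube of half-side
ρ = 1/√(nℓ) it is bounded below by a constant (`bounds_of_events`). So the evidence of J* is at
least D(2ρ)^|J*|. A model that misses a coordinate of J* stays at distance Cr from φ* by the signal
condition; its evidence is at most exp(-N₂ℓ), which is too small. A model J ⊋ J* with k extra
covariates has evidence at most F₁ times the integral of the ratio over the cube of half-side Cr,
plus exp(-N₂ℓ). The integral has mean (2Cr)^|J|. The prior ratio is O(p^(-γk)), so by Markov such a
model beats J* with probability O(ℓ^(2q) (n^(-1/2) p^(-γ))^k). There are at most p^k of them, and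
the sum over k ≥ 1 is O(ℓ^(2q) p^(1-γ) n^(-1/2)). The condition on γ leaves a slack of a positive
power of np between this and n^(-α) p^(-β) (`exists_slack`), which absorbs the powers of ℓ.

It remains to bound the probability of an untame design. It vanishes for large n if the covariates
are bounded. Under moment conditions a union bound for large rows and a Chernoff bound for truncated
sums give n^(-ρ) for suitable ρ (`MomentCovariates.exists_tame`). -/

namespace IsExpFamilyBase

/-! ### The cumulant function: smoothness and strict convexity. -/

variable {ν : Measure ℝ}

lemma isFiniteMeasure (hν : IsExpFamilyBase ν) : IsFiniteMeasure ν := by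
  have h := hν.integrable_exp 0
  simp only [zero_mul, Real.exp_zero] at h
  exact (integrable_const_iff_isFiniteMeasure one_ne_zero).1 h

lemma ne_zero (hν : IsExpFamilyBase ν) : NeZero ν :=
  ⟨fun h => hν.not_point 0 (by simp [h])⟩

lemma integrableExpSet_eq (hν : IsExpFamilyBase ν) : integrableExpSet id ν = Set.univ :=
  Set.eq_univ_of_forall fun t => hν.integrable_exp t

lemma mem_interior (hν : IsExpFamilyBase ν) (t : ℝ) :
    t ∈ interior (integrableExpSet id ν) := by
  simp [hν.integrableExpSet_eq]

lemma contDiff_cumulant (hν : IsExpFamilyBase ν) (k : ℕ∞) : ContDiff ℝ k (cumulant ν) := by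
  rw [contDiff_iff_contDiffAt]
  exact fun t => (analyticAt_cgf (hν.mem_interior t)).contDiffAt

lemma continuous_cumulant (hν : IsExpFamilyBase ν) : Continuous (cumulant ν) :=
  (hν.contDiff_cumulant 0).continuous

lemma continuous_iteratedDeriv_cumulant (hν : IsExpFamilyBase ν) (k : ℕ) :
    Continuous (iteratedDeriv k (cumulant ν)) :=
  (hν.contDiff_cumulant k).continuous_iteratedDeriv k le_rfl

lemma exp_cumulant (hν : IsExpFamilyBase ν) (t : ℝ) :
    Real.exp (cumulant ν t) = mgf id ν t := by
  have := hν.ne_zero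
  exact exp_cgf (hν.integrable_exp t)

lemma lintegral_density (hν : IsExpFamilyBase ν) (t : ℝ) :
    ∫⁻ y, ENNReal.ofReal (Real.exp (y * t - cumulant ν t)) ∂ν = 1 := by
  have h : ∀ y : ℝ, Real.exp (y * t - cumulant ν t)
      = Real.exp (t * y) * (Real.exp (cumulant ν t))⁻¹ := fun y => by
    rw [Real.exp_sub, mul_comm y t]; rfl
  simp_rw [h]
  rw [← ofReal_integral_eq_lintegral_ofReal ((hν.integrable_exp t).mul_const _)
    (ae_of_all _ fun y => by positivity), integral_mul_const, hν.exp_cumulant]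
  have : 0 < mgf id ν t := by rw [← hν.exp_cumulant]; positivity
  simp only [mgf, id] at this ⊢
  rw [mul_inv_cancel₀ this.ne', ENNReal.ofReal_one]

/-- The second derivative is the variance of the tilted law, which has the same null sets as `ν` and
so is not a point mass. -/
lemma iteratedDeriv_two_cumulant_pos (hν : IsExpFamilyBase ν) (t : ℝ) :
    0 < iteratedDeriv 2 (cumulant ν) t := by
  have hmgf : 0 < mgf id ν t := by rw [← hν.exp_cumulant]; positivity
  have h2 := iteratedDeriv_two_cgf_eq_integral (hν.mem_interior t)
  set m := deriv (cgf id ν) t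
  change iteratedDeriv 2 (cgf id ν) t = _ at h2
  change 0 < iteratedDeriv 2 (cgf id ν) t
  rw [h2]
  refine div_pos ?_ hmgf
  have hint : Integrable (fun y : ℝ => (id y - m) ^ 2 * Real.exp (t * id y)) ν := by
    have i2 := integrable_pow_mul_exp_of_mem_interior_integrableExpSet (hν.mem_interior t) 2
    have i1 := integrable_pow_mul_exp_of_mem_interior_integrableExpSet (hν.mem_interior t) 1
    have i0 := integrable_pow_mul_exp_of_mem_interior_integrableExpSet (hν.mem_interior t) 0
    refine ((i2.add (i1.const_mul (-2 * m))).add (i0.const_mul (m ^ 2))).congr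
      (ae_of_all _ fun y => ?_)
    simp only [Pi.add_apply]
    ring
  rw [integral_pos_iff_support_of_nonneg (fun y => by positivity) hint]
  refine pos_iff_ne_zero.2 fun h => hν.not_point m ?_
  refine measure_mono_null (fun y hy => ?_) h
  have : y - m ≠ 0 := sub_ne_zero.2 hy
  simp [this, Real.exp_ne_zero]

end IsExpFamilyBase

/-! ### Bregman remainders, and suprema over compact intervals. -/

/-- The Bregman remainder `b (θ + u) - b θ - b' θ * u` of the cumulant function. -/
noncomputable def bregman (ν : Measure ℝ) (θ u : ℝ) : ℝ :=
  cumulant ν (θ + u) - cumulant ν θ - deriv (cumulant ν) θ * u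

namespace IsExpFamilyBase

variable {ν : Measure ℝ}

lemma exists_bregman_eq (hν : IsExpFamilyBase ν) (θ u : ℝ) :
    ∃ ξ, |ξ - θ| ≤ |u| ∧ bregman ν θ u = iteratedDeriv 2 (cumulant ν) ξ * u ^ 2 / 2 := by
  -- Restricting to the segment from `θ` to `θ + u` puts Taylor's formula on `[0, 1]` whatever the
  -- sign of `u`.
  set g : ℝ → ℝ := fun s => cumulant ν (θ + u * s) with hg
  have hb : ContDiff ℝ 2 (cumulant ν) := hν.contDiff_cumulant 2
  have hg1 : ∀ s, HasDerivAt g (deriv (cumulant ν) (θ + u * s) * u) s := fun s => by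
    have h1 : HasDerivAt (cumulant ν) (deriv (cumulant ν) (θ + u * s)) (θ + u * s) :=
      ((hb.differentiable (by norm_num)) _).hasDerivAt
    have h2 : HasDerivAt (fun s : ℝ => θ + u * s) u s := by
      simpa using ((hasDerivAt_id s).const_mul u).const_add θ
    exact h1.comp s h2
  have hg2 : ∀ s, HasDerivAt (deriv g) (iteratedDeriv 2 (cumulant ν) (θ + u * s) * u ^ 2) s :=
    fun s => by
    have e : deriv g = fun s => deriv (cumulant ν) (θ + u * s) * u :=
      funext fun s => (hg1 s).deriv
    have h1 : HasDerivAt (deriv (cumulant ν)) (iteratedDeriv 2 (cumulant ν) (θ + u * s))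
        (θ + u * s) := by
      rw [iteratedDeriv_succ, iteratedDeriv_one]
      have : Differentiable ℝ (deriv (cumulant ν)) := by
        have := hb.differentiable_iteratedDeriv 1 (by norm_num)
        rwa [iteratedDeriv_one] at this
      exact (this _).hasDerivAt
    have h2 : HasDerivAt (fun s : ℝ => θ + u * s) u s := by
      simpa using ((hasDerivAt_id s).const_mul u).const_add θ
    rw [e, pow_two, ← mul_assoc]
    exact (h1.comp s h2).mul_const u
  have hgc : ContDiff ℝ 2 g := hb.comp (contDiff_const.add (contDiff_const.mul contDiff_id))
  obtain ⟨s, hs, h⟩ := taylor_mean_remainder_lagrange_iteratedDeriv (n := 1) (f := g)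
    (x := 1) (x₀ := 0) zero_ne_one hgc.contDiffOn
  rw [Set.uIoo_of_lt zero_lt_one] at hs
  refine ⟨θ + u * s, ?_, ?_⟩
  · rw [add_sub_cancel_left, abs_mul, abs_of_pos hs.1]
    exact mul_le_of_le_one_right (abs_nonneg _) hs.2.le
  · have h2 : iteratedDeriv 2 g s = iteratedDeriv 2 (cumulant ν) (θ + u * s) * u ^ 2 := by
      rw [iteratedDeriv_succ, iteratedDeriv_one, (hg2 s).deriv]
    have h1 : derivWithin g (Set.uIcc 0 1) 0 = deriv (cumulant ν) θ * u := by
      rw [Set.uIcc_of_le zero_le_one,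
        (hg1 0).differentiableAt.derivWithin (uniqueDiffOn_Icc one_pos 0 (by simp)),
        (hg1 0).deriv]
      simp
    simp only [taylorWithinEval_succ, taylor_within_zero_eval, Nat.reduceAdd, h2,
      iteratedDerivWithin_one, h1] at h
    norm_num at h
    simp only [hg, mul_one, mul_zero, add_zero] at h
    rw [bregman]
    linarith

lemma bregman_nonneg (hν : IsExpFamilyBase ν) (θ u : ℝ) : 0 ≤ bregman ν θ u := by
  obtain ⟨ξ, -, h⟩ := hν.exists_bregman_eq θ u
  have := hν.iteratedDeriv_two_cumulant_pos ξ
  rw [h]; positivity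

lemma convexOn_cumulant (hν : IsExpFamilyBase ν) : ConvexOn ℝ Set.univ (cumulant ν) := by
  have hb : ContDiff ℝ 2 (cumulant ν) := hν.contDiff_cumulant 2
  refine convexOn_univ_of_deriv2_nonneg (hb.differentiable (by norm_num)) ?_ fun x => ?_
  · have := hb.differentiable_iteratedDeriv 1 (by norm_num)
    rwa [iteratedDeriv_one] at this
  · rw [← iteratedDeriv_eq_iterate]
    exact (hν.iteratedDeriv_two_cumulant_pos x).le

/-- The remainder is convex in `u` and vanishes at `0`, so it grows at least linearly along rays.
This carries curvature bounds from the unit sphere to all larger `d`. -/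
lemma mul_bregman_le (hν : IsExpFamilyBase ν) (θ u : ℝ) {s : ℝ} (hs : 1 ≤ s) :
    s * bregman ν θ u ≤ bregman ν θ (s * u) := by
  have hs0 : 0 < s := by linarith
  have h := hν.convexOn_cumulant.2 (Set.mem_univ (θ + s * u)) (Set.mem_univ θ)
    (show 0 ≤ s⁻¹ by positivity)
    (show 0 ≤ 1 - s⁻¹ from sub_nonneg.2 (inv_le_one_of_one_le₀ hs)) (by ring)
  have e : s⁻¹ • (θ + s * u) + (1 - s⁻¹) • θ = θ + u := by
    simp only [smul_eq_mul]; field_simp; ring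
  rw [e] at h
  simp only [smul_eq_mul] at h
  have h2 := mul_le_mul_of_nonneg_left h hs0.le
  have h3 : s * (s⁻¹ * cumulant ν (θ + s * u) + (1 - s⁻¹) * cumulant ν θ)
      = cumulant ν (θ + s * u) + (s - 1) * cumulant ν θ := by field_simp
  rw [h3] at h2
  simp only [bregman]
  nlinarith

end IsExpFamilyBase

/-- The supremum of `|g|` over `[-s, s]`. -/
noncomputable def absSup (g : ℝ → ℝ) (s : ℝ) : ℝ := sSup ((fun θ => |g θ|) '' Set.Icc (-s) s)

section AbsSup

variable {g : ℝ → ℝ}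

lemma absSup_nonneg (g : ℝ → ℝ) (s : ℝ) : 0 ≤ absSup g s :=
  Real.sSup_nonneg (by rintro _ ⟨θ, -, rfl⟩; exact abs_nonneg _)

lemma abs_le_absSup (hg : Continuous g) {s θ : ℝ} (h : |θ| ≤ s) : |g θ| ≤ absSup g s :=
  le_csSup (isCompact_Icc.image hg.abs).bddAbove ⟨θ, abs_le.1 h, rfl⟩

lemma exists_absSup_eq (hg : Continuous g) {s : ℝ} (hs : 0 ≤ s) :
    ∃ θ, |θ| ≤ s ∧ absSup g s = |g θ| := by
  obtain ⟨θ, hθ, h⟩ := (isCompact_Icc.image hg.abs).sSup_mem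
    (s := (fun θ => |g θ|) '' Set.Icc (-s) s) ⟨_, ⟨0, ⟨by linarith, hs⟩, rfl⟩⟩
  exact ⟨θ, abs_le.2 hθ, h.symm⟩

lemma absSup_mono (hg : Continuous g) : Monotone (absSup g) := by
  intro s t hst
  rcases lt_or_ge s 0 with hs | hs
  · have : Set.Icc (-s) s = ∅ := Set.Icc_eq_empty (by linarith)
    simpa [absSup, this] using absSup_nonneg g t
  · obtain ⟨θ, hθ, h⟩ := exists_absSup_eq hg hs
    rw [h]
    exact abs_le_absSup hg (hθ.trans hst)

lemma measurable_absSup (hg : Continuous g) : Measurable (absSup g) := (absSup_mono hg).measurable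

lemma exists_pos_le_of_continuous (hg : Continuous g) (h0 : ∀ θ, 0 < g θ) (T : ℝ) :
    ∃ c, 0 < c ∧ ∀ θ, |θ| ≤ T → c ≤ g θ := by
  rcases lt_or_ge T 0 with hT | hT
  · exact ⟨1, one_pos, fun θ h => absurd ((abs_nonneg θ).trans h) (by linarith)⟩
  · obtain ⟨θ₀, -, h⟩ := (isCompact_Icc (a := -T) (b := T)).exists_isMinOn
      ⟨0, by simp [hT]⟩ hg.continuousOn
    exact ⟨g θ₀, h0 _, fun θ hθ => h (abs_le.1 hθ)⟩

end AbsSup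

/-- The supremum of the variance function `b''` over `[-s, s]`. -/
noncomputable def varSup (ν : Measure ℝ) (s : ℝ) : ℝ := absSup (iteratedDeriv 2 (cumulant ν)) s

lemma IsExpFamilyBase.bregman_le {ν : Measure ℝ} (hν : IsExpFamilyBase ν) {θ u : ℝ}
    (hu : |u| ≤ 1) : bregman ν θ u ≤ varSup ν (|θ| + 1) * u ^ 2 / 2 := by
  obtain ⟨ξ, hξ, h⟩ := hν.exists_bregman_eq θ u
  have h1 : |ξ| ≤ |θ| + 1 := by
    have := abs_add_le (ξ - θ) θ
    rw [sub_add_cancel] at this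
    linarith
  have := (le_abs_self _).trans (abs_le_absSup (hν.continuous_iteratedDeriv_cumulant 2) h1)
  rw [h]
  gcongr
  exact this

lemma IsExpFamilyBase.exists_le_bregman {ν : Measure ℝ} (hν : IsExpFamilyBase ν) (T : ℝ) :
    ∃ c, 0 < c ∧ ∀ θ u, |θ| ≤ T → |u| ≤ T → c * u ^ 2 ≤ bregman ν θ u := by
  obtain ⟨c, hc, h⟩ := exists_pos_le_of_continuous (hν.continuous_iteratedDeriv_cumulant 2)
    hν.iteratedDeriv_two_cumulant_pos (T + T)
  refine ⟨c / 2, by positivity, fun θ u hθ hu => ?_⟩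
  obtain ⟨ξ, hξ, e⟩ := hν.exists_bregman_eq θ u
  have h1 : |ξ| ≤ T + T := by
    have := abs_add_le (ξ - θ) θ
    rw [sub_add_cancel] at this
    linarith
  rw [e]
  nlinarith [h ξ h1, sq_nonneg u]

/-! ### Likelihood ratios have mean one. -/

/-- The log-likelihood ratio of the parameter vectors `φ + d` and `φ`. -/
noncomputable def gain (ν : Measure ℝ) {n p : ℕ} (φ : Fin p → ℝ) (X : Fin n → Fin p → ℝ)
    (Y : Fin n → ℝ) (d : Fin p → ℝ) : ℝ :=
  ∑ i, (Y i * (X i ⬝ᵥ d) - (cumulant ν (X i ⬝ᵥ φ + X i ⬝ᵥ d) - cumulant ν (X i ⬝ᵥ φ)))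

namespace GLMSequence

variable {ν : Measure ℝ} (S : GLMSequence ν)

instance (n : ℕ) : IsProbabilityMeasure (S.Q n) := S.isProb_Q n

/-- The log-likelihood ratio of `φ n + d` and the true parameter vector `φ n`, as a function of the
sample point. -/
noncomputable def logRatio (n : ℕ) (d : Fin (S.p n) → ℝ) (ω : S.Ω n) : ℝ :=
  gain ν (S.φ n).ofLp (fun i => S.X n i ω) (fun i => S.Y n i ω) d

lemma measurable_dotProduct {p : ℕ} (d : Fin p → ℝ) :
    Measurable fun x : Fin p → ℝ => x ⬝ᵥ d := by
  unfold dotProduct; fun_prop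

lemma lintegral_comp_observation (n : ℕ) (i : Fin n) {g : (Fin (S.p n) → ℝ) × ℝ → ℝ≥0∞}
    (hg : Measurable g) :
    ∫⁻ ω, g (S.X n i ω, S.Y n i ω) ∂(S.P n) = ∫⁻ z, g z ∂(observationLaw ν (S.Q n) (S.φ n)) := by
  rw [← S.law n i, lintegral_map hg ((S.measurable_X n i).prodMk (S.measurable_Y n i))]

lemma lintegral_observationLaw (hν : IsExpFamilyBase ν) (n : ℕ)
    {g : (Fin (S.p n) → ℝ) × ℝ → ℝ≥0∞} (hg : Measurable g) :
    ∫⁻ z, g z ∂(observationLaw ν (S.Q n) (S.φ n)) = ∫⁻ x, ∫⁻ y,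
      ENNReal.ofReal (Real.exp (y * (x ⬝ᵥ (S.φ n).ofLp) - cumulant ν (x ⬝ᵥ (S.φ n).ofLp)))
        * g (x, y) ∂ν ∂(S.Q n) := by
  have := hν.isFiniteMeasure
  have hc := hν.continuous_cumulant.measurable
  have hm : Measurable fun z : (Fin (S.p n) → ℝ) × ℝ => ENNReal.ofReal
      (Real.exp (z.2 * (z.1 ⬝ᵥ (S.φ n).ofLp) - cumulant ν (z.1 ⬝ᵥ (S.φ n).ofLp))) := by
    have h : Measurable fun z : (Fin (S.p n) → ℝ) × ℝ => z.1 ⬝ᵥ (S.φ n).ofLp :=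
      (measurable_dotProduct _).comp measurable_fst
    exact ((measurable_snd.mul h).sub (hc.comp h)).exp.ennreal_ofReal
  change ∫⁻ z, g z ∂((S.Q n).prod ν).withDensity _ = _
  rw [lintegral_withDensity_eq_lintegral_mul _ (by exact hm) hg, lintegral_prod]
  · rfl
  · exact (hm.mul hg).aemeasurable

lemma lintegral_comp_X (hν : IsExpFamilyBase ν) (n : ℕ) (i : Fin n)
    {g : (Fin (S.p n) → ℝ) → ℝ≥0∞} (hg : Measurable g) :
    ∫⁻ ω, g (S.X n i ω) ∂(S.P n) = ∫⁻ x, g x ∂(S.Q n) := by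
  rw [S.lintegral_comp_observation n i (g := fun z => g z.1) (hg.comp measurable_fst),
    S.lintegral_observationLaw hν n (g := fun z => g z.1) (hg.comp measurable_fst)]
  refine lintegral_congr fun x => ?_
  change ∫⁻ y, _ * g x ∂ν = g x
  rw [lintegral_mul_const _ (by fun_prop), hν.lintegral_density, one_mul]

lemma map_X (hν : IsExpFamilyBase ν) (n : ℕ) (i : Fin n) :
    (S.P n).map (S.X n i) = S.Q n := by
  ext s hs
  rw [← lintegral_indicator_one hs, lintegral_map (measurable_one.indicator hs)
    (S.measurable_X n i), S.lintegral_comp_X hν n i (measurable_one.indicator hs),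
    lintegral_indicator_one hs]

lemma lintegral_prod_comp (n : ℕ) {g : (Fin (S.p n) → ℝ) × ℝ → ℝ≥0∞} (hg : Measurable g) :
    ∫⁻ ω, ∏ i, g (S.X n i ω, S.Y n i ω) ∂(S.P n)
      = ∏ i : Fin n, ∫⁻ ω, g (S.X n i ω, S.Y n i ω) ∂(S.P n) := by
  have := (S.indep n).comp (fun _ => g) (fun _ => hg)
  exact lintegral_prod_eq_prod_lintegral_of_indepFun Finset.univ _ this
    fun i => hg.comp ((S.measurable_X n i).prodMk (S.measurable_Y n i))

/-- Given the covariate, the density at `θ` times the ratio is the density at `θ + xᵀd`, which again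
integrates to one; independence multiplies these ones. -/
lemma lintegral_exp_logRatio (hν : IsExpFamilyBase ν) (n : ℕ) (d : Fin (S.p n) → ℝ) :
    ∫⁻ ω, ENNReal.ofReal (Real.exp (S.logRatio n d ω)) ∂(S.P n) = 1 := by
  have hc := hν.continuous_cumulant.measurable
  set φ := (S.φ n).ofLp with hφ
  set g : (Fin (S.p n) → ℝ) × ℝ → ℝ≥0∞ := fun z => ENNReal.ofReal (Real.exp
    (z.2 * (z.1 ⬝ᵥ d) - (cumulant ν (z.1 ⬝ᵥ φ + z.1 ⬝ᵥ d) - cumulant ν (z.1 ⬝ᵥ φ)))) with hg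
  have hgm : Measurable g := by
    have h1 : Measurable fun z : (Fin (S.p n) → ℝ) × ℝ => z.1 ⬝ᵥ φ :=
      (measurable_dotProduct _).comp measurable_fst
    have h2 : Measurable fun z : (Fin (S.p n) → ℝ) × ℝ => z.1 ⬝ᵥ d :=
      (measurable_dotProduct _).comp measurable_fst
    exact ((measurable_snd.mul h2).sub ((hc.comp (h1.add h2)).sub
      (hc.comp h1))).exp.ennreal_ofReal
  have h1 : ∀ i : Fin n, ∫⁻ ω, g (S.X n i ω, S.Y n i ω) ∂(S.P n) = 1 := fun i => by
    rw [S.lintegral_comp_observation n i hgm, S.lintegral_observationLaw hν n hgm]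
    have : ∀ x : Fin (S.p n) → ℝ, ∫⁻ y, ENNReal.ofReal (Real.exp (y * (x ⬝ᵥ φ)
        - cumulant ν (x ⬝ᵥ φ))) * g (x, y) ∂ν = 1 := fun x => by
      rw [← hν.lintegral_density (x ⬝ᵥ φ + x ⬝ᵥ d)]
      refine lintegral_congr fun y => ?_
      rw [hg, ← ENNReal.ofReal_mul (Real.exp_nonneg _), ← Real.exp_add]
      congr 2
      ring
    simp [← hφ, this]
  calc ∫⁻ ω, ENNReal.ofReal (Real.exp (S.logRatio n d ω)) ∂(S.P n)
      = ∫⁻ ω, ∏ i, g (S.X n i ω, S.Y n i ω) ∂(S.P n) := lintegral_congr fun ω => by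
        rw [logRatio, gain, Real.exp_sum, ENNReal.ofReal_prod_of_nonneg
          (fun _ _ => Real.exp_nonneg _)]
    _ = 1 := by simp [S.lintegral_prod_comp n hgm, h1]

lemma measurable_uncurry_logRatio (hν : IsExpFamilyBase ν) (n : ℕ) :
    Measurable fun z : S.Ω n × (Fin (S.p n) → ℝ) => S.logRatio n z.2 z.1 := by
  have hc := hν.continuous_cumulant.measurable
  have h1 : ∀ i, Measurable fun z : S.Ω n × (Fin (S.p n) → ℝ) => S.X n i z.1 ⬝ᵥ (S.φ n).ofLp :=
    fun i => (measurable_dotProduct _).comp ((S.measurable_X n i).comp measurable_fst)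
  have h2 : ∀ i, Measurable fun z : S.Ω n × (Fin (S.p n) → ℝ) => S.X n i z.1 ⬝ᵥ z.2 := fun i => by
    unfold dotProduct
    refine Finset.measurable_sum _ fun j _ => ?_
    exact ((measurable_pi_apply j).comp ((S.measurable_X n i).comp measurable_fst)).mul
      ((measurable_pi_apply j).comp measurable_snd)
  unfold logRatio gain
  exact Finset.measurable_sum _ fun i _ =>
    (((S.measurable_Y n i).comp measurable_fst).mul (h2 i)).sub
      ((hc.comp ((h1 i).add (h2 i))).sub (hc.comp (h1 i)))

lemma measure_le_logRatio (hν : IsExpFamilyBase ν) (n : ℕ) (d : Fin (S.p n) → ℝ) (τ : ℝ) :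
    S.P n {ω | τ ≤ S.logRatio n d ω} ≤ ENNReal.ofReal (Real.exp (-τ)) := by
  have hm : Measurable fun ω => ENNReal.ofReal (Real.exp (S.logRatio n d ω)) :=
    ((S.measurable_uncurry_logRatio hν n).comp
      (measurable_id.prodMk measurable_const)).exp.ennreal_ofReal
  have h := meas_ge_le_lintegral_div hm.aemeasurable (ε := ENNReal.ofReal (Real.exp τ))
    (μ := S.P n) (by simp [Real.exp_pos]) ENNReal.ofReal_ne_top
  rw [S.lintegral_exp_logRatio hν, ← ENNReal.ofReal_one, ← ENNReal.ofReal_div_of_pos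
    (Real.exp_pos _), one_div, ← Real.exp_neg] at h
  refine (measure_mono fun ω hω => ?_).trans h
  exact ENNReal.ofReal_le_ofReal (Real.exp_le_exp.2 hω)

/-- The score events `logRatio (± r e_j) < τ`. -/
def scoreEvent (n : ℕ) (r τ : ℝ) : Set (S.Ω n) :=
  {ω | ∀ j, S.logRatio n (Pi.single j r) ω < τ ∧ S.logRatio n (Pi.single j (-r)) ω < τ}

lemma measure_compl_scoreEvent_le (hν : IsExpFamilyBase ν) (n : ℕ) (r τ : ℝ) :
    S.P n (S.scoreEvent n r τ)ᶜ ≤ ENNReal.ofReal (2 * S.p n * Real.exp (-τ)) := by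
  have hsub : (S.scoreEvent n r τ)ᶜ ⊆ ⋃ j, ({ω | τ ≤ S.logRatio n (Pi.single j r) ω} ∪
      {ω | τ ≤ S.logRatio n (Pi.single j (-r)) ω}) := fun ω hω => by
    simp only [scoreEvent, Set.mem_compl_iff, Set.mem_ofPred_eq, not_forall, not_and_or,
      not_lt] at hω
    simpa using hω
  calc S.P n (S.scoreEvent n r τ)ᶜ
      ≤ ∑ j, S.P n ({ω | τ ≤ S.logRatio n (Pi.single j r) ω} ∪
          {ω | τ ≤ S.logRatio n (Pi.single j (-r)) ω}) :=
        (measure_mono hsub).trans (measure_iUnion_fintype_le _ _)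
    _ ≤ ∑ _j : Fin (S.p n), 2 * ENNReal.ofReal (Real.exp (-τ)) := by
        refine Finset.sum_le_sum fun j _ => (measure_union_le _ _).trans ?_
        rw [two_mul]
        exact add_le_add (S.measure_le_logRatio hν n _ _) (S.measure_le_logRatio hν n _ _)
    _ = ENNReal.ofReal (2 * S.p n * Real.exp (-τ)) := by
        rw [Finset.sum_const, Finset.card_univ, Fintype.card_fin, nsmul_eq_mul,
          ENNReal.ofReal_mul (by positivity), ENNReal.ofReal_mul (by positivity)]
        simp only [ENNReal.ofReal_natCast, ENNReal.ofReal_ofNat]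
        ring

end GLMSequence

/-! ### Deterministic bounds for the log-likelihood ratio. -/

section Deterministic

variable {ν : Measure ℝ} {n p : ℕ}

/-- The score vector of the generalized linear model at the parameter vector `φ`. -/
noncomputable def score (ν : Measure ℝ) (φ : Fin p → ℝ) (X : Fin n → Fin p → ℝ)
    (Y : Fin n → ℝ) (j : Fin p) : ℝ :=
  ∑ i, (Y i - deriv (cumulant ν) (X i ⬝ᵥ φ)) * X i j

/-- A design is tame if all entries are at most `r⁻¹` and the weighted column norms, with weights
bounding the variance function near the true linear predictors, are at most `M * n`. -/
def IsTameDesign (ν : Measure ℝ) (φ : Fin p → ℝ) (r M : ℝ) (X : Fin n → Fin p → ℝ) : Prop :=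
  (∀ i j, r * |X i j| ≤ 1) ∧ ∀ j, ∑ i, X i j ^ 2 * varSup ν (|X i ⬝ᵥ φ| + 1) ≤ M * n

lemma gain_eq (φ : Fin p → ℝ) (X : Fin n → Fin p → ℝ) (Y : Fin n → ℝ) (d : Fin p → ℝ) :
    gain ν φ X Y d = ∑ j, d j * score ν φ X Y j - ∑ i, bregman ν (X i ⬝ᵥ φ) (X i ⬝ᵥ d) := by
  have h : ∑ j, d j * score ν φ X Y j
      = ∑ i, (Y i - deriv (cumulant ν) (X i ⬝ᵥ φ)) * (X i ⬝ᵥ d) := by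
    simp only [score, Finset.mul_sum, dotProduct]
    rw [Finset.sum_comm]
    exact Finset.sum_congr rfl fun i _ => Finset.sum_congr rfl fun j _ => by ring
  rw [h, gain, ← Finset.sum_sub_distrib]
  refine Finset.sum_congr rfl fun i _ => ?_
  rw [bregman]; ring

/-- At `s e_j` the gain is `s` times the score coordinate minus a Bregman sum of order `r² M n`.
Upper bounds on the gain for `s = r` and `s = -r` therefore bound the score from both sides, without
any tail assumption on the responses. -/
lemma abs_score_le (hν : IsExpFamilyBase ν) {φ : Fin p → ℝ} {X : Fin n → Fin p → ℝ}
    {Y : Fin n → ℝ} {r M τ : ℝ} (hr : 0 < r) (hX : IsTameDesign ν φ r M X) (j : Fin p)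
    (h1 : gain ν φ X Y (Pi.single j r) < τ) (h2 : gain ν φ X Y (Pi.single j (-r)) < τ) :
    |score ν φ X Y j| ≤ (τ + r ^ 2 * M * n / 2) / r := by
  have key : ∀ s : ℝ, |s| = r → gain ν φ X Y (Pi.single j s) < τ →
      s * score ν φ X Y j ≤ τ + r ^ 2 * M * n / 2 := by
    intro s hs h
    rw [gain_eq, Finset.sum_eq_single j (fun k _ hk => by simp [hk]) (by simp)] at h
    simp only [Pi.single_eq_same, dotProduct_single] at h
    have hb : ∑ i, bregman ν (X i ⬝ᵥ φ) (X i j * s) ≤ r ^ 2 * M * n / 2 := by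
      calc ∑ i, bregman ν (X i ⬝ᵥ φ) (X i j * s)
          ≤ ∑ i, r ^ 2 / 2 * (X i j ^ 2 * varSup ν (|X i ⬝ᵥ φ| + 1)) := by
            refine Finset.sum_le_sum fun i _ => ?_
            refine (hν.bregman_le ?_).trans (le_of_eq ?_)
            · rw [abs_mul, hs, mul_comm]; exact hX.1 i j
            · rw [mul_pow, ← hs, sq_abs]; ring
        _ ≤ r ^ 2 / 2 * (M * n) := by
            rw [← Finset.mul_sum]
            exact mul_le_mul_of_nonneg_left (hX.2 j) (by positivity)
        _ = r ^ 2 * M * n / 2 := by ring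
    linarith
  have k1 := key r (abs_of_pos hr) h1
  have k2 := key (-r) (by rw [abs_neg, abs_of_pos hr]) h2
  rw [le_div_iff₀ hr, ← abs_of_pos hr, ← abs_mul, abs_of_pos hr]
  exact abs_le.2 ⟨by linarith, by linarith⟩

lemma abs_sum_mul_le_of_support {d s : Fin p → ℝ} {J : Finset (Fin p)} {m : ℕ} {δ σ : ℝ}
    (hJ : J.card ≤ m) (hd : ∀ j ∉ J, d j = 0) (hδ : 0 ≤ δ) (hdδ : ∀ j ∈ J, |d j| ≤ δ)
    (hs : ∀ j ∈ J, |s j| ≤ σ) (hσ : 0 ≤ σ) : |∑ j, d j * s j| ≤ m * δ * σ := by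
  rw [← Finset.sum_subset (Finset.subset_univ J) (fun j _ hj => by rw [hd j hj, zero_mul])]
  calc |∑ j ∈ J, d j * s j| ≤ ∑ j ∈ J, |d j * s j| := Finset.abs_sum_le_sum_abs _ _
    _ ≤ ∑ _j ∈ J, δ * σ := Finset.sum_le_sum fun j hj => by
        rw [abs_mul]
        exact mul_le_mul (hdδ j hj) (hs j hj) (abs_nonneg _) hδ
    _ = J.card * (δ * σ) := by rw [Finset.sum_const, nsmul_eq_mul]
    _ ≤ m * δ * σ := by
        rw [mul_assoc]
        exact mul_le_mul_of_nonneg_right (by exact_mod_cast hJ) (mul_nonneg hδ hσ)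

/-- With `D = |d|`, the score contributes at most `m σ D`. The curvature term is at least `c n (C r)
D`, twice that amount, so half of it survives, and `D ≥ C r`. -/
lemma gain_le_of_curvature {φ : Fin p → ℝ} {X : Fin n → Fin p → ℝ} {Y : Fin n → ℝ}
    {d : Fin p → ℝ} {J : Finset (Fin p)} {m : ℕ} {σ c C r : ℝ}
    (hJ : J.card ≤ m) (hd : ∀ j ∉ J, d j = 0) (hσ : 0 ≤ σ)
    (hs : ∀ j, |score ν φ X Y j| ≤ σ) (hc : 0 ≤ c) (hCr : 0 ≤ C * r) (hCr1 : C * r ≤ 1)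
    (hcurv : c * n * min (√(∑ j, d j ^ 2)) (∑ j, d j ^ 2)
      ≤ ∑ i, bregman ν (X i ⬝ᵥ φ) (X i ⬝ᵥ d))
    (hfar : C * r ≤ √(∑ j, d j ^ 2)) (hσc : m * σ ≤ c * n * (C * r) / 2) :
    gain ν φ X Y d ≤ -(c * n * (C * r) ^ 2 / 2) := by
  set D := √(∑ j, d j ^ 2) with hD
  have hD0 : 0 ≤ D := Real.sqrt_nonneg _
  have hD2 : ∑ j, d j ^ 2 = D ^ 2 :=
    (Real.sq_sqrt (Finset.sum_nonneg fun _ _ => sq_nonneg _)).symm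
  have h1 : ∑ j, d j * score ν φ X Y j ≤ m * D * σ := by
    refine (le_abs_self _).trans
      (abs_sum_mul_le_of_support hJ hd hD0 (fun j _ => ?_) (fun j _ => hs j) hσ)
    rw [hD]
    refine Real.abs_le_sqrt ?_
    exact Finset.single_le_sum (f := fun j => d j ^ 2) (fun _ _ => sq_nonneg _)
      (Finset.mem_univ j)
  -- Replacing the minimum by a multiple of `D` treats the linear and the quadratic regime at once.
  have h2 : C * r * D ≤ min D (∑ j, d j ^ 2) := by
    refine le_min (mul_le_of_le_one_left hD0 hCr1) ?_
    rw [hD2, pow_two]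
    exact mul_le_mul_of_nonneg_right hfar hD0
  have hcn : 0 ≤ c * n := by positivity
  have h3 := mul_le_mul_of_nonneg_left h2 hcn
  have h4 := mul_le_mul_of_nonneg_left hσc hD0
  have h5 := mul_le_mul_of_nonneg_left hfar (mul_nonneg hcn hCr)
  rw [gain_eq]
  nlinarith

/-- Near the truth all increments of linear predictors are at most one, so the second-order bound
for the Bregman remainder applies, and tameness sums it over the rows. -/
lemma le_gain_of_small (hν : IsExpFamilyBase ν) {φ : Fin p → ℝ} {X : Fin n → Fin p → ℝ}
    {Y : Fin n → ℝ} {d : Fin p → ℝ} {J : Finset (Fin p)} {m : ℕ} {σ r ρ M : ℝ}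
    (hJ : J.card ≤ m) (hd : ∀ j ∉ J, d j = 0) (hρ : 0 ≤ ρ) (hdρ : ∀ j ∈ J, |d j| ≤ ρ)
    (hσ : 0 ≤ σ) (hs : ∀ j, |score ν φ X Y j| ≤ σ) (hX : IsTameDesign ν φ r M X)
    (hM : 0 ≤ M) (hr : 0 < r) (hρr : m * ρ ≤ r) :
    -(m * ρ * σ + m ^ 2 * ρ ^ 2 * M * n / 2) ≤ gain ν φ X Y d := by
  have h1 : -(m * ρ * σ) ≤ ∑ j, d j * score ν φ X Y j :=
    (abs_le.1 (abs_sum_mul_le_of_support hJ hd hρ hdρ (fun j _ => hs j) hσ)).1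
  have hu : ∀ i, |X i ⬝ᵥ d| ≤ 1 := fun i => by
    rw [dotProduct_comm]
    refine (abs_sum_mul_le_of_support (σ := r⁻¹) hJ hd hρ hdρ (fun j _ => ?_)
      (by positivity)).trans ?_
    · rw [← one_div, le_div_iff₀ hr, mul_comm]; exact hX.1 i j
    · rw [← div_eq_mul_inv]; exact (div_le_one hr).2 hρr
  have hsq : ∀ i, (X i ⬝ᵥ d) ^ 2 ≤ m * ρ ^ 2 * ∑ j ∈ J, X i j ^ 2 := fun i => by
    have e : X i ⬝ᵥ d = ∑ j ∈ J, d j * X i j := by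
      rw [dotProduct_comm, dotProduct]
      exact (Finset.sum_subset (Finset.subset_univ J)
        (fun j _ hj => by rw [hd j hj, zero_mul])).symm
    rw [e]
    calc (∑ j ∈ J, d j * X i j) ^ 2 ≤ J.card * ∑ j ∈ J, (d j * X i j) ^ 2 :=
          sq_sum_le_card_mul_sum_sq
      _ ≤ m * ∑ j ∈ J, ρ ^ 2 * X i j ^ 2 := by
          refine mul_le_mul (by exact_mod_cast hJ) (Finset.sum_le_sum fun j hj => ?_)
            (Finset.sum_nonneg fun _ _ => sq_nonneg _) (by positivity)
          rw [mul_pow]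
          refine mul_le_mul_of_nonneg_right ?_ (sq_nonneg _)
          rw [← sq_abs (d j)]
          exact pow_le_pow_left₀ (abs_nonneg _) (hdρ j hj) 2
      _ = _ := by rw [← Finset.mul_sum]; ring
  have h2 : ∑ i, bregman ν (X i ⬝ᵥ φ) (X i ⬝ᵥ d) ≤ m ^ 2 * ρ ^ 2 * M * n / 2 := by
    calc ∑ i, bregman ν (X i ⬝ᵥ φ) (X i ⬝ᵥ d)
        ≤ ∑ i, m * ρ ^ 2 / 2 * ∑ j ∈ J, X i j ^ 2 * varSup ν (|X i ⬝ᵥ φ| + 1) := by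
          refine Finset.sum_le_sum fun i _ => (hν.bregman_le (hu i)).trans ?_
          have := mul_le_mul_of_nonneg_left (hsq i) (absSup_nonneg
            (iteratedDeriv 2 (cumulant ν)) (|X i ⬝ᵥ φ| + 1))
          rw [← Finset.sum_mul]
          unfold varSup
          nlinarith
      _ = m * ρ ^ 2 / 2 * ∑ j ∈ J, ∑ i, X i j ^ 2 * varSup ν (|X i ⬝ᵥ φ| + 1) := by
          rw [← Finset.mul_sum, Finset.sum_comm]
      _ ≤ m * ρ ^ 2 / 2 * ∑ _j ∈ J, M * n := by
          gcongr with j _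
          exact hX.2 j
      _ = m * ρ ^ 2 / 2 * (J.card * (M * n)) := by rw [Finset.sum_const, nsmul_eq_mul]
      _ ≤ m * ρ ^ 2 / 2 * (m * (M * n)) := by gcongr
      _ = _ := by ring
  rw [gain_eq]
  linarith

end Deterministic

/-! ### Concentration of truncated second moments. -/

namespace GLMSequence

variable {ν : Measure ℝ} (S : GLMSequence ν)

lemma integral_comp_X (hν : IsExpFamilyBase ν) (n : ℕ) (i : Fin n)
    {h : (Fin (S.p n) → ℝ) → ℝ} (hm : Measurable h) :
    ∫ ω, h (S.X n i ω) ∂(S.P n) = ∫ x, h x ∂(S.Q n) := by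
  rw [← S.map_X hν n i, integral_map (S.measurable_X n i).aemeasurable hm.aestronglyMeasurable]

lemma iIndepFun_comp_X (n : ℕ) {h : (Fin (S.p n) → ℝ) → ℝ} (hm : Measurable h) :
    iIndepFun (fun i ω => h (S.X n i ω)) (S.P n) :=
  (S.indep n).comp (fun _ z => h z.1) (fun _ => hm.comp measurable_fst)

/-- Hoeffding's inequality: a variable with values in `[-B, B]` is sub-Gaussian with variance proxy
`B²`. -/
lemma measure_sum_sub_ge_le (hν : IsExpFamilyBase ν) (n : ℕ) {h : (Fin (S.p n) → ℝ) → ℝ}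
    (hm : Measurable h) {B : ℝ} (hB : ∀ x, |h x| ≤ B) {ε : ℝ} (hε : 0 ≤ ε) :
    (S.P n).real {ω | n * ε ≤ ∑ i, h (S.X n i ω) - n * ∫ x, h x ∂(S.Q n)}
      ≤ Real.exp (-(n * (ε ^ 2 / (2 * B ^ 2)))) := by
  set μ := ∫ x, h x ∂(S.Q n)
  have hsub : ∀ i : Fin n, HasSubgaussianMGF (fun ω => h (S.X n i ω) - μ)
      ((‖B - (-B)‖₊ / 2) ^ 2) (S.P n) := fun i => by
    have h1 := hasSubgaussianMGF_of_mem_Icc (μ := S.P n) (X := fun ω => h (S.X n i ω))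
      (a := -B) (b := B) (hm.comp (S.measurable_X n i)).aemeasurable
      (ae_of_all _ fun ω => abs_le.1 (hB _))
    rwa [S.integral_comp_X hν n i hm] at h1
  have hind : iIndepFun (fun i ω => h (S.X n i ω) - μ) (S.P n) :=
    S.iIndepFun_comp_X n (h := fun x => h x - μ) (hm.sub_const μ)
  have h2 := HasSubgaussianMGF.measure_sum_ge_le_of_iIndepFun hind (s := Finset.univ)
    (fun i _ => hsub i) (ε := n * ε) (by positivity)
  have e1 : ∀ ω, ∑ i, (h (S.X n i ω) - μ) = ∑ i, h (S.X n i ω) - n * μ := fun ω => by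
    simp [Finset.sum_sub_distrib]
  simp only [e1] at h2
  refine h2.trans (Real.exp_le_exp.2 (le_of_eq ?_))
  rcases Nat.eq_zero_or_pos n with rfl | hn
  · simp
  have hn' : (n : ℝ) ≠ 0 := by positivity
  have e2 : ‖B - -B‖ / 2 = |B| := by
    rw [sub_neg_eq_add, ← two_mul, norm_mul]; simp
  simp only [Finset.sum_const, Finset.card_univ, Fintype.card_fin, nsmul_eq_mul]
  push_cast
  rw [e2, sq_abs]
  field_simp

lemma measure_abs_sum_sub_ge_le (hν : IsExpFamilyBase ν) (n : ℕ) {h : (Fin (S.p n) → ℝ) → ℝ}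
    (hm : Measurable h) {B : ℝ} (hB : ∀ x, |h x| ≤ B) {ε : ℝ} (hε : 0 ≤ ε) :
    S.P n {ω | n * ε ≤ |∑ i, h (S.X n i ω) - n * ∫ x, h x ∂(S.Q n)|}
      ≤ ENNReal.ofReal (2 * Real.exp (-(n * (ε ^ 2 / (2 * B ^ 2))))) := by
  have h1 := S.measure_sum_sub_ge_le hν n hm hB hε
  have h2 := S.measure_sum_sub_ge_le hν n (h := fun x => -h x) hm.neg
    (fun x => (abs_neg (h x)).trans_le (hB x)) hε
  have hsub : {ω | n * ε ≤ |∑ i, h (S.X n i ω) - n * ∫ x, h x ∂(S.Q n)|} ⊆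
      {ω | n * ε ≤ ∑ i, h (S.X n i ω) - n * ∫ x, h x ∂(S.Q n)} ∪
      {ω | n * ε ≤ ∑ i, -h (S.X n i ω) - n * ∫ x, -h x ∂(S.Q n)} := fun ω hω => by
    simp only [integral_neg, Finset.sum_neg_distrib, Set.mem_union, Set.mem_ofPred_eq] at hω ⊢
    rcases le_abs.1 hω with h | h
    · exact Or.inl h
    · right; linarith
  refine (measure_mono hsub).trans ((measure_union_le _ _).trans ?_)
  rw [two_mul, ENNReal.ofReal_add (Real.exp_nonneg _) (Real.exp_nonneg _)]
  refine add_le_add ?_ ?_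
  · rw [← ofReal_measureReal]; exact ENNReal.ofReal_le_ofReal h1
  · rw [← ofReal_measureReal]; exact ENNReal.ofReal_le_ofReal h2

/-- The indicator that all entries of `x` in `J` are at most `T` in absolute value. -/
noncomputable def trunc {p : ℕ} (T : ℝ) (J : Finset (Fin p)) (x : Fin p → ℝ) : ℝ :=
  Set.indicator {x | ∀ l ∈ J, |x l| ≤ T} 1 x

lemma measurable_trunc {p : ℕ} (T : ℝ) (J : Finset (Fin p)) : Measurable (trunc T J) := by
  refine measurable_one.indicator ?_
  have : {x : Fin p → ℝ | ∀ l ∈ J, |x l| ≤ T} = ⋂ l ∈ J, {x | |x l| ≤ T} := by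
    ext x; simp
  rw [this]
  exact Finset.measurableSet_biInter _ fun l _ =>
    measurableSet_le (measurable_pi_apply l).abs measurable_const

lemma trunc_of_mem {p : ℕ} {T : ℝ} {J : Finset (Fin p)} {x : Fin p → ℝ}
    (h : ∀ l ∈ J, |x l| ≤ T) : trunc T J x = 1 := by
  rw [trunc, Set.indicator_of_mem (by simpa using h)]; rfl

lemma trunc_of_notMem {p : ℕ} {T : ℝ} {J : Finset (Fin p)} {x : Fin p → ℝ}
    (h : ¬ ∀ l ∈ J, |x l| ≤ T) : trunc T J x = 0 := by
  rw [trunc, Set.indicator_of_notMem (by simpa using h)]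

/-- The event that the truncated empirical second moments in models of size at most `m` are close
to their expectations. -/
def momentEvent (n m : ℕ) (T ε : ℝ) : Set (S.Ω n) :=
  {ω | ∀ J : Finset (Fin (S.p n)), J.card ≤ m → ∀ j ∈ J, ∀ k ∈ J,
    |∑ i, S.X n i ω j * S.X n i ω k * trunc T J (S.X n i ω)
      - n * ∫ x, x j * x k * trunc T J x ∂(S.Q n)| < n * ε}

lemma card_filter_card_le {p : ℕ} (hp : 1 ≤ p) (m : ℕ) :
    (Finset.univ.filter fun J : Finset (Fin p) => J.card ≤ m).card ≤ (m + 1) * p ^ m := by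
  have hsub : (Finset.univ.filter fun J : Finset (Fin p) => J.card ≤ m) ⊆
      (Finset.range (m + 1)).biUnion fun k => Finset.powersetCard k Finset.univ := fun J hJ => by
    simp only [Finset.mem_filter, Finset.mem_univ, true_and] at hJ
    simp only [Finset.mem_biUnion, Finset.mem_range, Finset.mem_powersetCard]
    exact ⟨J.card, by omega, Finset.subset_univ _, rfl⟩
  refine (Finset.card_le_card hsub).trans (Finset.card_biUnion_le.trans ?_)
  calc ∑ k ∈ Finset.range (m + 1), (Finset.powersetCard k (Finset.univ : Finset (Fin p))).card
      ≤ ∑ _k ∈ Finset.range (m + 1), p ^ m := by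
        refine Finset.sum_le_sum fun k hk => ?_
        rw [Finset.card_powersetCard, Finset.card_univ, Fintype.card_fin]
        exact (Nat.choose_le_pow p k).trans
          (Nat.pow_le_pow_right hp (by simp only [Finset.mem_range] at hk; omega))
    _ = (m + 1) * p ^ m := by simp

lemma measure_compl_momentEvent_le (hν : IsExpFamilyBase ν) (n m : ℕ) {T ε : ℝ} (hT : 0 ≤ T)
    (hε : 0 ≤ ε) :
    S.P n (S.momentEvent n m T ε)ᶜ ≤ ENNReal.ofReal
      ((m + 1) * (S.p n : ℝ) ^ m * (m * (m * (2 * Real.exp (-(n * (ε ^ 2 / (2 * T ^ 4)))))))) := by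
  set e := Real.exp (-(n * (ε ^ 2 / (2 * T ^ 4)))) with he
  set F := Finset.univ.filter fun J : Finset (Fin (S.p n)) => J.card ≤ m with hF
  let B : Finset (Fin (S.p n)) → Fin (S.p n) → Fin (S.p n) → Set (S.Ω n) := fun J j k =>
    {ω | n * ε ≤ |∑ i, S.X n i ω j * S.X n i ω k * trunc T J (S.X n i ω)
      - n * ∫ x, x j * x k * trunc T J x ∂(S.Q n)|}
  have hsub : (S.momentEvent n m T ε)ᶜ ⊆ ⋃ J ∈ F, ⋃ j ∈ J, ⋃ k ∈ J, B J j k := fun ω hω => by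
    simp only [momentEvent, Set.mem_compl_iff, Set.mem_ofPred_eq, not_forall, not_lt] at hω
    obtain ⟨J, hJ, j, hj, k, hk, h⟩ := hω
    simp only [Set.mem_iUnion]
    exact ⟨J, by simp [hF, hJ], j, hj, k, hk, h⟩
  have hB : ∀ J, ∀ j ∈ J, ∀ k ∈ J, S.P n (B J j k) ≤ ENNReal.ofReal (2 * e) := by
    intro J j hj k hk
    have h := S.measure_abs_sum_sub_ge_le hν n (h := fun x => x j * x k * trunc T J x)
      (((measurable_pi_apply j).mul (measurable_pi_apply k)).mul (measurable_trunc T J))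
      -- Products of two truncated entries are at most `T²`, hence the `T⁴` in the exponent.
      (B := T ^ 2) (fun x => ?_) hε
    · rwa [← pow_mul] at h
    · by_cases hx : ∀ l ∈ J, |x l| ≤ T
      · rw [trunc_of_mem hx, mul_one, abs_mul, pow_two]
        exact mul_le_mul (hx j hj) (hx k hk) (abs_nonneg _) hT
      · rw [trunc_of_notMem hx, mul_zero, abs_zero]; positivity
  have he0 : 0 ≤ e := Real.exp_nonneg _
  calc S.P n (S.momentEvent n m T ε)ᶜ
      ≤ ∑ J ∈ F, ∑ j ∈ J, ∑ k ∈ J, S.P n (B J j k) := by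
        refine (measure_mono hsub).trans ((measure_biUnion_finset_le _ _).trans ?_)
        refine Finset.sum_le_sum fun J _ => (measure_biUnion_finset_le _ _).trans ?_
        exact Finset.sum_le_sum fun j _ => measure_biUnion_finset_le _ _
    _ ≤ ∑ J ∈ F, ENNReal.ofReal (m * (m * (2 * e))) := by
        refine Finset.sum_le_sum fun J hJ => ?_
        have hJm : (J.card : ℝ) ≤ m := by
          simp only [hF, Finset.mem_filter, Finset.mem_univ, true_and] at hJ
          exact_mod_cast hJ
        calc ∑ j ∈ J, ∑ k ∈ J, S.P n (B J j k)
            ≤ ∑ _j ∈ J, ∑ _k ∈ J, ENNReal.ofReal (2 * e) :=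
              Finset.sum_le_sum fun j hj => Finset.sum_le_sum fun k hk => hB J j hj k hk
          _ = ENNReal.ofReal (J.card * (J.card * (2 * e))) := by
              simp only [Finset.sum_const, nsmul_eq_mul]
              rw [ENNReal.ofReal_mul (p := (J.card : ℝ)) (by positivity),
                ENNReal.ofReal_mul (p := (J.card : ℝ)) (by positivity), ENNReal.ofReal_natCast]
          _ ≤ _ := ENNReal.ofReal_le_ofReal (by gcongr)
    _ = ENNReal.ofReal (F.card * (m * (m * (2 * e)))) := by
        rw [Finset.sum_const, nsmul_eq_mul, ENNReal.ofReal_mul (p := (F.card : ℝ))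
          (by positivity), ENNReal.ofReal_natCast]
    _ ≤ _ := by
        refine ENNReal.ofReal_le_ofReal ?_
        have : (F.card : ℝ) ≤ (m + 1) * (S.p n : ℝ) ^ m := by
          exact_mod_cast card_filter_card_le (S.one_le_p n) m
        gcongr

lemma integrable_pow_four {A : ℝ} {n : ℕ} {j : Fin (S.p n)}
    (h : ∫⁻ x, ENNReal.ofReal (x j ^ 4) ∂(S.Q n) ≤ ENNReal.ofReal A) :
    Integrable (fun x => x j ^ 4) (S.Q n) :=
  ⟨((measurable_pi_apply j).pow_const 4).aestronglyMeasurable, by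
    rw [hasFiniteIntegral_iff_ofReal (ae_of_all _ fun x => by positivity)]
    exact h.trans_lt ENNReal.ofReal_lt_top⟩

/-- The elementary domination `|xy| ≤ 1 + x⁴ + y⁴` is enough. -/
lemma integrable_mul_of_pow_four {n : ℕ} {j k : Fin (S.p n)}
    (hj : Integrable (fun x => x j ^ 4) (S.Q n)) (hk : Integrable (fun x => x k ^ 4) (S.Q n)) :
    Integrable (fun x => x j * x k) (S.Q n) := by
  refine ((integrable_const (1 : ℝ)).add (hj.add hk)).mono'
    ((measurable_pi_apply j).mul (measurable_pi_apply k)).aestronglyMeasurable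
    (ae_of_all _ fun x => ?_)
  simp only [Pi.add_apply, Real.norm_eq_abs]
  rw [abs_le]
  constructor <;> nlinarith [sq_nonneg (x j + x k), sq_nonneg (x j - x k),
    sq_nonneg (x j ^ 2 - 1), sq_nonneg (x k ^ 2 - 1)]

lemma sum_mul_secondMoment_ge {q : ℕ} {a₁ a₂ a₃ : ℝ} (hS : S.SparseRegime q a₁ a₂ a₃) {n : ℕ}
    {J : Finset (Fin (S.p n))} (hJ : J.card ≤ 2 * q) (d : Fin (S.p n) → ℝ) :
    a₁ * ∑ j ∈ J, d j ^ 2 ≤ ∑ j ∈ J, ∑ k ∈ J, d j * d k * ∫ x, x j * x k ∂(S.Q n) := by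
  have h := (hS.eigen_lower n J hJ).dotProduct_mulVec_nonneg (fun j => d j)
  rw [Matrix.sub_mulVec, dotProduct_sub, Matrix.smul_mulVec, Matrix.one_mulVec,
    dotProduct_smul, sub_nonneg] at h
  simp only [star_trivial, dotProduct, smul_eq_mul, Matrix.mulVec, secondMoment,
    Matrix.of_apply] at h
  simp only [Finset.mul_sum] at h ⊢
  rw [← Finset.sum_coe_sort J, ← Finset.sum_coe_sort J]
  refine (le_of_eq ?_).trans (h.trans (le_of_eq ?_))
  · exact Finset.sum_congr rfl fun j _ => by ring
  · refine Finset.sum_congr rfl fun j _ => ?_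
    rw [← Finset.sum_coe_sort J]
    exact Finset.sum_congr rfl fun k _ => by ring

end GLMSequence

/-! ### Restricted curvature of the log-likelihood. -/

namespace GLMSequence

variable {ν : Measure ℝ} (S : GLMSequence ν)

/-- If an entry exceeds `T`, then `∑ x_j²` is at least `T²` and so at most its own square divided by
`T²`. Two applications of Cauchy–Schwarz give the fourth powers. -/
lemma sq_sum_mul_one_sub_trunc_le {p m : ℕ} {J : Finset (Fin p)} (hJ : J.card ≤ m) {T : ℝ}
    (hT : 0 < T) (d x : Fin p → ℝ) :
    (∑ j ∈ J, d j * x j) ^ 2 * (1 - trunc T J x)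
      ≤ (∑ j ∈ J, d j ^ 2) * m / T ^ 2 * ∑ j ∈ J, x j ^ 4 := by
  have hd : 0 ≤ ∑ j ∈ J, d j ^ 2 := Finset.sum_nonneg fun _ _ => sq_nonneg _
  have hx4 : 0 ≤ ∑ j ∈ J, x j ^ 4 := Finset.sum_nonneg fun _ _ => by positivity
  by_cases hx : ∀ l ∈ J, |x l| ≤ T
  · rw [trunc_of_mem hx, sub_self, mul_zero]
    positivity
  · rw [trunc_of_notMem hx, sub_zero, mul_one]
    push Not at hx
    obtain ⟨l, hl, hlT⟩ := hx
    have h1 : (∑ j ∈ J, d j * x j) ^ 2 ≤ (∑ j ∈ J, d j ^ 2) * ∑ j ∈ J, x j ^ 2 :=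
      Finset.sum_mul_sq_le_sq_mul_sq J d x
    have h2 : T ^ 2 ≤ ∑ j ∈ J, x j ^ 2 := by
      refine le_trans ?_ (Finset.single_le_sum (f := fun j => x j ^ 2)
        (fun _ _ => sq_nonneg _) hl)
      rw [← sq_abs (x l)]
      exact pow_le_pow_left₀ hT.le hlT.le 2
    have h3 : (∑ j ∈ J, x j ^ 2) ^ 2 ≤ m * ∑ j ∈ J, x j ^ 4 := by
      refine (sq_sum_le_card_mul_sum_sq (s := J) (f := fun j => x j ^ 2)).trans ?_
      simp only [← pow_mul]
      exact mul_le_mul_of_nonneg_right (by exact_mod_cast hJ) hx4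
    have h4 : ∑ j ∈ J, x j ^ 2 ≤ m * (∑ j ∈ J, x j ^ 4) / T ^ 2 := by
      rw [le_div_iff₀ (by positivity)]
      refine le_trans ?_ h3
      rw [pow_two (∑ j ∈ J, x j ^ 2)]
      exact mul_le_mul_of_nonneg_left h2 (Finset.sum_nonneg fun _ _ => sq_nonneg _)
    calc _ ≤ (∑ j ∈ J, d j ^ 2) * (m * (∑ j ∈ J, x j ^ 4) / T ^ 2) :=
          h1.trans (mul_le_mul_of_nonneg_left h4 hd)
      _ = _ := by ring

lemma sq_sum_mul_eq {p : ℕ} (J : Finset (Fin p)) (d x : Fin p → ℝ) :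
    (∑ j ∈ J, d j * x j) ^ 2 = ∑ j ∈ J, ∑ k ∈ J, d j * d k * (x j * x k) := by
  rw [pow_two, Finset.sum_mul_sum]
  exact Finset.sum_congr rfl fun j _ => Finset.sum_congr rfl fun k _ => by ring

/-- Truncation lowers the quadratic form by the integral over rows with a large entry, which fourth
moments make small for large `T`. -/
lemma sum_mul_truncMoment_ge {q : ℕ} {a₁ a₂ a₃ A : ℝ} (hS : S.SparseRegime q a₁ a₂ a₃) {n : ℕ}
    {J : Finset (Fin (S.p n))} (hJ : J.card ≤ 2 * q)
    (hA : 0 ≤ A) (hA4 : ∀ j, ∫⁻ x, ENNReal.ofReal (x j ^ 4) ∂(S.Q n) ≤ ENNReal.ofReal A)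
    {T : ℝ} (hT : 0 < T) (d : Fin (S.p n) → ℝ) :
    (a₁ - (2 * q : ℕ) ^ 2 * A / T ^ 2) * ∑ j ∈ J, d j ^ 2
      ≤ ∑ j ∈ J, ∑ k ∈ J, d j * d k * ∫ x, x j * x k * trunc T J x ∂(S.Q n) := by
  have hd : 0 ≤ ∑ j ∈ J, d j ^ 2 := Finset.sum_nonneg fun _ _ => sq_nonneg _
  have h4 : ∀ j, Integrable (fun x => x j ^ 4) (S.Q n) := fun j => S.integrable_pow_four (hA4 j)
  have h4le : ∀ j, ∫ x, x j ^ 4 ∂(S.Q n) ≤ A := fun j => by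
    rw [integral_eq_lintegral_of_nonneg_ae (ae_of_all _ fun x => by positivity)
      (h4 j).aestronglyMeasurable]
    exact ENNReal.toReal_le_of_le_ofReal hA (hA4 j)
  have h2 : ∀ j k, Integrable (fun x => x j * x k) (S.Q n) := fun j k =>
    S.integrable_mul_of_pow_four (h4 j) (h4 k)
  have htr : ∀ x : Fin (S.p n) → ℝ, ‖trunc T J x‖ ≤ 1 := fun x => by
    by_cases hx : ∀ l ∈ J, |x l| ≤ T
    · rw [trunc_of_mem hx]; simp
    · rw [trunc_of_notMem hx]; simp
  have h2t : ∀ j k, Integrable (fun x => x j * x k * trunc T J x) (S.Q n) := fun j k =>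
    (h2 j k).mul_bdd (measurable_trunc T J).aestronglyMeasurable (ae_of_all _ htr)
  have e1 : ∫ x, (∑ j ∈ J, d j * x j) ^ 2 * (1 - trunc T J x) ∂(S.Q n)
      = ∑ j ∈ J, ∑ k ∈ J, d j * d k * ∫ x, x j * x k ∂(S.Q n)
        - ∑ j ∈ J, ∑ k ∈ J, d j * d k * ∫ x, x j * x k * trunc T J x ∂(S.Q n) := by
    rw [← Finset.sum_sub_distrib]
    simp_rw [← Finset.sum_sub_distrib, ← mul_sub]
    have : ∀ x : Fin (S.p n) → ℝ, (∑ j ∈ J, d j * x j) ^ 2 * (1 - trunc T J x)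
        = ∑ j ∈ J, ∑ k ∈ J, d j * d k * (x j * x k - x j * x k * trunc T J x) := fun x => by
      rw [sq_sum_mul_eq, Finset.sum_mul]
      refine Finset.sum_congr rfl fun j _ => ?_
      rw [Finset.sum_mul]
      exact Finset.sum_congr rfl fun k _ => by ring
    simp_rw [this]
    have hi : ∀ j k, Integrable
        (fun x => d j * d k * (x j * x k - x j * x k * trunc T J x)) (S.Q n) := fun j k =>
      ((h2 j k).sub (h2t j k)).const_mul _
    rw [integral_finsetSum _ fun j _ => integrable_finsetSum _ fun k _ => hi j k]
    refine Finset.sum_congr rfl fun j _ => ?_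
    rw [integral_finsetSum _ fun k _ => hi j k]
    refine Finset.sum_congr rfl fun k _ => ?_
    rw [integral_const_mul, integral_sub (h2 j k) (h2t j k)]
  have e2 : ∫ x, (∑ j ∈ J, d j * x j) ^ 2 * (1 - trunc T J x) ∂(S.Q n)
      ≤ (2 * q : ℕ) ^ 2 * A / T ^ 2 * ∑ j ∈ J, d j ^ 2 := by
    have hnn : ∀ x : Fin (S.p n) → ℝ, 0 ≤ (∑ j ∈ J, d j * x j) ^ 2 * (1 - trunc T J x) :=
      fun x => mul_nonneg (sq_nonneg _) (sub_nonneg.2 ((le_abs_self _).trans (htr x)))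
    calc _ ≤ ∫ x, (∑ j ∈ J, d j ^ 2) * (2 * q : ℕ) / T ^ 2 * ∑ j ∈ J, x j ^ 4 ∂(S.Q n) :=
          integral_mono_of_nonneg (ae_of_all _ hnn)
            ((integrable_finsetSum _ fun j _ => h4 j).const_mul _)
            (ae_of_all _ fun x => sq_sum_mul_one_sub_trunc_le hJ hT d x)
      _ = (∑ j ∈ J, d j ^ 2) * (2 * q : ℕ) / T ^ 2 * ∑ j ∈ J, ∫ x, x j ^ 4 ∂(S.Q n) := by
          rw [integral_const_mul, integral_finsetSum _ fun j _ => h4 j]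
      _ ≤ (∑ j ∈ J, d j ^ 2) * (2 * q : ℕ) / T ^ 2 * ((2 * q : ℕ) * A) := by
          refine mul_le_mul_of_nonneg_left ?_ (by positivity)
          calc ∑ j ∈ J, ∫ x, x j ^ 4 ∂(S.Q n) ≤ ∑ _j ∈ J, A := Finset.sum_le_sum fun j _ => h4le j
            _ = J.card * A := by rw [Finset.sum_const, nsmul_eq_mul]
            _ ≤ (2 * q : ℕ) * A := mul_le_mul_of_nonneg_right (by exact_mod_cast hJ) hA
      _ = _ := by ring
  have h5 := S.sum_mul_secondMoment_ge hS hJ d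
  rw [sub_mul]
  linarith

lemma abs_coord_le_norm {q : ℕ} {a₁ a₂ a₃ : ℝ} (hS : S.SparseRegime q a₁ a₂ a₃) (n : ℕ)
    (j : Fin (S.p n)) : |S.φ n j| ≤ a₃ := by
  rw [← Real.norm_eq_abs]
  exact (PiLp.norm_apply_le (S.φ n) j).trans (hS.signal_upper n)

lemma abs_dotProduct_le_of_support {p m : ℕ} {J : Finset (Fin p)} (hJ : J.card ≤ m) {T δ : ℝ}
    (hT : 0 ≤ T) (hδ : 0 ≤ δ) {x d : Fin p → ℝ} (hx : ∀ j ∈ J, |x j| ≤ T)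
    (hd : ∀ j, |d j| ≤ δ) (hdJ : ∀ j ∉ J, d j = 0) : |x ⬝ᵥ d| ≤ m * δ * T := by
  rw [dotProduct_comm]
  exact abs_sum_mul_le_of_support hJ hdJ hδ (fun j _ => hd j) hx hT

/-- The event that the log-likelihood has restricted curvature at least `c` around the true
parameter vector. -/
def curvatureEvent (n m : ℕ) (c : ℝ) : Set (S.Ω n) :=
  {ω | ∀ J : Finset (Fin (S.p n)), J.card ≤ m → S.trueModel n ⊆ J →
    ∀ d : Fin (S.p n) → ℝ, (∀ j ∉ J, d j = 0) →
      c * n * min (√(∑ j, d j ^ 2)) (∑ j, d j ^ 2)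
        ≤ ∑ i, bregman ν (S.X n i ω ⬝ᵥ (S.φ n).ofLp) (S.X n i ω ⬝ᵥ d)}

/-- On rows with entries at most `T`, all linear predictors stay in a compact interval, where the
Bregman remainder dominates `c₀ u²`. Of the eigenvalue bound `a₁`, truncation takes at most one half
and the empirical deviation one quarter. The remaining rows contribute nonnegative terms. -/
lemma momentEvent_subset_curvatureEvent (hν : IsExpFamilyBase ν) {q : ℕ} {a₁ a₂ a₃ A T ε c₀ : ℝ}
    (hS : S.SparseRegime q a₁ a₂ a₃) {n : ℕ} (hA : 0 ≤ A)
    (hA4 : ∀ j, ∫⁻ x, ENNReal.ofReal (x j ^ 4) ∂(S.Q n) ≤ ENNReal.ofReal A) (ha₃ : 0 ≤ a₃)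
    (hT : 0 < T) (hTa : (2 * q : ℕ) ^ 2 * A / T ^ 2 ≤ a₁ / 2) (hε : 0 ≤ ε)
    (hεa : (2 * q : ℕ) * ε ≤ a₁ / 4) (hc₀ : 0 ≤ c₀)
    (hc : ∀ θ u, |θ| ≤ (2 * q : ℕ) * (a₃ + 1) * T → |u| ≤ (2 * q : ℕ) * (a₃ + 1) * T →
      c₀ * u ^ 2 ≤ bregman ν θ u) :
    S.momentEvent n (2 * q) T ε ⊆ S.curvatureEvent n (2 * q) (c₀ * (a₁ / 4)) := by
  intro ω hω
  simp only [momentEvent, curvatureEvent, Set.mem_ofPred_eq] at hω ⊢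
  intro J hJ hJs
  have quad : ∀ d : Fin (S.p n) → ℝ, (∀ j ∉ J, d j = 0) → n * (a₁ / 4) * ∑ j, d j ^ 2
      ≤ ∑ i, (S.X n i ω ⬝ᵥ d) ^ 2 * trunc T J (S.X n i ω) := by
    intro d hd
    have hsum : ∑ j, d j ^ 2 = ∑ j ∈ J, d j ^ 2 :=
      (Finset.sum_subset (Finset.subset_univ J) fun j _ hj => by rw [hd j hj]; ring).symm
    have hdot : ∀ i, S.X n i ω ⬝ᵥ d = ∑ j ∈ J, d j * S.X n i ω j := fun i => by
      rw [dotProduct_comm, dotProduct]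
      exact (Finset.sum_subset (Finset.subset_univ J)
        fun j _ hj => by rw [hd j hj, zero_mul]).symm
    have e1 : ∑ i, (S.X n i ω ⬝ᵥ d) ^ 2 * trunc T J (S.X n i ω)
        = ∑ j ∈ J, ∑ k ∈ J, d j * d k *
          ∑ i, S.X n i ω j * S.X n i ω k * trunc T J (S.X n i ω) := by
      simp_rw [hdot, sq_sum_mul_eq, Finset.sum_mul, Finset.mul_sum]
      rw [Finset.sum_comm]
      refine Finset.sum_congr rfl fun j _ => ?_
      rw [Finset.sum_comm]
      exact Finset.sum_congr rfl fun k _ => Finset.sum_congr rfl fun i _ => by ring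
    have h1 := S.sum_mul_truncMoment_ge hS hJ hA hA4 hT d
    have h2 : |∑ j ∈ J, ∑ k ∈ J, d j * d k *
        (∑ i, S.X n i ω j * S.X n i ω k * trunc T J (S.X n i ω)
          - n * ∫ x, x j * x k * trunc T J x ∂(S.Q n))| ≤ n * ε * ((2 * q : ℕ) *
            ∑ j ∈ J, d j ^ 2) := by
      calc _ ≤ ∑ j ∈ J, ∑ k ∈ J, |d j| * |d k| * (n * ε) := by
            refine (Finset.abs_sum_le_sum_abs _ _).trans (Finset.sum_le_sum fun j hj => ?_)
            refine (Finset.abs_sum_le_sum_abs _ _).trans (Finset.sum_le_sum fun k hk => ?_)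
            rw [abs_mul, abs_mul]
            exact mul_le_mul_of_nonneg_left (hω J hJ j hj k hk).le (by positivity)
        _ = n * ε * (∑ j ∈ J, |d j|) ^ 2 := by
            simp_rw [← Finset.sum_mul]
            rw [pow_two, Finset.sum_mul_sum]; ring
        _ ≤ n * ε * ((2 * q : ℕ) * ∑ j ∈ J, d j ^ 2) := by
            refine mul_le_mul_of_nonneg_left ?_ (by positivity)
            refine (sq_sum_le_card_mul_sum_sq (s := J) (f := fun j => |d j|)).trans ?_
            simp only [sq_abs]
            exact mul_le_mul_of_nonneg_right (by exact_mod_cast hJ)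
              (Finset.sum_nonneg fun _ _ => sq_nonneg _)
    have e3 : ∑ j ∈ J, ∑ k ∈ J, d j * d k *
        (∑ i, S.X n i ω j * S.X n i ω k * trunc T J (S.X n i ω)
          - n * ∫ x, x j * x k * trunc T J x ∂(S.Q n))
        = ∑ i, (S.X n i ω ⬝ᵥ d) ^ 2 * trunc T J (S.X n i ω)
          - n * ∑ j ∈ J, ∑ k ∈ J, d j * d k * ∫ x, x j * x k * trunc T J x ∂(S.Q n) := by
      rw [e1]
      simp_rw [mul_sub, Finset.sum_sub_distrib, Finset.mul_sum]
      congr 1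
      exact Finset.sum_congr rfl fun j _ => Finset.sum_congr rfl fun k _ => by ring
    rw [e3] at h2
    have hD : 0 ≤ ∑ j ∈ J, d j ^ 2 := Finset.sum_nonneg fun _ _ => sq_nonneg _
    have h3 := (abs_le.1 h2).1
    have hn : (0 : ℝ) ≤ n := Nat.cast_nonneg n
    have h4 := mul_le_mul_of_nonneg_left h1 hn
    have h5 := mul_le_mul_of_nonneg_right hεa (mul_nonneg hn hD)
    have h6 := mul_le_mul_of_nonneg_right hTa (mul_nonneg hn hD)
    rw [hsum]
    nlinarith
  have small : ∀ d : Fin (S.p n) → ℝ, (∀ j ∉ J, d j = 0) → ∑ j, d j ^ 2 ≤ 1 →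
      c₀ * (a₁ / 4) * n * ∑ j, d j ^ 2
        ≤ ∑ i, bregman ν (S.X n i ω ⬝ᵥ (S.φ n).ofLp) (S.X n i ω ⬝ᵥ d) := by
    intro d hd hd1
    have hdj : ∀ j, |d j| ≤ a₃ + 1 := fun j => by
      have h1 : d j ^ 2 ≤ 1 := (Finset.single_le_sum (f := fun j => d j ^ 2)
        (fun _ _ => sq_nonneg _) (Finset.mem_univ j)).trans hd1
      have := (sq_le_one_iff_abs_le_one _).1 h1
      linarith
    have hφ : ∀ j, |(S.φ n).ofLp j| ≤ a₃ + 1 := fun j =>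
      (S.abs_coord_le_norm hS n j).trans (by linarith)
    have hφJ : ∀ j ∉ J, (S.φ n).ofLp j = 0 := fun j hj => by
      by_contra h
      exact hj (hJs (by simpa [trueModel] using h))
    calc c₀ * (a₁ / 4) * n * ∑ j, d j ^ 2 = c₀ * (n * (a₁ / 4) * ∑ j, d j ^ 2) := by ring
      _ ≤ c₀ * ∑ i, (S.X n i ω ⬝ᵥ d) ^ 2 * trunc T J (S.X n i ω) :=
          mul_le_mul_of_nonneg_left (quad d hd) hc₀
      _ ≤ _ := by
          rw [Finset.mul_sum]
          refine Finset.sum_le_sum fun i _ => ?_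
          by_cases hx : ∀ l ∈ J, |S.X n i ω l| ≤ T
          · rw [trunc_of_mem hx, mul_one]
            exact hc _ _ (abs_dotProduct_le_of_support hJ hT.le (by linarith) hx hφ hφJ)
              (abs_dotProduct_le_of_support hJ hT.le (by linarith) hx hdj hd)
          -- A row outside the truncation is discarded, since its Bregman term is nonnegative.
          · rw [trunc_of_notMem hx, mul_zero, mul_zero]
            exact hν.bregman_nonneg _ _
  intro d hd
  have hD0 : 0 ≤ ∑ j, d j ^ 2 := Finset.sum_nonneg fun _ _ => sq_nonneg _
  -- The sign of `a₁` is not assumed here; for a negative constant the claim is trivial.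
  by_cases hcn : 0 ≤ c₀ * (a₁ / 4) * n
  swap
  · refine le_trans ?_ (Finset.sum_nonneg fun i _ => hν.bregman_nonneg _ _)
    exact mul_nonpos_of_nonpos_of_nonneg (not_le.1 hcn).le (le_min (Real.sqrt_nonneg _) hD0)
  rcases le_total (∑ j, d j ^ 2) 1 with h1 | h1
  · exact (mul_le_mul_of_nonneg_left (min_le_right _ _) hcn).trans (small d hd h1)
  -- Beyond the unit sphere, the bound for `D⁻¹ d` is scaled up by convexity.
  · set D := √(∑ j, d j ^ 2) with hDdef
    have hD1 : 1 ≤ D := Real.one_le_sqrt.2 h1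
    have hDpos : 0 < D := by linarith
    have hD2 : D ^ 2 = ∑ j, d j ^ 2 := Real.sq_sqrt hD0
    have e : ∑ j, (D⁻¹ * d j) ^ 2 = 1 := by
      simp_rw [mul_pow, ← Finset.mul_sum, ← hD2]
      field_simp
    have h2 := small (fun j => D⁻¹ * d j) (fun j hj => by rw [hd j hj, mul_zero]) e.le
    rw [e, mul_one] at h2
    calc _ ≤ c₀ * (a₁ / 4) * n * D := mul_le_mul_of_nonneg_left (min_le_left _ _) hcn
      _ ≤ (∑ i, bregman ν (S.X n i ω ⬝ᵥ (S.φ n).ofLp)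
            (S.X n i ω ⬝ᵥ fun j => D⁻¹ * d j)) * D := mul_le_mul_of_nonneg_right h2 hDpos.le
      _ ≤ _ := by
          rw [Finset.sum_mul]
          refine Finset.sum_le_sum fun i _ => ?_
          rw [mul_comm]
          refine (hν.mul_bregman_le _ _ hD1).trans (le_of_eq ?_)
          congr 1
          have : (fun j => D⁻¹ * d j) = D⁻¹ • d := rfl
          rw [this, dotProduct_smul, smul_eq_mul, mul_inv_cancel_left₀ hDpos.ne']

lemma exists_measure_compl_curvatureEvent_le (hν : IsExpFamilyBase ν) {q : ℕ}
    {a₁ a₂ a₃ A : ℝ} (ha₁ : 0 < a₁) (ha₃ : 0 ≤ a₃) (hS : S.SparseRegime q a₁ a₂ a₃) (hA : 0 ≤ A)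
    (hA4 : ∀ n j, ∫⁻ x, ENNReal.ofReal (x j ^ 4) ∂(S.Q n) ≤ ENNReal.ofReal A) :
    ∃ c δ C : ℝ, 0 < c ∧ 0 < δ ∧ 0 ≤ C ∧ ∀ n, S.P n (S.curvatureEvent n (2 * q) c)ᶜ
      ≤ ENNReal.ofReal (C * (S.p n : ℝ) ^ (2 * q) * Real.exp (-(n * δ))) := by
  set m : ℕ := 2 * q with hm
  -- Since `T ≥ 1`, one has `a₁ T² ≥ a₁ T ≥ 2 m² A`: truncation costs at most `a₁ / 2`.
  set T : ℝ := 1 + 2 * (m ^ 2 * A) / a₁ with hTdef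
  have hq : 0 ≤ 2 * ((m : ℝ) ^ 2 * A) / a₁ := by positivity
  have hT1 : 1 ≤ T := by linarith
  have hT : 0 < T := by linarith
  set ε : ℝ := a₁ / (4 * (m + 1)) with hε
  obtain ⟨c₀, hc₀, hc⟩ := hν.exists_le_bregman ((m : ℝ) * (a₃ + 1) * T)
  refine ⟨c₀ * (a₁ / 4), ε ^ 2 / (2 * T ^ 4), (m + 1) * (m * (m * 2)), by positivity,
    by positivity, by positivity, fun n => ?_⟩
  refine (measure_mono (Set.compl_subset_compl.2 (S.momentEvent_subset_curvatureEvent hν hS hA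
    (hA4 n) ha₃ hT (c₀ := c₀) ?_ (ε := ε) (by positivity) ?_ hc₀.le hc))).trans
    ((S.measure_compl_momentEvent_le hν n m hT.le (by positivity)).trans (le_of_eq ?_))
  · rw [div_le_iff₀ (by positivity)]
    have h1 : T ≤ T ^ 2 := by nlinarith
    have h2 : 2 * ((m : ℝ) ^ 2 * A) ≤ a₁ * T := by
      rw [hTdef, mul_add, mul_div_cancel₀ _ ha₁.ne']; nlinarith
    nlinarith
  · rw [hε, mul_div_assoc', div_le_div_iff₀ (by positivity) (by norm_num)]
    have : (0 : ℝ) ≤ m := Nat.cast_nonneg _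
    rw [← hm]
    nlinarith
  · congr 1; ring

end GLMSequence

/-! ### Integrated likelihoods relative to the likelihood of the truth. -/

/-- Extension by zero of a parameter vector of the model `J`. -/
noncomputable def extendZero {p : ℕ} {J : Finset (Fin p)} (ψ : EuclideanSpace ℝ J) : Fin p → ℝ :=
  fun j => if h : j ∈ J then ψ ⟨j, h⟩ else 0

lemma extendZero_of_mem {p : ℕ} {J : Finset (Fin p)} (ψ : EuclideanSpace ℝ J) {j : Fin p}
    (h : j ∈ J) : extendZero ψ j = ψ ⟨j, h⟩ := by simp [extendZero, h]

lemma extendZero_of_notMem {p : ℕ} {J : Finset (Fin p)} (ψ : EuclideanSpace ℝ J) {j : Fin p}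
    (h : j ∉ J) : extendZero ψ j = 0 := by simp [extendZero, h]

lemma sum_mul_eq_dotProduct_extendZero {p : ℕ} {J : Finset (Fin p)} (ψ : EuclideanSpace ℝ J)
    (x : Fin p → ℝ) : ∑ j : J, x j * ψ j = x ⬝ᵥ extendZero ψ := by
  rw [dotProduct, ← Finset.sum_subset (Finset.subset_univ J)
    (fun j _ hj => by rw [extendZero_of_notMem ψ hj, mul_zero]), ← Finset.sum_coe_sort J]
  exact Finset.sum_congr rfl fun j _ => by rw [extendZero_of_mem ψ j.2]

lemma measurable_extendZero {p : ℕ} (J : Finset (Fin p)) :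
    Measurable (extendZero : EuclideanSpace ℝ J → Fin p → ℝ) := by
  refine measurable_pi_iff.2 fun j => ?_
  by_cases h : j ∈ J
  · simp only [extendZero, h, dite_true]; fun_prop
  · simp only [extendZero, h, dite_false]; fun_prop

lemma logLik_eq {ν : Measure ℝ} {n p : ℕ} (φ : Fin p → ℝ) (X : Fin n → Fin p → ℝ)
    (Y : Fin n → ℝ) (J : Finset (Fin p)) (ψ : EuclideanSpace ℝ J) :
    logLik ν X Y J ψ = ∑ i, (Y i * (X i ⬝ᵥ φ) - cumulant ν (X i ⬝ᵥ φ))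
      + gain ν φ X Y (extendZero ψ - φ) := by
  rw [logLik, gain, ← Finset.sum_add_distrib]
  refine Finset.sum_congr rfl fun i _ => ?_
  rw [sum_mul_eq_dotProduct_extendZero, dotProduct_sub, add_sub_cancel]
  ring

/-- The cube of half-side `r` in the parameter space of the model `J`, around the restriction of
`φ`. -/
def paramCube {p : ℕ} (φ : Fin p → ℝ) (J : Finset (Fin p)) (r : ℝ) : Set (EuclideanSpace ℝ J) :=
  {ψ | ∀ j : J, |ψ j - φ j| < r}

lemma measurableSet_paramCube {p : ℕ} (φ : Fin p → ℝ) (J : Finset (Fin p)) (r : ℝ) :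
    MeasurableSet (paramCube φ J r) := by
  have : paramCube φ J r = ⋂ j : J, {ψ | |ψ j - φ j| < r} := by ext; simp [paramCube]
  rw [this]
  refine MeasurableSet.iInter fun j => measurableSet_lt (Measurable.abs ?_) measurable_const
  fun_prop

lemma volume_paramCube {p : ℕ} (φ : Fin p → ℝ) (J : Finset (Fin p)) (r : ℝ) :
    volume (paramCube φ J r) = ENNReal.ofReal (2 * r) ^ J.card := by
  have e : paramCube φ J r = (WithLp.ofLp : EuclideanSpace ℝ J → (J → ℝ)) ⁻¹'
      (Set.univ.pi fun j : J => Set.Ioo (φ j - r) (φ j + r)) := by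
    ext ψ
    simp only [paramCube, Set.mem_ofPred_eq, Set.mem_preimage, Set.mem_univ_pi, Set.mem_Ioo,
      abs_lt]
    exact forall_congr' fun j => ⟨fun h => ⟨by linarith [h.1], by linarith [h.2]⟩,
      fun h => ⟨by linarith [h.1], by linarith [h.2]⟩⟩
  rw [e, (PiLp.volume_preserving_ofLp J).measure_preimage
    (MeasurableSet.univ_pi fun _ => measurableSet_Ioo).nullMeasurableSet, volume_pi_pi]
  simp only [Real.volume_Ioo]
  have : ∀ j : J, φ j + r - (φ j - r) = 2 * r := fun j => by ring
  simp [this]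

namespace GLMSequence

variable {ν : Measure ℝ} (S : GLMSequence ν)

/-- The integrated likelihood of the model `J`, divided by the likelihood of the truth. -/
noncomputable def evidence (f : S.PriorFamily) (n : ℕ) (J : Finset (Fin (S.p n))) (ω : S.Ω n) :
    ℝ≥0∞ :=
  ∫⁻ ψ : EuclideanSpace ℝ J,
    ENNReal.ofReal (Real.exp (S.logRatio n (extendZero ψ - (S.φ n).ofLp) ω) * f n J ψ)

lemma bayes_eq (q : ℕ) (γ : ℝ) (f : S.PriorFamily) (n : ℕ) (J : Finset (Fin (S.p n)))
    (ω : S.Ω n) :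
    bayes ν q γ (f n) (fun i => S.X n i ω) (fun i => S.Y n i ω) J
      = ENNReal.ofReal (Real.exp (∑ i, (S.Y n i ω * (S.X n i ω ⬝ᵥ (S.φ n).ofLp)
          - cumulant ν (S.X n i ω ⬝ᵥ (S.φ n).ofLp))))
        * (ENNReal.ofReal (modelPrior (S.p n) q γ J) * S.evidence f n J ω) := by
  rw [bayes, evidence, mul_left_comm]
  congr 1
  rw [← lintegral_const_mul' _ _ ENNReal.ofReal_ne_top]
  refine lintegral_congr fun ψ => ?_
  rw [← ENNReal.ofReal_mul (Real.exp_nonneg _), ← mul_assoc, ← Real.exp_add,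
    logLik_eq (S.φ n).ofLp]
  rfl

/-- The likelihood of the truth is a common positive factor of all models and cancels. -/
lemma bayes_lt_bayes {q : ℕ} {γ : ℝ} {f : S.PriorFamily} {n : ℕ} {J J' : Finset (Fin (S.p n))}
    {ω : S.Ω n} (h : ENNReal.ofReal (modelPrior (S.p n) q γ J) * S.evidence f n J ω
      < ENNReal.ofReal (modelPrior (S.p n) q γ J') * S.evidence f n J' ω) :
    bayes ν q γ (f n) (fun i => S.X n i ω) (fun i => S.Y n i ω) J
      < bayes ν q γ (f n) (fun i => S.X n i ω) (fun i => S.Y n i ω) J' := by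
  rw [bayes_eq, bayes_eq]
  exact ENNReal.mul_lt_mul_right (by simp [Real.exp_pos]) ENNReal.ofReal_ne_top h

lemma measurable_logRatio_extendZero (hν : IsExpFamilyBase ν) (n : ℕ)
    (J : Finset (Fin (S.p n))) :
    Measurable fun z : S.Ω n × EuclideanSpace ℝ J =>
      ENNReal.ofReal (Real.exp (S.logRatio n (extendZero z.2 - (S.φ n).ofLp) z.1)) :=
  ((S.measurable_uncurry_logRatio hν n).comp (measurable_fst.prodMk
    (((measurable_extendZero J).comp measurable_snd).sub_const _))).exp.ennreal_ofReal

/-- The integral of the likelihood ratio over a cube around the true parameter vector. -/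
noncomputable def cubeIntegral (n : ℕ) (J : Finset (Fin (S.p n))) (r : ℝ) (ω : S.Ω n) : ℝ≥0∞ :=
  ∫⁻ ψ in paramCube (S.φ n).ofLp J r,
    ENNReal.ofReal (Real.exp (S.logRatio n (extendZero ψ - (S.φ n).ofLp) ω))

/-- By Fubini the mean is the volume of the cube, because every single likelihood ratio has mean
one. -/
lemma lintegral_cubeIntegral (hν : IsExpFamilyBase ν) (n : ℕ) (J : Finset (Fin (S.p n)))
    (r : ℝ) : ∫⁻ ω, S.cubeIntegral n J r ω ∂(S.P n) = ENNReal.ofReal (2 * r) ^ J.card := by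
  unfold cubeIntegral
  rw [lintegral_lintegral_swap (S.measurable_logRatio_extendZero hν n J).aemeasurable]
  simp_rw [S.lintegral_exp_logRatio hν]
  rw [setLIntegral_one, volume_paramCube]

lemma measure_cubeIntegral_ge_le (hν : IsExpFamilyBase ν) (n : ℕ) (J : Finset (Fin (S.p n)))
    {r u : ℝ} (hr : 0 ≤ r) (hu : 0 < u) :
    S.P n {ω | ENNReal.ofReal u ≤ S.cubeIntegral n J r ω}
      ≤ ENNReal.ofReal ((2 * r) ^ J.card / u) := by
  have hm : Measurable fun ω => S.cubeIntegral n J r ω :=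
    (S.measurable_logRatio_extendZero hν n J).lintegral_prod_right'
  refine (meas_ge_le_lintegral_div hm.aemeasurable (by simp [hu]) ENNReal.ofReal_ne_top).trans ?_
  rw [S.lintegral_cubeIntegral hν, ← ENNReal.ofReal_pow (by positivity),
    ENNReal.ofReal_div_of_pos hu]

section Evidence

variable {S}
variable {q : ℕ} {R F₁ F₂ F₃ : ℝ} {f : S.PriorFamily}
  {n : ℕ} {J : Finset (Fin (S.p n))} {ω : S.Ω n}

lemma PriorConditions.evidence_le_of_far (hf : S.PriorConditions q R F₁ F₂ F₃ f)
    (hJ : J.card ≤ q) {τ : ℝ}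
    (h : ∀ ψ : EuclideanSpace ℝ J, S.logRatio n (extendZero ψ - (S.φ n).ofLp) ω ≤ -τ) :
    S.evidence f n J ω ≤ ENNReal.ofReal (Real.exp (-τ)) := by
  calc S.evidence f n J ω
      ≤ ∫⁻ ψ, ENNReal.ofReal (Real.exp (-τ)) * ENNReal.ofReal (f n J ψ) := by
        refine lintegral_mono fun ψ => ?_
        rw [ENNReal.ofReal_mul (Real.exp_nonneg _)]
        gcongr
        exact h ψ
    _ = ENNReal.ofReal (Real.exp (-τ)) := by
        rw [lintegral_const_mul' _ _ ENNReal.ofReal_ne_top, hf.lintegral_eq_one n J hJ, mul_one]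

lemma PriorConditions.evidence_le (hf : S.PriorConditions q R F₁ F₂ F₃ f) (hJ : J.card ≤ q)
    {τ r : ℝ} (h : ∀ ψ ∉ paramCube (S.φ n).ofLp J r,
      S.logRatio n (extendZero ψ - (S.φ n).ofLp) ω ≤ -τ) :
    S.evidence f n J ω
      ≤ ENNReal.ofReal F₁ * S.cubeIntegral n J r ω + ENNReal.ofReal (Real.exp (-τ)) := by
  rw [evidence, ← lintegral_add_compl _ (measurableSet_paramCube (S.φ n).ofLp J r)]
  refine add_le_add ?_ ?_
  · rw [cubeIntegral, ← lintegral_const_mul' _ _ ENNReal.ofReal_ne_top]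
    refine lintegral_mono fun ψ => ?_
    rw [mul_comm, ENNReal.ofReal_mul' (Real.exp_nonneg _)]
    gcongr
    exact hf.upper n J hJ ψ
  · calc _ ≤ ∫⁻ ψ in (paramCube (S.φ n).ofLp J r)ᶜ,
          ENNReal.ofReal (Real.exp (-τ)) * ENNReal.ofReal (f n J ψ) := by
          refine setLIntegral_mono' (measurableSet_paramCube _ J r).compl fun ψ hψ => ?_
          rw [ENNReal.ofReal_mul (Real.exp_nonneg _)]
          gcongr
          exact h ψ hψ
      _ ≤ ∫⁻ ψ, ENNReal.ofReal (Real.exp (-τ)) * ENNReal.ofReal (f n J ψ) :=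
          setLIntegral_le_lintegral _ _
      _ = ENNReal.ofReal (Real.exp (-τ)) := by
          rw [lintegral_const_mul' _ _ ENNReal.ofReal_ne_top, hf.lintegral_eq_one n J hJ, mul_one]

lemma norm_le_sum_abs {ι : Type*} [Fintype ι] (x : EuclideanSpace ℝ ι) : ‖x‖ ≤ ∑ i, |x i| := by
  rw [EuclideanSpace.norm_eq]
  refine Real.sqrt_le_iff.2 ⟨Finset.sum_nonneg fun _ _ => abs_nonneg _, ?_⟩
  simp only [Real.norm_eq_abs]
  exact Finset.sum_sq_le_sq_sum_of_nonneg fun _ _ => abs_nonneg _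

/-- Only the contribution of a small cube is kept. The bound `hR` places this cube inside the ball
where the prior is bounded below. -/
lemma PriorConditions.le_evidence (hf : S.PriorConditions q R F₁ F₂ F₃ f) (hJ : J.card ≤ q)
    {B ρ a₃ : ℝ} (hφ : ∀ j, |(S.φ n).ofLp j| ≤ a₃) (ha₃ : 0 ≤ a₃) (hρ1 : ρ ≤ 1)
    (hR : q * (a₃ + 1) ≤ R + 1) (hF₂ : 0 ≤ F₂)
    (h : ∀ ψ ∈ paramCube (S.φ n).ofLp J ρ,
      -B ≤ S.logRatio n (extendZero ψ - (S.φ n).ofLp) ω) :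
    ENNReal.ofReal (Real.exp (-B) * F₂) * ENNReal.ofReal (2 * ρ) ^ J.card
      ≤ S.evidence f n J ω := by
  rw [← volume_paramCube (S.φ n).ofLp, ← setLIntegral_const]
  refine le_trans ?_ (setLIntegral_le_lintegral (paramCube (S.φ n).ofLp J ρ) _)
  refine setLIntegral_mono' (measurableSet_paramCube _ J ρ) fun ψ hψ => ?_
  refine ENNReal.ofReal_le_ofReal (mul_le_mul (Real.exp_le_exp.2 (h ψ hψ)) ?_ hF₂
    (Real.exp_nonneg _))
  refine hf.lower n J hJ ψ ((norm_le_sum_abs ψ).trans (le_trans ?_ hR))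
  calc ∑ j, |ψ j| ≤ ∑ _j : J, (a₃ + 1) := by
        refine Finset.sum_le_sum fun j _ => ?_
        have h1 : |ψ j - (S.φ n).ofLp j| < ρ := hψ j
        have h2 := abs_add_le (ψ j - (S.φ n).ofLp j) ((S.φ n).ofLp j)
        rw [sub_add_cancel] at h2
        linarith [hφ j]
    _ = J.card * (a₃ + 1) := by rw [Finset.sum_const, nsmul_eq_mul]; simp
    _ ≤ q * (a₃ + 1) := mul_le_mul_of_nonneg_right (by exact_mod_cast hJ) (by linarith)

end Evidence

lemma modelPrior_of_le {p q : ℕ} {γ : ℝ} {J : Finset (Fin p)} (hJ : J.card ≤ q) :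
    modelPrior p q γ J = (p.choose J.card : ℝ) ^ (-γ) := if_pos hJ

/-- The deterministic comparison of models. If `J` misses a true covariate, every parameter of `J`
is at distance at least `r` from the truth. If `J` strictly contains the true model, only the cube
around the truth needs a separate bound `u J`. -/
lemma selectsTrueModel_of_bounds {q : ℕ} {R F₁ F₂ F₃ γ r τ D : ℝ}
    {f : S.PriorFamily} (hf : S.PriorConditions q R F₁ F₂ F₃ f) {n : ℕ} {ω : S.Ω n}
    (hF₁ : 0 ≤ F₁) {u : Finset (Fin (S.p n)) → ℝ} (hu : ∀ J, 0 ≤ u J)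
    (hfar : ∀ J : Finset (Fin (S.p n)), J.card ≤ q → ∀ ψ : EuclideanSpace ℝ J,
      r ≤ √(∑ j, (extendZero ψ - (S.φ n).ofLp) j ^ 2) →
        S.logRatio n (extendZero ψ - (S.φ n).ofLp) ω ≤ -τ)
    (hsignal : ∀ j ∈ S.trueModel n, r ≤ |S.φ n j|)
    (hden : ENNReal.ofReal D ≤ S.evidence f n (S.trueModel n) ω)
    (hover : ∀ J : Finset (Fin (S.p n)), J.card ≤ q → S.trueModel n ⊂ J →
      S.cubeIntegral n J r ω ≤ ENNReal.ofReal (u J))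
    (hunder' : ∀ J : Finset (Fin (S.p n)), J.card ≤ q →
      modelPrior (S.p n) q γ J * Real.exp (-τ) < modelPrior (S.p n) q γ (S.trueModel n) * D)
    (hover' : ∀ J : Finset (Fin (S.p n)), J.card ≤ q → S.trueModel n ⊂ J →
      modelPrior (S.p n) q γ J * (F₁ * u J + Real.exp (-τ))
        < modelPrior (S.p n) q γ (S.trueModel n) * D) :
    ω ∈ S.selectsTrueModel q γ f n := by
  have hprior : ∀ J : Finset (Fin (S.p n)), 0 ≤ modelPrior (S.p n) q γ J := fun J => by
    unfold modelPrior; split_ifs <;> positivity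
  have hcoord : ∀ (d : Fin (S.p n) → ℝ) j, |d j| ≤ √(∑ j, d j ^ 2) := fun d j =>
    Real.abs_le_sqrt (Finset.single_le_sum (f := fun j => d j ^ 2)
      (fun _ _ => sq_nonneg _) (Finset.mem_univ j))
  intro J hJne hJ
  refine S.bayes_lt_bayes ?_
  have key : ∀ v : ℝ, 0 ≤ v → S.evidence f n J ω ≤ ENNReal.ofReal v →
      modelPrior (S.p n) q γ J * v < modelPrior (S.p n) q γ (S.trueModel n) * D →
      ENNReal.ofReal (modelPrior (S.p n) q γ J) * S.evidence f n J ω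
      < ENNReal.ofReal (modelPrior (S.p n) q γ (S.trueModel n)) *
        S.evidence f n (S.trueModel n) ω := by
    intro v hv h1 h2
    calc _ ≤ ENNReal.ofReal (modelPrior (S.p n) q γ J) * ENNReal.ofReal v := by gcongr
      _ = ENNReal.ofReal (modelPrior (S.p n) q γ J * v) := (ENNReal.ofReal_mul (hprior J)).symm
      _ < ENNReal.ofReal (modelPrior (S.p n) q γ (S.trueModel n) * D) :=
          (ENNReal.ofReal_lt_ofReal_iff (lt_of_le_of_lt (mul_nonneg (hprior J) hv) h2)).2 h2
      _ = ENNReal.ofReal (modelPrior (S.p n) q γ (S.trueModel n)) * ENNReal.ofReal D :=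
          ENNReal.ofReal_mul (hprior _)
      _ ≤ _ := by gcongr
  by_cases hsub : S.trueModel n ⊆ J
  · have hss : S.trueModel n ⊂ J := hsub.ssubset_of_ne (Ne.symm hJne)
    refine key (F₁ * u J + Real.exp (-τ))
      (add_nonneg (mul_nonneg hF₁ (hu J)) (Real.exp_nonneg _)) ?_ (hover' J hJ hss)
    refine (hf.evidence_le hJ (r := r) (τ := τ) fun ψ hψ => hfar J hJ ψ ?_).trans ?_
    · simp only [paramCube, Set.mem_ofPred_eq, not_forall, not_lt] at hψ
      obtain ⟨j, hj⟩ := hψ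
      refine hj.trans (le_trans (le_of_eq ?_) (hcoord _ j))
      rw [Pi.sub_apply, extendZero_of_mem ψ j.2]
    · rw [ENNReal.ofReal_add (mul_nonneg hF₁ (hu J)) (Real.exp_nonneg _),
        ENNReal.ofReal_mul hF₁]
      gcongr
      exact hover J hJ hss
  · obtain ⟨j, hj, hjJ⟩ := Finset.not_subset.1 hsub
    refine key (Real.exp (-τ)) (Real.exp_nonneg _) ?_ (hunder' J hJ)
    refine hf.evidence_le_of_far hJ fun ψ => hfar J hJ ψ ?_
    refine (hsignal j hj).trans (le_trans (le_of_eq ?_) (hcoord _ j))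
    rw [Pi.sub_apply, extendZero_of_notMem ψ hjJ, zero_sub, abs_neg]

end GLMSequence

/-! ### Binomial coefficients and the number of larger models. -/

section Counting

/-- Each factor of the falling factorial is at least `p + 1 - m`, and `p ≤ m (p + 1 - m)` for `1 ≤ m
≤ p`. -/
lemma pow_le_mul_choose {p m : ℕ} (hm : m ≤ p) :
    (p : ℝ) ^ m ≤ (m : ℝ) ^ m * m.factorial * p.choose m := by
  have h1 : p ≤ m * (p + 1 - m) ∨ m = 0 := by
    rcases Nat.eq_zero_or_pos m with h | h
    · exact Or.inr h
    · left
      obtain ⟨k, rfl⟩ := Nat.exists_eq_add_of_le hm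
      have : m + k + 1 - m = k + 1 := by omega
      rw [this]
      nlinarith
  rcases h1 with h1 | rfl
  · have h2 := Nat.pow_le_choose (α := ℝ) m p
    rw [div_le_iff₀ (by positivity)] at h2
    calc (p : ℝ) ^ m ≤ ((m * (p + 1 - m) : ℕ) : ℝ) ^ m := by
          gcongr
      _ = (m : ℝ) ^ m * ((p + 1 - m : ℕ) : ℝ) ^ m := by push_cast; rw [mul_pow]
      _ ≤ (m : ℝ) ^ m * (p.choose m * m.factorial) := by gcongr
      _ = _ := by ring
  · simp

lemma choose_mul_pow_le {p q m k : ℕ} (hp : m + k ≤ p) (hq : m + k ≤ q) (hq0 : 1 ≤ q) :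
    (p.choose m : ℝ) * (p : ℝ) ^ k ≤ (q : ℝ) ^ q * q.factorial * p.choose (m + k) := by
  have h1 : (p.choose m : ℝ) ≤ (p : ℝ) ^ m := by exact_mod_cast Nat.choose_le_pow p m
  calc (p.choose m : ℝ) * (p : ℝ) ^ k ≤ (p : ℝ) ^ m * (p : ℝ) ^ k := by gcongr
    _ = (p : ℝ) ^ (m + k) := (pow_add _ _ _).symm
    _ ≤ ((m + k : ℕ) : ℝ) ^ (m + k) * (m + k).factorial * p.choose (m + k) :=
        pow_le_mul_choose hp
    _ ≤ (q : ℝ) ^ q * q.factorial * p.choose (m + k) := by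
        gcongr
        calc ((m + k : ℕ) : ℝ) ^ (m + k) ≤ (q : ℝ) ^ (m + k) := by gcongr
          _ ≤ (q : ℝ) ^ q := pow_le_pow_right₀ (by exact_mod_cast hq0) hq

/-- For sizes up to `q` a binomial coefficient is `p ^ m` up to constants, so `k` extra covariates
cost a prior factor of order `p ^ (-γ k)`. This holds up to `m + k = p`. -/
lemma choose_rpow_neg_le {p q m k : ℕ} {γ : ℝ} (hγ : 0 ≤ γ) (hp : m + k ≤ p) (hq : m + k ≤ q)
    (hq0 : 1 ≤ q) :
    (p.choose (m + k) : ℝ) ^ (-γ)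
      ≤ ((q : ℝ) ^ q * q.factorial) ^ γ * ((p : ℝ) ^ (-γ)) ^ k * (p.choose m : ℝ) ^ (-γ) := by
  rcases Nat.eq_zero_or_pos p with rfl | hp0
  · obtain ⟨rfl, rfl⟩ : m = 0 ∧ k = 0 := by omega
    simp only [add_zero, Nat.choose_self, Nat.cast_one, Real.one_rpow, pow_zero, mul_one]
    refine Real.one_le_rpow ?_ hγ
    exact one_le_mul_of_one_le_of_one_le (one_le_pow₀ (by exact_mod_cast hq0))
      (by exact_mod_cast Nat.succ_le_of_lt q.factorial_pos)
  have hK : 0 < (q : ℝ) ^ q * q.factorial := by positivity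
  have hc : 0 < (p.choose m : ℝ) := by exact_mod_cast Nat.choose_pos (by omega)
  have hpp : 0 < (p : ℝ) := by exact_mod_cast hp0
  have h := choose_mul_pow_le hp hq hq0
  have h1 : (p.choose m : ℝ) * (p : ℝ) ^ k / ((q : ℝ) ^ q * q.factorial) ≤ p.choose (m + k) := by
    rw [div_le_iff₀ hK, mul_comm _ ((q : ℝ) ^ q * q.factorial)]; exact h
  refine (Real.rpow_le_rpow_of_nonpos (by positivity) h1 (by linarith)).trans (le_of_eq ?_)
  rw [Real.div_rpow (by positivity) hK.le, Real.mul_rpow hc.le (by positivity),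
    Real.rpow_neg hK.le, div_inv_eq_mul, ← Real.rpow_natCast (p : ℝ) k, ← Real.rpow_mul hpp.le,
    ← Real.rpow_natCast ((p : ℝ) ^ (-γ)) k, ← Real.rpow_mul hpp.le, mul_comm (k : ℝ)]
  ring

lemma choose_rpow_neg_le_one {p m : ℕ} {γ : ℝ} (hγ : 0 ≤ γ) (hm : m ≤ p) :
    (p.choose m : ℝ) ^ (-γ) ≤ 1 :=
  Real.rpow_le_one_of_one_le_of_nonpos (by exact_mod_cast Nat.choose_pos hm) (by linarith)

lemma le_choose_rpow_neg {p q m : ℕ} {γ : ℝ} (hγ : 0 ≤ γ) (hm : m ≤ p) (hq : m ≤ q)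
    (hp : 1 ≤ p) : ((p : ℝ) ^ q) ^ (-γ) ≤ (p.choose m : ℝ) ^ (-γ) := by
  refine Real.rpow_le_rpow_of_nonpos (by exact_mod_cast Nat.choose_pos hm) ?_ (by linarith)
  exact_mod_cast (Nat.choose_le_pow p m).trans (Nat.pow_le_pow_right hp hq)

/-- A superset of `T` is determined by its difference with `T`, which leaves at most `p ^ k`
supersets with `k` extra elements. -/
lemma sum_ssuperset_le {p q : ℕ} (T : Finset (Fin p)) {g : ℕ → ℝ} (hg : ∀ k, 0 ≤ g k) :
    ∑ J ∈ Finset.univ.filter (fun J : Finset (Fin p) => J.card ≤ q ∧ T ⊂ J), g (J.card - T.card)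
      ≤ ∑ k ∈ Finset.Icc 1 q, (p : ℝ) ^ k * g k := by
  have hmaps : ∀ J ∈ Finset.univ.filter (fun J : Finset (Fin p) => J.card ≤ q ∧ T ⊂ J),
      J.card - T.card ∈ Finset.Icc 1 q := fun J hJ => by
    simp only [Finset.mem_filter, Finset.mem_univ, true_and] at hJ
    have := Finset.card_lt_card hJ.2
    rw [Finset.mem_Icc]; omega
  rw [← Finset.sum_fiberwise_of_maps_to hmaps]
  refine Finset.sum_le_sum fun k _ => ?_
  rw [Finset.sum_congr rfl (g := fun _ => g k) (fun J hJ => by rw [(Finset.mem_filter.1 hJ).2]),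
    Finset.sum_const, nsmul_eq_mul]
  refine mul_le_mul_of_nonneg_right ?_ (hg k)
  have hcard : (Finset.filter (fun J : Finset (Fin p) => J.card - T.card = k)
      (Finset.univ.filter (fun J : Finset (Fin p) => J.card ≤ q ∧ T ⊂ J))).card
      ≤ (Finset.powersetCard k (Finset.univ : Finset (Fin p))).card := by
    refine Finset.card_le_card_of_injOn (fun J => J \ T) (fun J hJ => ?_) ?_
    · simp only [Finset.coe_filter, Finset.mem_filter, Finset.mem_univ, true_and,
        Set.mem_ofPred_eq] at hJ
      simp only [Finset.mem_coe, Finset.mem_powersetCard]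
      exact ⟨Finset.subset_univ _, by rw [Finset.card_sdiff_of_subset hJ.1.2.1, hJ.2]⟩
    · intro J hJ J' hJ' h
      simp only [Finset.coe_filter, Finset.mem_filter, Finset.mem_univ, true_and,
        Set.mem_ofPred_eq] at hJ hJ'
      rw [← Finset.sdiff_union_of_subset hJ.1.2.1, ← Finset.sdiff_union_of_subset hJ'.1.2.1]
      exact congrArg (· ∪ T) h
  rw [Finset.card_powersetCard, Finset.card_univ, Fintype.card_fin] at hcard
  exact_mod_cast hcard.trans (Nat.choose_le_pow p k)

end Counting

/-! ### The noise level, and the consequences of the good events. -/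

namespace GLMSequence

variable {ν : Measure ℝ} (S : GLMSequence ν)

/-- `log n + log p`. -/
noncomputable def logSize (n : ℕ) : ℝ := Real.log n + Real.log (S.p n)

/-- The noise level `√(log (n p) / n)`. -/
noncomputable def scale (n : ℕ) : ℝ := √(S.logSize n / n)

lemma log_p_nonneg (n : ℕ) : 0 ≤ Real.log (S.p n) :=
  Real.log_nonneg (by exact_mod_cast S.one_le_p n)

lemma log_le_logSize (n : ℕ) : Real.log n ≤ S.logSize n :=
  le_add_of_nonneg_right (S.log_p_nonneg n)

lemma log_p_le_logSize (n : ℕ) : Real.log (S.p n) ≤ S.logSize n :=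
  le_add_of_nonneg_left (Real.log_natCast_nonneg n)

lemma tendsto_logSize : Tendsto S.logSize atTop atTop :=
  tendsto_atTop_mono S.log_le_logSize (Real.tendsto_log_atTop.comp tendsto_natCast_atTop_atTop)

lemma SparseRegime.logSize_isLittleO {S : GLMSequence ν} {q : ℕ} {a₁ a₂ a₃ : ℝ}
    (hS : S.SparseRegime q a₁ a₂ a₃) :
    S.logSize =o[atTop] (fun n => (n : ℝ)) :=
  (Real.isLittleO_log_id_atTop.comp_tendsto tendsto_natCast_atTop_atTop).add hS.growth

lemma SparseRegime.eventually_logSize_le {S : GLMSequence ν} {q : ℕ} {a₁ a₂ a₃ : ℝ}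
    (hS : S.SparseRegime q a₁ a₂ a₃) {c : ℝ} (hc : 0 < c) :
    ∀ᶠ n : ℕ in atTop, S.logSize n ≤ c * n := by
  filter_upwards [hS.logSize_isLittleO.bound hc] with n hn
  rw [Real.norm_natCast] at hn
  exact (Real.le_norm_self _).trans hn

lemma abs_linear_le_logSize (n : ℕ) (α β : ℝ) :
    α * Real.log n + β * Real.log (S.p n) ≤ (|α| + |β|) * S.logSize n := by
  have h1 := S.log_le_logSize n
  have h2 := S.log_p_le_logSize n
  have h3 : α * Real.log n ≤ |α| * S.logSize n :=
    (mul_le_mul_of_nonneg_right (le_abs_self α) (Real.log_natCast_nonneg n)).trans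
      (mul_le_mul_of_nonneg_left h1 (abs_nonneg _))
  have h4 : β * Real.log (S.p n) ≤ |β| * S.logSize n :=
    (mul_le_mul_of_nonneg_right (le_abs_self β) (S.log_p_nonneg n)).trans
      (mul_le_mul_of_nonneg_left h2 (abs_nonneg _))
  rw [add_mul]
  exact add_le_add h3 h4

/-- The event that the design is tame at the noise level. -/
def tameEvent (M : ℝ) (n : ℕ) : Set (S.Ω n) :=
  {ω | IsTameDesign ν (S.φ n).ofLp (S.scale n) M fun i => S.X n i ω}

/-- The event that the likelihood ratio integrals over cubes stay below the levels `u`. -/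
def cubeEvent (n q : ℕ) (r : ℝ) (u : Finset (Fin (S.p n)) → ℝ) : Set (S.Ω n) :=
  {ω | ∀ J : Finset (Fin (S.p n)), J.card ≤ q → S.trueModel n ⊂ J →
    S.cubeIntegral n J r ω < ENNReal.ofReal (u J)}

lemma measure_compl_cubeEvent_le (hν : IsExpFamilyBase ν) (n q : ℕ) {r : ℝ} (hr : 0 ≤ r)
    {u : Finset (Fin (S.p n)) → ℝ}
    (hu : ∀ J : Finset (Fin (S.p n)), J.card ≤ q → 0 < u J)
    {g : ℕ → ℝ} (hg : ∀ k, 0 ≤ g k)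
    (hgu : ∀ J : Finset (Fin (S.p n)), J.card ≤ q → S.trueModel n ⊂ J →
      (2 * r) ^ J.card / u J ≤ g (J.card - (S.trueModel n).card)) :
    S.P n (S.cubeEvent n q r u)ᶜ
      ≤ ENNReal.ofReal (∑ k ∈ Finset.Icc 1 q, (S.p n : ℝ) ^ k * g k) := by
  set F := Finset.univ.filter fun J : Finset (Fin (S.p n)) => J.card ≤ q ∧ S.trueModel n ⊂ J
    with hF
  have hFm : ∀ J ∈ F, J.card ≤ q ∧ S.trueModel n ⊂ J := fun J hJ => by simpa [hF] using hJ
  have hsub : (S.cubeEvent n q r u)ᶜ ⊆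
      ⋃ J ∈ F, {ω | ENNReal.ofReal (u J) ≤ S.cubeIntegral n J r ω} := fun ω hω => by
    simp only [cubeEvent, Set.mem_compl_iff, Set.mem_ofPred_eq, not_forall, not_lt] at hω
    obtain ⟨J, hJ, hJ', h⟩ := hω
    simp only [Set.mem_iUnion]
    exact ⟨J, by simp [hF, hJ, hJ'], h⟩
  calc S.P n (S.cubeEvent n q r u)ᶜ
      ≤ ∑ J ∈ F, S.P n {ω | ENNReal.ofReal (u J) ≤ S.cubeIntegral n J r ω} :=
        (measure_mono hsub).trans (measure_biUnion_finset_le _ _)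
    _ ≤ ∑ J ∈ F, ENNReal.ofReal (g (J.card - (S.trueModel n).card)) := by
        refine Finset.sum_le_sum fun J hJ => ?_
        exact (S.measure_cubeIntegral_ge_le hν n J hr (hu J (hFm J hJ).1)).trans
          (ENNReal.ofReal_le_ofReal (hgu J (hFm J hJ).1 (hFm J hJ).2))
    _ = ENNReal.ofReal (∑ J ∈ F, g (J.card - (S.trueModel n).card)) :=
        (ENNReal.ofReal_sum_of_nonneg fun _ _ => hg _).symm
    _ ≤ _ := ENNReal.ofReal_le_ofReal (sum_ssuperset_le (S.trueModel n) hg)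

/-- The cube radius is `C ℓ ρ`. The `m` true coordinates cancel against `(2ρ) ^ m` up to powers of
`ℓ`; each extra coordinate leaves `ℓ ρ = √ℓ s`, with `s = 1 / √n`, and the prior factor `t`. -/
lemma overfit_term_le {q m k : ℕ} {C D ℓ ρ s t a b F K : ℝ} (hC : 1 ≤ C) (hD : 0 < D)
    (hℓ : 1 ≤ ℓ) (hρ : 0 < ρ) (hs : 0 ≤ s) (hrs : ℓ * ρ = √ℓ * s) (ha : 0 < a)
    (hb : 0 < b) (hF : 0 < F) (hab : a ≤ K * t ^ k * b) (hm : m ≤ q) (hk : k ≤ q) :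
    (2 * (C * (ℓ * ρ))) ^ (m + k) / (b * (D * (2 * ρ) ^ m) / (2 * F * a))
      ≤ C ^ q * (2 * C) ^ q * (2 * F / D) * K * ℓ ^ (2 * q) * (s * t) ^ k := by
  have e : (2 * (C * (ℓ * ρ))) ^ (m + k) / (b * (D * (2 * ρ) ^ m) / (2 * F * a))
      = (C * ℓ) ^ m * (2 * C * (ℓ * ρ)) ^ k * (2 * F / D) * (a / b) := by
    have e1 : (2 * (C * (ℓ * ρ))) ^ (m + k) = (C * ℓ) ^ m * (2 * ρ) ^ m * (2 * C * (ℓ * ρ)) ^ k := by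
      rw [pow_add, ← mul_pow]; congr 2 <;> ring
    rw [e1]
    have : (2 * ρ) ^ m ≠ 0 := by positivity
    field_simp
  have h1 : a / b ≤ K * t ^ k := by rwa [div_le_iff₀ hb]
  have h2 : (C * ℓ) ^ m ≤ C ^ q * ℓ ^ q := by
    rw [← mul_pow]
    exact pow_le_pow_right₀ (one_le_mul_of_one_le_of_one_le hC hℓ) hm
  have h3 : (2 * C * (ℓ * ρ)) ^ k ≤ (2 * C) ^ q * ℓ ^ q * s ^ k := by
    rw [hrs, mul_pow, mul_pow (√ℓ), ← mul_assoc]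
    have h31 : (2 * C) ^ k ≤ (2 * C) ^ q := pow_le_pow_right₀ (by linarith) hk
    have h32 : √ℓ ^ k ≤ ℓ ^ q := by
      have : √ℓ ≤ ℓ := by rw [Real.sqrt_le_left (by linarith)]; nlinarith
      exact (pow_le_pow_left₀ (Real.sqrt_nonneg _) this k).trans (pow_le_pow_right₀ hℓ hk)
    gcongr
  rw [e]
  calc (C * ℓ) ^ m * (2 * C * (ℓ * ρ)) ^ k * (2 * F / D) * (a / b)
      ≤ (C ^ q * ℓ ^ q) * ((2 * C) ^ q * ℓ ^ q * s ^ k) * (2 * F / D) * (K * t ^ k) := by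
        have : 0 ≤ ℓ := by linarith
        gcongr
    _ = _ := by rw [mul_pow s t, two_mul q, pow_add]; ring

lemma scale_facts {n : ℕ} (hn : 1 ≤ n) (hℓ : 1 ≤ S.logSize n) :
    0 < S.scale n ∧ S.scale n ^ 2 * n = S.logSize n ∧
    S.logSize n * (1 / √(n * S.logSize n)) = S.scale n ∧
    S.logSize n * (1 / √(n * S.logSize n)) = √(S.logSize n) * (1 / √n) := by
  have hn' : (0 : ℝ) < n := by exact_mod_cast hn
  have hℓ' : 0 < S.logSize n := by linarith
  have h3 : S.logSize n * (1 / √(n * S.logSize n)) = √(S.logSize n) * (1 / √n) := by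
    rw [Real.sqrt_mul hn'.le]
    have h1 : √(S.logSize n) ≠ 0 := (Real.sqrt_pos.2 hℓ').ne'
    have h2 : √(n : ℝ) ≠ 0 := (Real.sqrt_pos.2 hn').ne'
    field_simp
    rw [Real.sq_sqrt hℓ'.le]
  refine ⟨Real.sqrt_pos.2 (by positivity), ?_, ?_, h3⟩
  · rw [scale, Real.sq_sqrt (by positivity)]; field_simp
  · rw [h3, scale, Real.sqrt_div hℓ'.le]; ring

/-- The lower bound for the evidence of the true model. -/
noncomputable def trueEvidenceBound (n : ℕ) (D : ℝ) : ℝ :=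
  D * (2 * (1 / √(n * S.logSize n))) ^ (S.trueModel n).card

/-- On the score, curvature and tame design events, the log-likelihood ratio is small away from the
truth, and the evidence of the true model is bounded below. -/
lemma bounds_of_events (hν : IsExpFamilyBase ν) {q : ℕ} {a₁ a₂ a₃ R F₁ F₂ F₃ : ℝ}
    (ha₃ : 0 ≤ a₃) (hS : S.SparseRegime q a₁ a₂ a₃) {f : S.PriorFamily}
    (hf : S.PriorConditions q R F₁ F₂ F₃ f) (hR : q * (a₃ + 1) ≤ R + 1) (hF₂ : 0 ≤ F₂)
    {n : ℕ} (hn : 1 ≤ n) (hℓ : 1 ≤ S.logSize n) (hℓq : q ≤ S.logSize n) {N N₂ M c C : ℝ}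
    (hN : 0 ≤ N) (hM : 0 ≤ M) (hc : 0 < c) (hC : 1 ≤ C)
    (hCs : C * S.scale n ≤ 1) (hCN : 4 * q * (N + M / 2) ≤ c * C) (hCN₂ : 2 * N₂ ≤ c * C)
    {ω : S.Ω n} (h1 : ω ∈ S.scoreEvent n (S.scale n) (N * S.logSize n))
    (h2 : ω ∈ S.curvatureEvent n (2 * q) c) (h3 : ω ∈ S.tameEvent M n) :
    (∀ J : Finset (Fin (S.p n)), J.card ≤ q → ∀ ψ : EuclideanSpace ℝ J,
      C * S.scale n ≤ √(∑ j, (extendZero ψ - (S.φ n).ofLp) j ^ 2) →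
        S.logRatio n (extendZero ψ - (S.φ n).ofLp) ω ≤ -(N₂ * S.logSize n)) ∧
    ENNReal.ofReal (S.trueEvidenceBound n
      (Real.exp (-(q * (N + M / 2) + q ^ 2 * M / 2)) * F₂))
      ≤ S.evidence f n (S.trueModel n) ω := by
  have hn' : (0 : ℝ) < n := by exact_mod_cast hn
  obtain ⟨hr, hr2, hρr, -⟩ := S.scale_facts hn hℓ
  set ℓ := S.logSize n
  set r := S.scale n
  -- The half-side is chosen so that `ρ n r = 1`. The score, of order `n r`, then changes the
  -- log-ratio only by a constant; the cube being smaller than `1 / √n` costs only powers of `ℓ`.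
  set ρ : ℝ := 1 / √(n * ℓ) with hρ
  have hℓ0 : 0 < ℓ := by linarith
  have hρ0 : 0 < ρ := by positivity
  set σ : ℝ := (N + M / 2) * (n * r) with hσ
  have hσ0 : 0 ≤ σ := by positivity
  have hscore : ∀ j, |score ν (S.φ n).ofLp (fun i => S.X n i ω) (fun i => S.Y n i ω) j| ≤ σ :=
    fun j => by
      refine (abs_score_le hν hr h3 j (h1 j).1 (h1 j).2).trans (le_of_eq ?_)
      rw [div_eq_iff hr.ne', hσ]
      have e : (N + M / 2) * (n * r) * r = (N + M / 2) * (r ^ 2 * n) := by ring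
      have e' : r ^ 2 * M * n / 2 = (r ^ 2 * n) * M / 2 := by ring
      rw [e, e', hr2]; ring
  have hφJ : ∀ j ∉ S.trueModel n, (S.φ n).ofLp j = 0 := fun j hj => by
    by_contra h
    exact hj (by simpa [trueModel] using h)
  constructor
  · intro J hJ ψ hψ
    -- The shift from the truth to a parameter of `J` lives on this union, which is why curvature is
    -- needed up to size `2q`.
    have hcard : (J ∪ S.trueModel n).card ≤ 2 * q := by
      have := Finset.card_union_le J (S.trueModel n)
      have := hS.sparse n
      omega
    have hd : ∀ j ∉ J ∪ S.trueModel n, (extendZero ψ - (S.φ n).ofLp) j = 0 := fun j hj => by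
      rw [Finset.mem_union, not_or] at hj
      rw [Pi.sub_apply, extendZero_of_notMem ψ hj.1, hφJ j hj.2, sub_zero]
    have h := gain_le_of_curvature (r := r) hcard hd hσ0 hscore hc.le (by positivity) hCs
      (h2 _ hcard Finset.subset_union_right _ hd) hψ (by
        have := mul_le_mul_of_nonneg_right hCN (mul_nonneg hn'.le hr.le)
        rw [hσ]; push_cast; nlinarith)
    refine h.trans (neg_le_neg ?_)
    have e : c * n * (C * r) ^ 2 / 2 = c * C ^ 2 / 2 * (r ^ 2 * n) := by ring
    rw [e, hr2]
    refine mul_le_mul_of_nonneg_right ?_ hℓ0.le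
    nlinarith [mul_le_mul_of_nonneg_left hC (mul_pos hc (by linarith : 0 < C)).le]
  · have hmr : (q : ℝ) * ρ ≤ r := by
      rw [← hρr]; exact mul_le_mul_of_nonneg_right hℓq hρ0.le
    have hρ1 : ρ ≤ 1 := by
      rw [hρ, div_le_one (by positivity), Real.one_le_sqrt]
      exact one_le_mul_of_one_le_of_one_le (by exact_mod_cast hn) hℓ
    have hρ2 : ρ ^ 2 * n * ℓ = 1 := by
      rw [hρ, div_pow, Real.sq_sqrt (by positivity)]; field_simp
    have hev := hf.le_evidence (ω := ω) (hS.sparse n) (ρ := ρ)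
      (B := q * (N + M / 2) + q ^ 2 * M / 2) (S.abs_coord_le_norm hS n) ha₃ hρ1 hR hF₂ ?_
    · refine le_trans (le_of_eq ?_) hev
      rw [trueEvidenceBound, ENNReal.ofReal_mul (by positivity),
        ENNReal.ofReal_pow (by positivity)]
    · intro ψ hψ
      have h := le_gain_of_small hν (d := extendZero ψ - (S.φ n).ofLp) (hS.sparse n)
        (fun j hj => by
          rw [Pi.sub_apply, extendZero_of_notMem ψ hj, hφJ j hj, sub_zero]) hρ0.le
        (fun j hj => by
          rw [Pi.sub_apply, extendZero_of_mem ψ hj]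
          exact (hψ ⟨j, hj⟩ : _ < ρ).le) hσ0 hscore h3 hM hr hmr
      refine le_trans (neg_le_neg ?_) h
      have e1 : (q : ℝ) * ρ * σ = q * (N + M / 2) := by
        have : ρ * (n * r) = 1 := by
          rw [← hρr]
          calc ρ * (n * (ℓ * ρ)) = ρ ^ 2 * n * ℓ := by ring
            _ = 1 := hρ2
        rw [hσ]
        calc (q : ℝ) * ρ * ((N + M / 2) * (n * r)) = q * (N + M / 2) * (ρ * (n * r)) := by ring
          _ = _ := by rw [this, mul_one]
      have e2 : (q : ℝ) ^ 2 * ρ ^ 2 * M * n / 2 ≤ q ^ 2 * M / 2 := by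
        have : ρ ^ 2 * n ≤ 1 := by
          have h0 : 0 ≤ ρ ^ 2 * n := by positivity
          nlinarith
        have h' := mul_le_mul_of_nonneg_left this (by positivity : (0 : ℝ) ≤ q ^ 2 * M / 2)
        linarith
      linarith

end GLMSequence

/-! ### Probability of a wrong selection under a tame design. -/

namespace GLMSequence

variable {ν : Measure ℝ} (S : GLMSequence ν)

lemma card_le_p {n : ℕ} (J : Finset (Fin (S.p n))) : J.card ≤ S.p n := by
  simpa using J.card_le_univ

lemma modelPrior_pos {q : ℕ} {γ : ℝ} {n : ℕ} {J : Finset (Fin (S.p n))} (hJ : J.card ≤ q) :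
    0 < modelPrior (S.p n) q γ J := by
  rw [modelPrior_of_le hJ]
  have : 0 < ((S.p n).choose J.card : ℝ) := by
    exact_mod_cast Nat.choose_pos (S.card_le_p J)
  positivity

lemma p_pow_rpow_neg (n q : ℕ) (γ : ℝ) :
    ((S.p n : ℝ) ^ q) ^ (-γ) = Real.exp (-(γ * q * Real.log (S.p n))) := by
  have hp : (0 : ℝ) < S.p n := by exact_mod_cast S.one_le_p n
  rw [Real.rpow_def_of_pos (by positivity), Real.log_pow]
  congr 1; ring

/-- The exponent has one part for each factor on the right: `γ q` for the prior, `q` for the volume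
of the small cube, and `1` for the constant `D / 4`. -/
lemma exp_neg_le_modelPrior_mul {q : ℕ} {γ D : ℝ} (hγ : 0 ≤ γ) (hD : 0 < D) {n : ℕ} (hn : 1 ≤ n)
    (hℓ : 1 ≤ S.logSize n) (hm : (S.trueModel n).card ≤ q)
    (hDℓ : Real.exp (-S.logSize n) ≤ D / 4) :
    Real.exp (-((γ * q + q + 1) * S.logSize n))
      ≤ modelPrior (S.p n) q γ (S.trueModel n) * S.trueEvidenceBound n D / 4 := by
  have hn' : (0 : ℝ) < n := by exact_mod_cast hn
  set ℓ := S.logSize n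
  have h1 : Real.exp (-(γ * q * ℓ)) ≤ modelPrior (S.p n) q γ (S.trueModel n) := by
    rw [modelPrior_of_le hm]
    refine le_trans ?_ (le_choose_rpow_neg hγ (S.card_le_p _) hm (S.one_le_p n))
    rw [S.p_pow_rpow_neg]
    have := mul_le_mul_of_nonneg_left (S.log_p_le_logSize n)
      (by positivity : (0 : ℝ) ≤ γ * q)
    exact Real.exp_le_exp.2 (neg_le_neg this)
  have h2 : Real.exp (-ℓ) ≤ 2 * (1 / √(n * ℓ)) := by
    have hℓ0 : 0 < ℓ := by linarith
    have : √(n * ℓ) ≤ Real.exp ℓ := by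
      rw [Real.sqrt_le_left (Real.exp_nonneg _), pow_two]
      refine mul_le_mul ?_ ?_ hℓ0.le (Real.exp_nonneg _)
      · rw [← Real.exp_log hn']; exact Real.exp_le_exp.2 (S.log_le_logSize n)
      · linarith [Real.add_one_le_exp ℓ]
    rw [Real.exp_neg, ← one_div]
    have hs : 0 < √(n * ℓ) := by positivity
    have h3 := one_div_le_one_div_of_le hs this
    have h4 : 0 < 1 / √(n * ℓ) := by positivity
    linarith
  have h3 : Real.exp (-(q * ℓ)) ≤ (2 * (1 / √(n * ℓ))) ^ (S.trueModel n).card := by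
    calc Real.exp (-(q * ℓ)) = Real.exp (-ℓ) ^ q := by rw [← Real.exp_nat_mul]; congr 1; ring
      _ ≤ Real.exp (-ℓ) ^ (S.trueModel n).card :=
          pow_le_pow_of_le_one (Real.exp_nonneg _) (Real.exp_le_one_iff.2 (by linarith)) hm
      _ ≤ _ := pow_le_pow_left₀ (Real.exp_nonneg _) h2 _
  have e : Real.exp (-((γ * q + q + 1) * ℓ))
      = Real.exp (-(γ * q * ℓ)) * (Real.exp (-ℓ) * Real.exp (-(q * ℓ))) := by
    rw [← Real.exp_add, ← Real.exp_add]; congr 1; ring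
  rw [e]
  calc _ ≤ modelPrior (S.p n) q γ (S.trueModel n)
        * (D / 4 * (2 * (1 / √(n * ℓ))) ^ (S.trueModel n).card) := by
        have := S.modelPrior_pos (γ := γ) hm
        gcongr
    _ = _ := by rw [trueEvidenceBound]; ring

/-- The thresholds for the likelihood ratio integrals of models that contain the true model. -/
noncomputable def cubeLevel (q : ℕ) (γ D F : ℝ) (n : ℕ) (J : Finset (Fin (S.p n))) : ℝ :=
  modelPrior (S.p n) q γ (S.trueModel n) * S.trueEvidenceBound n D
    / (2 * F * modelPrior (S.p n) q γ J)

lemma modelPrior_le_of_ssubset {q : ℕ} {γ : ℝ} (hγ : 0 ≤ γ) {n : ℕ}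
    {J : Finset (Fin (S.p n))} (hJ : J.card ≤ q) (hs : S.trueModel n ⊂ J) :
    modelPrior (S.p n) q γ J ≤ ((q : ℝ) ^ q * q.factorial) ^ γ
      * ((S.p n : ℝ) ^ (-γ)) ^ (J.card - (S.trueModel n).card)
      * modelPrior (S.p n) q γ (S.trueModel n) := by
  have hlt := Finset.card_lt_card hs
  rw [modelPrior_of_le hJ, modelPrior_of_le (hlt.le.trans hJ)]
  have e : (S.trueModel n).card + (J.card - (S.trueModel n).card) = J.card := by omega
  have h := choose_rpow_neg_le (p := S.p n) (q := q) (m := (S.trueModel n).card)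
    (k := J.card - (S.trueModel n).card) hγ (by rw [e]; exact S.card_le_p J) (by omega)
    (by omega)
  rwa [e] at h

/-- With `k` extra covariates the union bound gives `(p s t) ^ k` up to powers of `ℓ`, where `s = n
^ (-1/2)` and `t = p ^ (-γ)`. Nonnegativity of the exponent means `p s t ≤ 1`, so `k = 1` dominates.
-/
lemma exists_measure_compl_cubeEvent_le (hν : IsExpFamilyBase ν) {q : ℕ} {γ C D F : ℝ}
    (hγ : 0 ≤ γ) (hC : 1 ≤ C) (hD : 0 < D) (hF : 0 < F) :
    ∃ K : ℝ, 0 ≤ K ∧ ∀ n : ℕ, 1 ≤ n → 1 ≤ S.logSize n → (S.trueModel n).card ≤ q →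
      0 ≤ (γ - 1) * Real.log (S.p n) + Real.log n / 2 →
      S.P n (S.cubeEvent n q (C * S.scale n) (S.cubeLevel q γ D F n))ᶜ
        ≤ ENNReal.ofReal (K * S.logSize n ^ (2 * q)
          * Real.exp (-((γ - 1) * Real.log (S.p n) + Real.log n / 2))) := by
  set K₀ : ℝ := ((q : ℝ) ^ q * q.factorial) ^ γ
  set K₁ : ℝ := C ^ q * (2 * C) ^ q * (2 * F / D) * K₀ with hK₁
  have hK₀ : 0 ≤ K₀ := by positivity
  have hK₁0 : 0 ≤ K₁ := by positivity
  refine ⟨q * K₁, by positivity, fun n hn hℓ hm hslack => ?_⟩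
  obtain ⟨hr, hr2, hρr, hρs⟩ := S.scale_facts hn hℓ
  have hn' : (0 : ℝ) < n := by exact_mod_cast hn
  have hp' : (0 : ℝ) < S.p n := by exact_mod_cast S.one_le_p n
  set ℓ := S.logSize n
  have hℓ0 : 0 < ℓ := by linarith
  set s : ℝ := 1 / √n with hs
  set t : ℝ := (S.p n : ℝ) ^ (-γ) with ht
  have hst : S.p n * (s * t)
      = Real.exp (-((γ - 1) * Real.log (S.p n) + Real.log n / 2)) := by
    have hs' : s = Real.exp (-(Real.log n / 2)) := by
      rw [hs, Real.exp_neg, one_div, Real.sqrt_eq_rpow, Real.rpow_def_of_pos hn']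
      congr 2; ring
    have hpe : (S.p n : ℝ) = Real.exp (Real.log (S.p n)) := (Real.exp_log hp').symm
    rw [hs', ht, Real.rpow_def_of_pos hp']
    nth_rw 1 [hpe]
    rw [← Real.exp_add, ← Real.exp_add]
    congr 1; ring
  have hst1 : S.p n * (s * t) ≤ 1 := by rw [hst]; exact Real.exp_le_one_iff.2 (by linarith)
  have hst0 : 0 ≤ S.p n * (s * t) := by positivity
  have hlevel : ∀ J : Finset (Fin (S.p n)), J.card ≤ q → 0 < S.cubeLevel q γ D F n J :=
    fun J hJ => by
      have h1 := S.modelPrior_pos (γ := γ) hm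
      have h2 := S.modelPrior_pos (γ := γ) hJ
      have h3 : 0 < S.trueEvidenceBound n D := by rw [trueEvidenceBound]; positivity
      rw [cubeLevel]; positivity
  refine (S.measure_compl_cubeEvent_le hν n q (by positivity) hlevel
    (g := fun k => K₁ * ℓ ^ (2 * q) * (s * t) ^ k) (fun k => by positivity)
    fun J hJ hss => ?_).trans (ENNReal.ofReal_le_ofReal ?_)
  · have hlt := Finset.card_lt_card hss
    have h := overfit_term_le (q := q) (m := (S.trueModel n).card)
      (k := J.card - (S.trueModel n).card) (ρ := 1 / √(n * ℓ)) (t := t) (F := F) (D := D)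
      hC hD hℓ (by positivity) (by positivity) hρs (S.modelPrior_pos (γ := γ) hJ)
      (S.modelPrior_pos (γ := γ) hm) hF (S.modelPrior_le_of_ssubset hγ hJ hss) hm (by omega)
    have e : (S.trueModel n).card + (J.card - (S.trueModel n).card) = J.card := by omega
    rw [hρr, e] at h
    exact h
  · rw [← hst]
    calc ∑ k ∈ Finset.Icc 1 q, (S.p n : ℝ) ^ k * (K₁ * ℓ ^ (2 * q) * (s * t) ^ k)
        ≤ ∑ _k ∈ Finset.Icc 1 q, K₁ * ℓ ^ (2 * q) * (S.p n * (s * t)) := by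
          refine Finset.sum_le_sum fun k hk => ?_
          have hk1 := (Finset.mem_Icc.1 hk).1
          calc (S.p n : ℝ) ^ k * (K₁ * ℓ ^ (2 * q) * (s * t) ^ k)
              = K₁ * ℓ ^ (2 * q) * (S.p n * (s * t)) ^ k := by rw [mul_pow (S.p n : ℝ)]; ring
            _ ≤ _ := by
              refine mul_le_mul_of_nonneg_left ?_ (by positivity)
              exact pow_le_of_le_one hst0 hst1 (by omega)
      _ = q * K₁ * ℓ ^ (2 * q) * (S.p n * (s * t)) := by
          rw [Finset.sum_const, Nat.card_Icc, nsmul_eq_mul]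
          simp only [add_tsub_cancel_right]; ring

lemma eventually_pow_mul_exp_le {S : GLMSequence ν} (K : ℝ) (m : ℕ) {ε c : ℝ} (hε : 0 < ε)
    (hc : 0 < c) : ∀ᶠ n in atTop, K * S.logSize n ^ m * Real.exp (-(ε * S.logSize n)) ≤ c := by
  have h1 : Tendsto (fun x : ℝ => K * (x ^ m * Real.exp (-(ε * x)))) atTop (𝓝 (K * 0)) := by
    refine Tendsto.const_mul K ?_
    have := tendsto_rpow_mul_exp_neg_mul_atTop_nhds_zero (m : ℝ) ε hε
    refine this.congr fun x => ?_
    rw [Real.rpow_natCast, neg_mul]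
  rw [mul_zero] at h1
  filter_upwards [(h1.comp S.tendsto_logSize).eventually (eventually_le_nhds hc)] with n hn
  simpa [mul_assoc] using hn

/-- Away from untame designs, the true model is selected with the claimed probability. -/
theorem eventually_measure_compl_selectsTrueModel_inter_le (hν : IsExpFamilyBase ν) {q : ℕ}
    {a₁ a₂ a₃ R F₁ F₂ F₃ : ℝ} (ha₁ : 0 < a₁)
    (ha₃ : 0 ≤ a₃) (hS : S.SparseRegime q a₁ a₂ a₃) {A : ℝ} (hA : 0 ≤ A)
    (hA4 : ∀ n j, ∫⁻ x, ENNReal.ofReal (x j ^ 4) ∂(S.Q n) ≤ ENNReal.ofReal A)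
    {f : S.PriorFamily} (hf : S.PriorConditions q R F₁ F₂ F₃ f) (hR : q * (a₃ + 1) ≤ R + 1)
    (hF₁ : 0 < F₁) (hF₂ : 0 < F₂) {γ : ℝ} (hγ : 0 ≤ γ) {M : ℝ} (hM : 0 ≤ M)
    {α β ε : ℝ} (hε : 0 < ε)
    (hslack : ∀ᶠ n : ℕ in atTop, α * Real.log n + β * Real.log (S.p n) + ε * S.logSize n
      ≤ (γ - 1) * Real.log (S.p n) + Real.log n / 2) :
    ∀ᶠ n : ℕ in atTop, 0 ≤ α * Real.log n + β * Real.log (S.p n) →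
      S.P n ((S.selectsTrueModel q γ f n)ᶜ ∩ S.tameEvent M n)
        ≤ ENNReal.ofReal (1 / 2 * Real.exp (-(α * Real.log n + β * Real.log (S.p n)))) := by
  obtain ⟨c, δ, C₀, hc, hδ, hC₀, hcurv⟩ :=
    S.exists_measure_compl_curvatureEvent_le hν ha₁ ha₃ hS hA hA4
  -- Of the extra `2`, one pays for the union over the `p` coordinates and the other absorbs
  -- constants.
  set N : ℝ := |α| + |β| + 2 with hN
  have hN0 : 0 ≤ N := by positivity
  set N₂ : ℝ := γ * q + q + 1 with hN₂
  have hN₂0 : 0 ≤ N₂ := by positivity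
  -- The radius constant makes curvature beat the score for supports of size `2q`, and pushes the
  -- far log-ratio below `-N₂ ℓ`.
  set C : ℝ := 1 + (4 * q * (N + M / 2) + 2 * N₂) / c with hC
  have hC1 : 1 ≤ C := le_add_of_nonneg_right (by positivity)
  have hcC : c * C = c + (4 * q * (N + M / 2) + 2 * N₂) := by
    rw [hC, mul_add, mul_one, mul_div_cancel₀ _ hc.ne']
  have hCN : 4 * q * (N + M / 2) ≤ c * C := by rw [hcC]; linarith
  have hCN₂ : 2 * N₂ ≤ c * C := by
    have : 0 ≤ 4 * q * (N + M / 2) := by positivity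
    rw [hcC]; linarith
  set D : ℝ := Real.exp (-(q * (N + M / 2) + q ^ 2 * M / 2)) * F₂ with hD
  have hD0 : 0 < D := by positivity
  obtain ⟨K, hK, hcube⟩ := S.exists_measure_compl_cubeEvent_le hν (q := q) hγ hC1 hD0 hF₁
  have hCpos : 0 < C := by linarith
  filter_upwards [eventually_ge_atTop 1, S.tendsto_logSize.eventually_ge_atTop 1,
    S.tendsto_logSize.eventually_ge_atTop (q : ℝ),
    eventually_pow_mul_exp_le (S := S) 1 0 one_pos (c := D / 4) (by positivity),
    -- Each of the three bad events receives a sixth of the target rate; the other half is kept for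
    -- untame designs in the case `κ = 0`.
    eventually_pow_mul_exp_le (S := S) 2 0 one_pos (c := 1 / 6) (by positivity),
    eventually_pow_mul_exp_le (S := S) C₀ 0 one_pos (c := 1 / 6) (by positivity),
    eventually_pow_mul_exp_le (S := S) K (2 * q) hε (c := 1 / 6) (by positivity),
    hS.eventually_logSize_le (c := 1 / C ^ 2) (by positivity),
    hS.eventually_logSize_le (c := δ / (2 * q + 1 + (|α| + |β|))) (by positivity),
    hS.signal_lower (1 / C) (by positivity), hslack]
    with n hn hℓ hℓq hDℓ h2ℓ hC₀ℓ hKℓ hℓn hℓδ hsig hsl hE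
  have hn' : (0 : ℝ) < n := by exact_mod_cast hn
  have hp' : (0 : ℝ) < S.p n := by exact_mod_cast S.one_le_p n
  simp only [pow_zero, mul_one, one_mul] at hDℓ h2ℓ hC₀ℓ
  set E := α * Real.log n + β * Real.log (S.p n) with hEdef
  have hEℓ : E ≤ (|α| + |β|) * S.logSize n := S.abs_linear_le_logSize n α β
  have hpexp : (S.p n : ℝ) ≤ Real.exp (S.logSize n) := by
    rw [← Real.exp_log hp']; exact Real.exp_le_exp.2 (S.log_p_le_logSize n)
  set ℓ := S.logSize n with hℓdef
  have hℓ0 : 0 < ℓ := by linarith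
  have hscaleC : C * S.scale n ≤ 1 := by
    have : S.scale n ≤ 1 / C := by
      rw [scale, Real.sqrt_le_left (by positivity), div_le_iff₀ hn', div_pow, one_pow]
      exact hℓn
    rwa [le_div_iff₀ hCpos, mul_comm] at this
  have hm := hS.sparse n
  have hmul := S.modelPrior_pos (γ := γ) hm
  have hTE : 0 < S.trueEvidenceBound n D := by rw [trueEvidenceBound]; positivity
  have hexp := S.exp_neg_le_modelPrior_mul hγ hD0 hn hℓ hm hDℓ
  have hpD : 0 < modelPrior (S.p n) q γ (S.trueModel n) * S.trueEvidenceBound n D := by positivity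
  have hprior1 : ∀ J : Finset (Fin (S.p n)), J.card ≤ q → modelPrior (S.p n) q γ J ≤ 1 :=
    fun J hJ => by
      rw [modelPrior_of_le hJ]; exact choose_rpow_neg_le_one hγ (S.card_le_p J)
  have hsub : (S.selectsTrueModel q γ f n)ᶜ ∩ S.tameEvent M n ⊆
      (S.scoreEvent n (S.scale n) (N * ℓ))ᶜ ∪ (S.curvatureEvent n (2 * q) c)ᶜ ∪
        (S.cubeEvent n q (C * S.scale n) (S.cubeLevel q γ D F₁ n))ᶜ := by
    rintro ω ⟨hsel, htame⟩
    by_contra hcon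
    simp only [Set.mem_union, Set.mem_compl_iff, not_or, not_not] at hcon
    obtain ⟨⟨hω1, hω2⟩, hω3⟩ := hcon
    refine hsel ?_
    obtain ⟨hfar, hden⟩ := S.bounds_of_events hν ha₃ hS hf hR hF₂.le hn hℓ hℓq hN0 hM hc hC1
      hscaleC hCN hCN₂ hω1 hω2 htame
    have hu : ∀ J : Finset (Fin (S.p n)), J.card ≤ q →
        modelPrior (S.p n) q γ J * Real.exp (-(N₂ * ℓ))
          ≤ modelPrior (S.p n) q γ (S.trueModel n) * S.trueEvidenceBound n D / 4 := fun J hJ =>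
      (mul_le_of_le_one_left (Real.exp_nonneg _) (hprior1 J hJ)).trans hexp
    refine S.selectsTrueModel_of_bounds hf hF₁.le (u := S.cubeLevel q γ D F₁ n) (fun J => ?_)
      hfar (fun j hj => ?_) hden (fun J hJ hss => (hω3 J hJ hss).le) (fun J hJ => ?_)
      (fun J hJ hss => ?_)
    · have : 0 ≤ modelPrior (S.p n) q γ J := by unfold modelPrior; split_ifs <;> positivity
      rw [cubeLevel]; positivity
    · have h := hsig j hj
      rw [Real.log_mul hn'.ne' hp'.ne', div_mul_eq_mul_div, one_mul, le_div_iff₀ hCpos,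
        mul_comm] at h
      exact h
    · linarith [hu J hJ]
    · have hJp := S.modelPrior_pos (γ := γ) hJ
      -- The level was defined to use exactly half of the evidence available to the true model; the
      -- far part needs at most a quarter.
      have e : modelPrior (S.p n) q γ J * (F₁ * S.cubeLevel q γ D F₁ n J)
          = modelPrior (S.p n) q γ (S.trueModel n) * S.trueEvidenceBound n D / 2 := by
        rw [cubeLevel]; field_simp
      rw [mul_add, e]
      linarith [hu J hJ]
  have b1 : S.P n (S.scoreEvent n (S.scale n) (N * ℓ))ᶜ
      ≤ ENNReal.ofReal (1 / 6 * Real.exp (-E)) := by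
    refine (S.measure_compl_scoreEvent_le hν n _ _).trans (ENNReal.ofReal_le_ofReal ?_)
    calc 2 * S.p n * Real.exp (-(N * ℓ)) ≤ 2 * Real.exp ℓ * Real.exp (-(N * ℓ)) := by gcongr
      _ = (2 * Real.exp (-ℓ)) * Real.exp (-((|α| + |β|) * ℓ)) := by
          rw [mul_assoc, mul_assoc, ← Real.exp_add, ← Real.exp_add]
          congr 2; rw [hN]; ring
      _ ≤ 1 / 6 * Real.exp (-E) := by gcongr
  have b2 : S.P n (S.curvatureEvent n (2 * q) c)ᶜ ≤ ENNReal.ofReal (1 / 6 * Real.exp (-E)) := by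
    refine (hcurv n).trans (ENNReal.ofReal_le_ofReal ?_)
    have h : (2 * q + 1 + (|α| + |β|)) * ℓ ≤ n * δ := by
      have hd : (0 : ℝ) < 2 * q + 1 + (|α| + |β|) := by positivity
      rw [div_mul_eq_mul_div, le_div_iff₀ hd] at hℓδ
      linarith
    calc C₀ * (S.p n : ℝ) ^ (2 * q) * Real.exp (-(n * δ))
        ≤ C₀ * Real.exp ℓ ^ (2 * q) * Real.exp (-((2 * q + 1 + (|α| + |β|)) * ℓ)) := by gcongr
      _ = (C₀ * Real.exp (-ℓ)) * Real.exp (-((|α| + |β|) * ℓ)) := by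
          rw [← Real.exp_nat_mul, mul_assoc, mul_assoc, ← Real.exp_add, ← Real.exp_add]
          congr 2; push_cast; ring
      _ ≤ 1 / 6 * Real.exp (-E) := by gcongr
  have b3 : S.P n (S.cubeEvent n q (C * S.scale n) (S.cubeLevel q γ D F₁ n))ᶜ
      ≤ ENNReal.ofReal (1 / 6 * Real.exp (-E)) := by
    have hεℓ : 0 < ε * ℓ := by positivity
    refine (hcube n hn hℓ hm (by linarith)).trans (ENNReal.ofReal_le_ofReal ?_)
    calc K * ℓ ^ (2 * q) * Real.exp (-((γ - 1) * Real.log (S.p n) + Real.log n / 2))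
        ≤ K * ℓ ^ (2 * q) * Real.exp (-(E + ε * ℓ)) := by gcongr
      _ = K * ℓ ^ (2 * q) * Real.exp (-(ε * ℓ)) * Real.exp (-E) := by
          rw [mul_assoc _ (Real.exp _), ← Real.exp_add]; congr 2; ring
      _ ≤ 1 / 6 * Real.exp (-E) := by gcongr
  calc _ ≤ S.P n ((S.scoreEvent n (S.scale n) (N * ℓ))ᶜ ∪ (S.curvatureEvent n (2 * q) c)ᶜ ∪
        (S.cubeEvent n q (C * S.scale n) (S.cubeLevel q γ D F₁ n))ᶜ) := measure_mono hsub
    _ ≤ ENNReal.ofReal (1 / 6 * Real.exp (-E)) + ENNReal.ofReal (1 / 6 * Real.exp (-E))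
        + ENNReal.ofReal (1 / 6 * Real.exp (-E)) :=
        (measure_union_le _ _).trans (add_le_add
          ((measure_union_le _ _).trans (add_le_add b1 b2)) b3)
    _ = ENNReal.ofReal (1 / 2 * Real.exp (-E)) := by
        rw [← ENNReal.ofReal_add (by positivity) (by positivity),
          ← ENNReal.ofReal_add (by positivity) (by positivity)]
        congr 1; ring

end GLMSequence

/-! ### From the admissibility condition to a uniform slack. -/

namespace GLMSequence

variable {ν : Measure ℝ} (S : GLMSequence ν)

/-- `κ_n = log_n p`. -/
noncomputable def kappaSeq (n : ℕ) : ℝ := Real.logb n (S.p n)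

lemma kappaSeq_nonneg {n : ℕ} (hn : 2 ≤ n) : 0 ≤ S.kappaSeq n :=
  Real.logb_nonneg (by exact_mod_cast hn) (by exact_mod_cast S.one_le_p n)

lemma log_p_eq {n : ℕ} (hn : 2 ≤ n) : Real.log (S.p n) = S.kappaSeq n * Real.log n := by
  have : Real.log n ≠ 0 := (Real.log_pos (by exact_mod_cast hn)).ne'
  rw [kappaSeq, Real.logb, div_mul_cancel₀ _ this]

lemma eventually_kappaSeq_lt {K : ℝ} (h : S.kappa < ENNReal.ofReal K) :
    ∀ᶠ n in atTop, S.kappaSeq n < K := by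
  have hK : 0 < K := ENNReal.ofReal_pos.1 (pos_of_gt h)
  filter_upwards [eventually_lt_of_limsup_lt h] with n hn
  exact (ENNReal.ofReal_lt_ofReal_iff hK).1 hn

lemma eventually_lt_kappaSeq {k : ℝ} (hk : 0 ≤ k) (h : ENNReal.ofReal k < S.kappaLow) :
    ∀ᶠ n in atTop, k < S.kappaSeq n := by
  filter_upwards [eventually_lt_of_lt_liminf h] with n hn
  exact (ENNReal.ofReal_lt_ofReal_iff_of_nonneg hk).1 hn

lemma eventually_slack_of_eventually {a b ε : ℝ}
    (h : ∀ᶠ n in atTop, 0 ≤ (a - ε) * S.kappaSeq n + (b - ε)) :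
    ∀ᶠ n in atTop, ε * S.logSize n ≤ a * Real.log (S.p n) + b * Real.log n := by
  filter_upwards [h, eventually_ge_atTop 2] with n hn hn2
  rw [logSize, S.log_p_eq hn2]
  nlinarith [mul_nonneg hn (Real.log_natCast_nonneg n)]

lemma mul_toReal_inv_pos {κ : ℝ≥0∞} (h0 : κ ≠ 0) (ht : κ ≠ ⊤) {a b : ℝ}
    (h : 0 < a + b * (κ⁻¹).toReal) : 0 < κ.toReal ∧ 0 < a * κ.toReal + b := by
  have hpos : 0 < κ.toReal := ENNReal.toReal_pos h0 ht
  refine ⟨hpos, ?_⟩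
  rw [ENNReal.toReal_inv] at h
  have := mul_pos h hpos
  rwa [add_mul, mul_assoc, inv_mul_cancel₀ hpos.ne', mul_one] at this

/-- Divided by `log n`, the claim is `a κ_n + b ≥ ε (κ_n + 1)` with `a = γ - 1 - β` and `b = 1/2 -
α`. For `a ≤ 0` the worst case is the limsup. For `a > 0` it is trivial when `b > 0`, and otherwise
the liminf is decisive. -/
lemma exists_slack {α β γ : ℝ} (h : Admissible S.kappaLow S.kappa α β γ) :
    ∃ ε, 0 < ε ∧ ∀ᶠ n : ℕ in atTop, α * Real.log n + β * Real.log (S.p n) + ε * S.logSize n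
      ≤ (γ - 1) * Real.log (S.p n) + Real.log n / 2 := by
  suffices hs : ∃ ε, 0 < ε ∧ ∀ᶠ n : ℕ in atTop,
      0 ≤ (γ - 1 - β - ε) * S.kappaSeq n + (1 / 2 - α - ε) by
    obtain ⟨ε, hε, hev⟩ := hs
    refine ⟨ε, hε, ?_⟩
    filter_upwards [S.eventually_slack_of_eventually hev] with n hn
    linarith
  set a := γ - 1 - β with ha
  set b := 1 / 2 - α with hb
  have upper : ∀ K : ℝ, 0 ≤ K → a ≤ 0 → 0 < a * K + b → S.kappa < ENNReal.ofReal K →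
      ∃ ε, 0 < ε ∧ ∀ᶠ n : ℕ in atTop, 0 ≤ (a - ε) * S.kappaSeq n + (b - ε) := by
    intro K hK ha0 hpos hκ
    -- With this `ε` the affine function vanishes at `K`; its slope `a - ε` is negative.
    refine ⟨(a * K + b) / (K + 1), by positivity, ?_⟩
    have e : (a * K + b) / (K + 1) * (K + 1) = a * K + b := div_mul_cancel₀ _ (by positivity)
    have hε : 0 < (a * K + b) / (K + 1) := by positivity
    filter_upwards [S.eventually_kappaSeq_lt hκ] with n hn
    nlinarith
  by_cases hκ : S.kappa = 0
  · obtain ⟨-, hα, -⟩ := h.1 hκ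
    have hb0 : 0 < b := by rw [hb]; linarith
    rcases lt_or_ge 0 a with ha0 | ha0
    · refine ⟨min a b, lt_min ha0 hb0, ?_⟩
      filter_upwards [eventually_ge_atTop 2] with n hn
      exact add_nonneg (mul_nonneg (sub_nonneg.2 (min_le_left _ _)) (S.kappaSeq_nonneg hn))
        (sub_nonneg.2 (min_le_right _ _))
    · refine upper (b / (2 * (1 - a))) (by have : 0 < 1 - a := by linarith
                                           positivity) ha0 ?_ ?_
      · have h1 : 0 < 1 - a := by linarith
        have e : b / (2 * (1 - a)) * (2 * (1 - a)) = b := div_mul_cancel₀ _ (by positivity)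
        have h2 : 0 < b / (2 * (1 - a)) := by positivity
        nlinarith
      · have h1 : 0 < 1 - a := by linarith
        rw [hκ, ENNReal.ofReal_pos]; positivity
  · obtain ⟨h1, h2⟩ := h.2 hκ
    have h1' : 0 < a + b * (S.kappa⁻¹).toReal := by
      rw [gammaThreshold] at h1; rw [ha, hb]; linarith
    rcases lt_or_ge α (1 / 2) with hα | hα
    · have hb0 : 0 < b := by rw [hb]; linarith
      rcases lt_or_ge 0 a with ha0 | ha0
      · refine ⟨min a b, lt_min ha0 hb0, ?_⟩
        filter_upwards [eventually_ge_atTop 2] with n hn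
        exact add_nonneg (mul_nonneg (sub_nonneg.2 (min_le_left _ _)) (S.kappaSeq_nonneg hn))
          (sub_nonneg.2 (min_le_right _ _))
      -- At `κ = ∞` the threshold condition reads `a > 0`.
      · have hκt : S.kappa ≠ ⊤ := fun ht => by
          rw [ht] at h1'; simp at h1'; linarith
        obtain ⟨hk, hpos⟩ := mul_toReal_inv_pos hκ hκt h1'
        set k := S.kappa.toReal with hkdef
        have h1 : 0 < 1 - a := by linarith
        have hη : 0 < (a * k + b) / (2 * (1 - a)) := by positivity
        have e : (a * k + b) / (2 * (1 - a)) * (2 * (1 - a)) = a * k + b :=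
          div_mul_cancel₀ _ (by positivity)
        refine upper (k + (a * k + b) / (2 * (1 - a))) (by positivity) ha0 (by nlinarith) ?_
        rw [← ENNReal.ofReal_toReal hκt, ENNReal.ofReal_lt_ofReal_iff (by positivity)]
        linarith
    · obtain ⟨hκ', h3⟩ := h2 hα
      have h3' : 0 < a + b * (S.kappaLow⁻¹).toReal := by
        rw [gammaThreshold] at h3; rw [ha, hb]; linarith
      have hb0 : b ≤ 0 := by rw [hb]; linarith
      have ha0 : 0 < a := by
        have := mul_nonneg (neg_nonneg.2 hb0) (ENNReal.toReal_nonneg (a := S.kappaLow⁻¹))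
        linarith
      have hba : 0 ≤ -b / a := div_nonneg (by linarith) ha0.le
      have eba : a * (-b / a) = -b := mul_div_cancel₀ _ ha0.ne'
      -- A point strictly between the zero `-b / a` of the affine function and the liminf.
      obtain ⟨k, hk0, hk, hpos⟩ : ∃ k : ℝ, 0 ≤ k ∧ ENNReal.ofReal k < S.kappaLow ∧
          0 < a * k + b := by
        by_cases ht : S.kappaLow = ⊤
        · refine ⟨-b / a + 1, by positivity, by rw [ht]; exact ENNReal.ofReal_lt_top, ?_⟩
          rw [mul_add, eba]; linarith
        · obtain ⟨hk, hpos⟩ := mul_toReal_inv_pos hκ' ht h3'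
          refine ⟨(S.kappaLow.toReal + -b / a) / 2, by positivity, ?_, by nlinarith⟩
          rw [ENNReal.ofReal_lt_iff_lt_toReal (by positivity) ht]
          have : -b / a < S.kappaLow.toReal := by rw [div_lt_iff₀ ha0]; linarith
          linarith
      have hε1 : 0 < (a * k + b) / (k + 1) := by positivity
      refine ⟨min a ((a * k + b) / (k + 1)), lt_min ha0 hε1, ?_⟩
      filter_upwards [S.eventually_lt_kappaSeq hk0 hk] with n hn
      set ε := min a ((a * k + b) / (k + 1)) with hε
      have h4 : ε ≤ a := min_le_left _ _
      have h5 : ε * (k + 1) ≤ a * k + b := by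
        have := min_le_right a ((a * k + b) / (k + 1))
        rwa [← hε, le_div_iff₀ (by positivity)] at this
      nlinarith

end GLMSequence

/-! ### Probability bounds for selection, and consistency. -/

namespace GLMSequence

variable {ν : Measure ℝ} (S : GLMSequence ν)

lemma rpow_mul_rpow_eq_exp {n : ℕ} (hn : 1 ≤ n) (α β : ℝ) :
    (n : ℝ) ^ (-α) * (S.p n : ℝ) ^ (-β)
      = Real.exp (-(α * Real.log n + β * Real.log (S.p n))) := by
  have hn' : (0 : ℝ) < n := by exact_mod_cast hn
  have hp' : (0 : ℝ) < S.p n := by exact_mod_cast S.one_le_p n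
  rw [Real.rpow_def_of_pos hn', Real.rpow_def_of_pos hp', ← Real.exp_add]
  congr 1; ring

theorem eventually_le_measureReal_selectsTrueModel (hν : IsExpFamilyBase ν) {q : ℕ}
    {a₁ a₂ a₃ R F₁ F₂ F₃ : ℝ} (ha₁ : 0 < a₁)
    (ha₃ : 0 ≤ a₃) (hS : S.SparseRegime q a₁ a₂ a₃) {A : ℝ} (hA : 0 ≤ A)
    (hA4 : ∀ n j, ∫⁻ x, ENNReal.ofReal (x j ^ 4) ∂(S.Q n) ≤ ENNReal.ofReal A)
    {f : S.PriorFamily} (hf : S.PriorConditions q R F₁ F₂ F₃ f) (hR : q * (a₃ + 1) ≤ R + 1)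
    (hF₁ : 0 < F₁) (hF₂ : 0 < F₂) {γ : ℝ} (hγ : 0 ≤ γ) {M : ℝ} (hM : 0 ≤ M)
    {α β : ℝ} (hadm : Admissible S.kappaLow S.kappa α β γ) {δ : ℕ → ℝ}
    (hδ0 : ∀ n, 0 ≤ δ n)
    (hδ : ∀ᶠ n in atTop, S.P n (S.tameEvent M n)ᶜ ≤ ENNReal.ofReal (δ n)) :
    ∀ᶠ n : ℕ in atTop, 0 ≤ α * Real.log n + β * Real.log (S.p n) →
      1 - δ n - (n : ℝ) ^ (-α) * (S.p n : ℝ) ^ (-β) / 2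
        ≤ (S.P n).real (S.selectsTrueModel q γ f n) := by
  obtain ⟨ε, hε, hslack⟩ := S.exists_slack hadm
  filter_upwards [S.eventually_measure_compl_selectsTrueModel_inter_le hν ha₁ ha₃ hS hA hA4 hf hR
    hF₁ hF₂ hγ hM hε hslack, hδ, eventually_ge_atTop 1] with n hn hδn hn1 hE
  rw [S.rpow_mul_rpow_eq_exp hn1]
  set e := Real.exp (-(α * Real.log n + β * Real.log (S.p n)))
  have he : 0 ≤ e := Real.exp_nonneg _
  set s := S.selectsTrueModel q γ f n
  have h1 : S.P n sᶜ ≤ ENNReal.ofReal (1 / 2 * e + δ n) := by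
    rw [ENNReal.ofReal_add (by positivity) (hδ0 n)]
    refine (measure_mono fun ω hω => ?_).trans ((measure_union_le (sᶜ ∩ S.tameEvent M n)
      (S.tameEvent M n)ᶜ).trans (add_le_add (hn hE) hδn))
    by_cases h : ω ∈ S.tameEvent M n
    · exact Or.inl ⟨hω, h⟩
    · exact Or.inr h
  have h2 : (S.P n).real sᶜ ≤ 1 / 2 * e + δ n :=
    ENNReal.toReal_le_of_le_ofReal (add_nonneg (by positivity) (hδ0 n)) h1
  -- Subadditivity suffices, so no measurability of the selection event is needed.
  have h3 : (1 : ℝ) ≤ (S.P n).real s + (S.P n).real sᶜ := by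
    have := measureReal_union_le (μ := S.P n) s sᶜ
    rwa [Set.union_compl_self, probReal_univ] at this
  linarith

lemma one_le_rpow_mul_rpow {n : ℕ} (hn : 1 ≤ n) {α β : ℝ}
    (h : ¬ 0 ≤ α * Real.log n + β * Real.log (S.p n)) :
    1 ≤ (n : ℝ) ^ (-α) * (S.p n : ℝ) ^ (-β) := by
  rw [S.rpow_mul_rpow_eq_exp hn]
  exact Real.one_le_exp (by linarith)

lemma tendsto_rpow_mul_rpow {α β : ℝ} (hα : 0 < α) (hβ : 0 ≤ β) :
    Tendsto (fun n : ℕ => (n : ℝ) ^ (-α) * (S.p n : ℝ) ^ (-β)) atTop (𝓝 0) := by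
  refine squeeze_zero (fun n => by positivity) (fun n => ?_)
    ((tendsto_rpow_neg_atTop hα).comp tendsto_natCast_atTop_atTop)
  refine mul_le_of_le_one_right (by positivity) ?_
  exact Real.rpow_le_one_of_one_le_of_nonpos (by exact_mod_cast S.one_le_p n) (by linarith)

lemma exists_admissible {γ : ℝ} (h : S.kappa = 0 ∨ 1 - (S.kappa⁻¹).toReal / 2 < γ) :
    ∃ α β : ℝ, 0 < α ∧ 0 ≤ β ∧ Admissible S.kappaLow S.kappa α β γ := by
  by_cases hκ : S.kappa = 0
  · exact ⟨1 / 4, 1, by norm_num, by norm_num, fun _ => by norm_num, fun h => absurd hκ h⟩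
  · have h' := h.resolve_left hκ
    set τ := (S.kappa⁻¹).toReal with hτ
    have hτ0 : 0 ≤ τ := ENNReal.toReal_nonneg
    set x := γ - (1 - τ / 2) with hx
    have hx0 : 0 < x := by linarith
    -- Keeping `α` below `1/2` makes the liminf condition void; the second bound spends at most half
    -- of the excess `x` of `γ` over the threshold.
    refine ⟨min (1 / 4) (x / (2 * (τ + 1))), 0, lt_min (by norm_num) (by positivity), le_rfl,
      fun h => absurd h hκ, fun _ => ⟨?_, fun h => ?_⟩⟩
    · rw [gammaThreshold, ← hτ]
      have h1 : min (1 / 4) (x / (2 * (τ + 1))) * τ ≤ x / (2 * (τ + 1)) * τ :=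
        mul_le_mul_of_nonneg_right (min_le_right _ _) hτ0
      have h2 : x / (2 * (τ + 1)) * (2 * (τ + 1)) = x := div_mul_cancel₀ _ (by positivity)
      have h3 : 0 < x / (2 * (τ + 1)) := by positivity
      nlinarith
    · have := min_le_left (1 / 4 : ℝ) (x / (2 * (τ + 1)))
      linarith

lemma tendsto_measureReal_of_le {q : ℕ} {γ : ℝ} {f : S.PriorFamily} {e : ℕ → ℝ}
    (he : Tendsto e atTop (𝓝 0))
    (h : ∀ᶠ n in atTop, 1 - e n ≤ (S.P n).real (S.selectsTrueModel q γ f n)) :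
    Tendsto (fun n => (S.P n).real (S.selectsTrueModel q γ f n)) atTop (𝓝 1) := by
  have h1 : Tendsto (fun n => 1 - e n) atTop (𝓝 1) := by simpa using he.const_sub 1
  exact tendsto_of_tendsto_of_tendsto_of_le_of_le' h1 tendsto_const_nhds h
    (Eventually.of_forall fun n => measureReal_le_one)

/-! ### Tame designs for bounded covariates. -/

section Bounded

variable {S}

lemma BoundedCovariates.fourth_moment {A : ℝ} (h : S.BoundedCovariates A) (n : ℕ)
    (j : Fin (S.p n)) : ∫⁻ x, ENNReal.ofReal (x j ^ 4) ∂(S.Q n) ≤ ENNReal.ofReal (A ^ 4) := by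
  calc ∫⁻ x, ENNReal.ofReal (x j ^ 4) ∂(S.Q n) ≤ ∫⁻ _x, ENNReal.ofReal (A ^ 4) ∂(S.Q n) := by
        refine lintegral_mono_ae ((h n j).mono fun x hx => ENNReal.ofReal_le_ofReal ?_)
        rw [← Even.pow_abs (by decide : Even 4)]
        exact pow_le_pow_left₀ (abs_nonneg _) hx 4
    _ = ENNReal.ofReal (A ^ 4) := by simp

/-- Almost surely all linear predictors lie in a fixed compact interval, so both requirements hold
as soon as the noise level is at most `1 / (A + 1)`. -/
lemma BoundedCovariates.exists_tame {q : ℕ} {a₁ a₂ a₃ : ℝ} (hν : IsExpFamilyBase ν)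
    (ha₃ : 0 ≤ a₃) (hS : S.SparseRegime q a₁ a₂ a₃) {A : ℝ} (hA : 0 ≤ A)
    (h : S.BoundedCovariates A) :
    ∃ M, 0 ≤ M ∧ ∀ᶠ n in atTop, S.P n (S.tameEvent M n)ᶜ ≤ ENNReal.ofReal 0 := by
  set V := varSup ν (q * a₃ * A + 1) with hV
  have hV0 : 0 ≤ V := absSup_nonneg _ _
  refine ⟨A ^ 2 * V, by positivity, ?_⟩
  filter_upwards [eventually_ge_atTop 1, hS.eventually_logSize_le
    (c := (1 / (A + 1)) ^ 2) (by positivity)] with n hn hℓ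
  have hn' : (0 : ℝ) < n := by exact_mod_cast hn
  rw [ENNReal.ofReal_zero, nonpos_iff_eq_zero]
  have hae : ∀ᵐ ω ∂(S.P n), ∀ i j, |S.X n i ω j| ≤ A := by
    rw [ae_all_iff]; intro i
    rw [ae_all_iff]; intro j
    have := h n j
    rw [← S.map_X hν n i] at this
    exact ae_of_ae_map (S.measurable_X n i).aemeasurable this
  rw [← mem_ae_iff]
  have hscale : S.scale n ≤ 1 / (A + 1) := by
    rw [scale, Real.sqrt_le_left (by positivity), div_le_iff₀ hn']
    exact hℓ
  filter_upwards [hae] with ω hgood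
  refine ⟨fun i j => ?_, fun j => ?_⟩
  · calc S.scale n * |S.X n i ω j| ≤ 1 / (A + 1) * A :=
          mul_le_mul hscale (hgood i j) (abs_nonneg _) (by positivity)
      _ ≤ 1 := by rw [one_div, inv_mul_le_iff₀ (by positivity)]; linarith
  · calc ∑ i, S.X n i ω j ^ 2 * varSup ν (|S.X n i ω ⬝ᵥ (S.φ n).ofLp| + 1)
        ≤ ∑ _i : Fin n, A ^ 2 * V := by
          refine Finset.sum_le_sum fun i _ => ?_
          refine mul_le_mul ?_ ?_ (absSup_nonneg _ _) (by positivity)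
          · rw [← sq_abs]; exact pow_le_pow_left₀ (abs_nonneg _) (hgood i j) 2
          · refine absSup_mono (hν.continuous_iteratedDeriv_cumulant 2) ?_
            have := abs_dotProduct_le_of_support (hS.sparse n) hA ha₃ (fun j _ => hgood i j)
              (S.abs_coord_le_norm hS n)
              (fun j hj => by by_contra hne; exact hj (by simpa [trueModel] using hne))
            linarith
      _ = A ^ 2 * V * n := by
          rw [Finset.sum_const, Finset.card_univ, Fintype.card_fin, nsmul_eq_mul]; ring

end Bounded

end GLMSequence

/-! ### The variance function under control of the third derivative. -/

/-- `s` times the supremum of `|b'''|` over `[-t s, t s]`, at `s = |x|`. -/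
noncomputable def thirdSup (ν : Measure ℝ) (t x : ℝ) : ℝ :=
  |x| * absSup (iteratedDeriv 3 (cumulant ν)) (t * |x|)

lemma thirdSup_nonneg (ν : Measure ℝ) (t x : ℝ) : 0 ≤ thirdSup ν t x :=
  mul_nonneg (abs_nonneg _) (absSup_nonneg _ _)

namespace IsExpFamilyBase

variable {ν : Measure ℝ}

lemma measurable_thirdSup (hν : IsExpFamilyBase ν) (t : ℝ) : Measurable (thirdSup ν t) :=
  measurable_norm.mul ((measurable_absSup (hν.continuous_iteratedDeriv_cumulant 3)).comp
    (measurable_norm.const_mul t))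

lemma measurable_varSup (hν : IsExpFamilyBase ν) : Measurable (varSup ν) :=
  measurable_absSup (hν.continuous_iteratedDeriv_cumulant 2)

lemma varSup_le (hν : IsExpFamilyBase ν) {s : ℝ} (hs : 0 ≤ s) :
    varSup ν s ≤ iteratedDeriv 2 (cumulant ν) 0
      + s * absSup (iteratedDeriv 3 (cumulant ν)) s := by
  obtain ⟨ξ, hξ, h⟩ := exists_absSup_eq (hν.continuous_iteratedDeriv_cumulant 2) hs
  have hd : Differentiable ℝ (iteratedDeriv 2 (cumulant ν)) :=
    (hν.contDiff_cumulant 3).differentiable_iteratedDeriv 2 (by norm_num)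
  have h1 := (convex_Icc (-s) s).norm_image_sub_le_of_norm_deriv_le
    (f := iteratedDeriv 2 (cumulant ν)) (C := absSup (iteratedDeriv 3 (cumulant ν)) s)
    (x := 0) (y := ξ) (fun x _ => hd x) (fun x hx => by
      rw [← iteratedDeriv_succ]
      exact abs_le_absSup (hν.continuous_iteratedDeriv_cumulant 3) (abs_le.2 hx))
    ⟨by linarith, hs⟩ (abs_le.1 hξ)
  rw [sub_zero, Real.norm_eq_abs, Real.norm_eq_abs] at h1
  have h2 := mul_le_mul_of_nonneg_left hξ (absSup_nonneg (iteratedDeriv 3 (cumulant ν)) s)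
  have h3 := hν.iteratedDeriv_two_cumulant_pos ξ
  have h4 := le_abs_self (iteratedDeriv 2 (cumulant ν) ξ - iteratedDeriv 2 (cumulant ν) 0)
  rw [varSup, h, abs_of_pos h3]
  linarith

/-- The moment condition concerns `b'''` at multiples of one entry, so the linear predictor is
reduced to its largest entry. If all entries are at most `1 / t`, the interval lies in `[-2, 2]`.
Otherwise the largest entry has `t |x_l| > 1`, which absorbs the added `1`, and `varSup_le` applies.
-/
lemma varSup_add_one_le (hν : IsExpFamilyBase ν) {p q : ℕ} {J : Finset (Fin p)}
    (hJ : J.card ≤ q) {φ : Fin p → ℝ} {a t : ℝ} (ha : 0 ≤ a) (ht : 0 < t) (hat : q * a ≤ t)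
    (hφ : ∀ j, |φ j| ≤ a) (hφJ : ∀ j ∉ J, φ j = 0) (x : Fin p → ℝ) :
    varSup ν (|x ⬝ᵥ φ| + 1) ≤ varSup ν 2 + iteratedDeriv 2 (cumulant ν) 0
      + 2 * t * ∑ l ∈ J, thirdSup ν (2 * t) (x l) := by
  have hmono := absSup_mono (hν.continuous_iteratedDeriv_cumulant 2)
  have hb0 := hν.iteratedDeriv_two_cumulant_pos 0
  have hsum : 0 ≤ ∑ l ∈ J, thirdSup ν (2 * t) (x l) :=
    Finset.sum_nonneg fun _ _ => thirdSup_nonneg _ _ _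
  have hV2 : 0 ≤ varSup ν 2 := absSup_nonneg _ _
  have hθ : ∀ m : ℝ, 0 ≤ m → (∀ l ∈ J, |x l| ≤ m) → |x ⬝ᵥ φ| ≤ t * m := fun m hm h =>
    (GLMSequence.abs_dotProduct_le_of_support hJ hm ha h hφ hφJ).trans
      (mul_le_mul_of_nonneg_right hat hm)
  by_cases hsmall : ∀ l ∈ J, |x l| ≤ 1 / t
  · have h1 := hθ (1 / t) (by positivity) hsmall
    rw [mul_one_div_cancel ht.ne'] at h1
    have h2 : varSup ν (|x ⬝ᵥ φ| + 1) ≤ varSup ν 2 := hmono (by linarith)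
    have h3 : 0 ≤ 2 * t * ∑ l ∈ J, thirdSup ν (2 * t) (x l) := by positivity
    linarith
  · push Not at hsmall
    obtain ⟨l₁, hl₁, hgt⟩ := hsmall
    obtain ⟨l, hl, hmax⟩ := J.exists_max_image (fun l => |x l|) ⟨l₁, hl₁⟩
    have hm : 1 < t * |x l| := by
      rw [div_lt_iff₀' ht] at hgt
      exact hgt.trans_le (mul_le_mul_of_nonneg_left (hmax l₁ hl₁) ht.le)
    have h1 := hθ |x l| (abs_nonneg _) hmax
    have h2 : varSup ν (|x ⬝ᵥ φ| + 1) ≤ varSup ν (2 * t * |x l|) := hmono (by linarith)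
    have h3 := hν.varSup_le (s := 2 * t * |x l|) (by positivity)
    have h4 : thirdSup ν (2 * t) (x l) ≤ ∑ l ∈ J, thirdSup ν (2 * t) (x l) :=
      Finset.single_le_sum (f := fun l => thirdSup ν (2 * t) (x l))
        (fun _ _ => thirdSup_nonneg _ _ _) hl
    have h5 := mul_le_mul_of_nonneg_left h4 (by positivity : 0 ≤ 2 * t)
    rw [thirdSup, ← mul_assoc] at h5
    linarith

end IsExpFamilyBase

/-! ### Moment estimates and Markov bounds for nonnegative functions. -/

section MomentBounds

variable {Ω : Type*} [MeasurableSpace Ω] {μ : Measure Ω}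

lemma lintegral_ofReal_add_le {g h : Ω → ℝ} {a b : ℝ} (hg : Measurable g) (ha : 0 ≤ a)
    (hb : 0 ≤ b) (hga : ∫⁻ x, ENNReal.ofReal (g x) ∂μ ≤ ENNReal.ofReal a)
    (hhb : ∫⁻ x, ENNReal.ofReal (h x) ∂μ ≤ ENNReal.ofReal b) :
    ∫⁻ x, ENNReal.ofReal (g x + h x) ∂μ ≤ ENNReal.ofReal (a + b) := by
  calc ∫⁻ x, ENNReal.ofReal (g x + h x) ∂μ
      ≤ ∫⁻ x, ENNReal.ofReal (g x) + ENNReal.ofReal (h x) ∂μ :=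
        lintegral_mono fun x => ENNReal.ofReal_add_le
    _ = ∫⁻ x, ENNReal.ofReal (g x) ∂μ + ∫⁻ x, ENNReal.ofReal (h x) ∂μ :=
        lintegral_add_left hg.ennreal_ofReal _
    _ ≤ _ := by rw [ENNReal.ofReal_add ha hb]; exact add_le_add hga hhb

lemma lintegral_ofReal_mul_le {g : Ω → ℝ} {a c : ℝ} (hc : 0 ≤ c)
    (hga : ∫⁻ x, ENNReal.ofReal (g x) ∂μ ≤ ENNReal.ofReal a) :
    ∫⁻ x, ENNReal.ofReal (c * g x) ∂μ ≤ ENNReal.ofReal (c * a) := by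
  simp_rw [ENNReal.ofReal_mul hc]
  rw [lintegral_const_mul' _ _ ENNReal.ofReal_ne_top]
  gcongr

lemma lintegral_ofReal_sum_le {ι : Type*} (s : Finset ι) {g : ι → Ω → ℝ} {a : ℝ}
    (hg : ∀ i, Measurable (g i)) (ha : 0 ≤ a)
    (hga : ∀ i, ∫⁻ x, ENNReal.ofReal (g i x) ∂μ ≤ ENNReal.ofReal a) :
    ∫⁻ x, ENNReal.ofReal (∑ i ∈ s, g i x) ∂μ ≤ ENNReal.ofReal (s.card * a) := by
  classical
  induction s using Finset.induction_on with
  | empty => simp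
  | insert i s hi ih =>
    simp_rw [Finset.sum_insert hi]
    rw [Finset.card_insert_of_notMem hi]
    refine (lintegral_ofReal_add_le (hg i) ha (by positivity) (hga i) ih).trans (le_of_eq ?_)
    push_cast
    congr 1; ring

lemma measure_ge_le_of_moment {g : Ω → ℝ} (hg : Measurable g) {r : ℕ}
    {a c : ℝ} (hc : 0 < c) (h : ∫⁻ x, ENNReal.ofReal (g x ^ r) ∂μ ≤ ENNReal.ofReal a) :
    μ {x | c ≤ g x} ≤ ENNReal.ofReal (a / c ^ r) := by
  rw [ENNReal.ofReal_div_of_pos (by positivity)]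
  refine (measure_mono fun x hx => ?_).trans ((meas_ge_le_lintegral_div
    (hg.pow_const r).ennreal_ofReal.aemeasurable (ε := ENNReal.ofReal (c ^ r))
    (by simp; positivity) ENNReal.ofReal_ne_top).trans (ENNReal.div_le_div_right h _))
  exact ENNReal.ofReal_le_ofReal (pow_le_pow_left₀ hc.le hx r)

end MomentBounds

namespace GLMSequence

variable {ν : Measure ℝ} {S : GLMSequence ν}

lemma MomentCovariates.pos {K : ℕ} {A : ℝ} {B : ℝ → ℝ} (h : S.MomentCovariates K A B) :
    0 < K := by
  have := pos_of_gt h.two_kappa_lt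
  exact_mod_cast this

lemma MomentCovariates.abs_moment {K : ℕ} {A : ℝ} {B : ℝ → ℝ} (h : S.MomentCovariates K A B)
    (n : ℕ) (j : Fin (S.p n)) :
    ∫⁻ x, ENNReal.ofReal (|x j| ^ (6 * K)) ∂(S.Q n) ≤ ENNReal.ofReal (max A 0) :=
  (h.moment n j).trans (ENNReal.ofReal_le_ofReal (le_max_left _ _))

lemma pow_le_one_add_pow {x : ℝ} (hx : 0 ≤ x) {k l : ℕ} (hkl : k ≤ l) : x ^ k ≤ 1 + x ^ l := by
  rcases le_total x 1 with h | h
  · have := pow_le_one₀ hx h (n := k)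
    have : 0 ≤ x ^ l := by positivity
    linarith
  · have := pow_le_pow_right₀ h hkl
    linarith

lemma MomentCovariates.fourth_moment {K : ℕ} {A : ℝ} {B : ℝ → ℝ} (h : S.MomentCovariates K A B)
    (n : ℕ) (j : Fin (S.p n)) :
    ∫⁻ x, ENNReal.ofReal (x j ^ 4) ∂(S.Q n) ≤ ENNReal.ofReal (1 + max A 0) := by
  have hK := h.pos
  refine le_trans (lintegral_mono fun x => ENNReal.ofReal_le_ofReal ?_)
    (lintegral_ofReal_add_le (g := fun _ => 1) (a := 1) measurable_const zero_le_one
      (le_max_right A 0) (by simp) (h.abs_moment n j))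
  rw [← Even.pow_abs (by decide : Even 4)]
  exact pow_le_one_add_pow (abs_nonneg _) (by omega)

/-- With `u = |x| ^ (3k)` and `v` the `k`-th power of the supremum, the integrand is `u v³ ≤ u⁴ +
v⁴`, and these are the two moments assumed for `K = 2k`. This fixes the exponent `3k`. -/
lemma MomentCovariates.thirdSup_moment (hν : IsExpFamilyBase ν) {k : ℕ} {A : ℝ} {B : ℝ → ℝ}
    (h : S.MomentCovariates (2 * k) A B) {t : ℝ} (ht : 0 < t) (n : ℕ) (j : Fin (S.p n)) :
    ∫⁻ x, ENNReal.ofReal (thirdSup ν t (x j) ^ (3 * k)) ∂(S.Q n)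
      ≤ ENNReal.ofReal (max A 0 + max (B t) 0) := by
  have hm : Measurable fun x : Fin (S.p n) → ℝ => |x j| ^ (6 * (2 * k)) :=
    (measurable_pi_apply j).abs.pow_const _
  refine le_trans (lintegral_mono fun x => ENNReal.ofReal_le_ofReal ?_)
    (lintegral_ofReal_add_le (h := fun x => absSup (iteratedDeriv 3 (cumulant ν)) (t * |x j|)
      ^ (2 * (2 * k))) hm (le_max_right A 0) (le_max_right (B t) 0) (h.abs_moment n j) ?_)
  · rw [thirdSup]
    set u := |x j| ^ (3 * k) with hu
    set v := absSup (iteratedDeriv 3 (cumulant ν)) (t * |x j|) ^ k with hv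
    have hu0 : 0 ≤ u := by positivity
    have hv0 : 0 ≤ v := pow_nonneg (absSup_nonneg _ _) _
    have e1 : (|x j| * absSup (iteratedDeriv 3 (cumulant ν)) (t * |x j|)) ^ (3 * k)
        = u * v ^ 3 := by rw [mul_pow, hv, ← pow_mul, mul_comm k 3]
    have e2 : |x j| ^ (6 * (2 * k)) = u ^ 4 := by rw [hu, ← pow_mul]; congr 1; ring
    have e3 : absSup (iteratedDeriv 3 (cumulant ν)) (t * |x j|) ^ (2 * (2 * k)) = v ^ 4 := by
      rw [hv, ← pow_mul]; congr 1; ring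
    rw [e1, e2, e3]
    rcases le_total u v with huv | huv
    · have := mul_le_mul_of_nonneg_right huv (pow_nonneg hv0 3)
      nlinarith [pow_nonneg hu0 4]
    · have := mul_le_mul_of_nonneg_left (pow_le_pow_left₀ hv0 huv 3) hu0
      nlinarith [pow_nonneg hv0 4]
  · refine le_trans (lintegral_mono fun x => ?_) ((h.third_deriv t ht n j).trans
      (ENNReal.ofReal_le_ofReal (le_max_left _ _)))
    obtain ⟨θ, hθ, e⟩ := exists_absSup_eq (hν.continuous_iteratedDeriv_cumulant 3)
      (s := t * |x j|) (by positivity)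
    rw [e]
    exact le_iSup₂_of_le θ (abs_le.1 hθ) le_rfl

end GLMSequence

/-! ### Untame designs under moment conditions. -/

namespace GLMSequence

variable {ν : Measure ℝ} (S : GLMSequence ν)

lemma measure_comp_X (hν : IsExpFamilyBase ν) (n : ℕ) (i : Fin n) {s : Set (Fin (S.p n) → ℝ)}
    (hs : MeasurableSet s) : S.P n {ω | S.X n i ω ∈ s} = S.Q n s := by
  rw [← S.map_X hν n i, Measure.map_apply (S.measurable_X n i) hs]; rfl

lemma measure_exists_index_le (hν : IsExpFamilyBase ν) (n : ℕ) {s : Set (Fin (S.p n) → ℝ)}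
    (hs : MeasurableSet s) {c : ℝ} (h : S.Q n s ≤ ENNReal.ofReal c) :
    S.P n {ω | ∃ i, S.X n i ω ∈ s} ≤ ENNReal.ofReal (n * c) := by
  have e : {ω | ∃ i, S.X n i ω ∈ s} = ⋃ i, {ω | S.X n i ω ∈ s} := by ext; simp
  rw [e]
  refine (measure_iUnion_fintype_le _ _).trans ?_
  simp_rw [S.measure_comp_X hν n _ hs]
  rw [Finset.sum_const, Finset.card_univ, Fintype.card_fin, nsmul_eq_mul,
    ENNReal.ofReal_mul (Nat.cast_nonneg n), ENNReal.ofReal_natCast]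
  gcongr

/-- Chernoff's bound for terms truncated at `L`: since `exp y ≤ 1 + 2y` on `[0, 1]`, each factor has
mean at most `exp (2 M₀ / L)`, and the threshold `3 M₀ n` leaves `exp (-M₀ n / L)`. -/
lemma measure_le_sum_min_le (hν : IsExpFamilyBase ν) (n : ℕ) {g : (Fin (S.p n) → ℝ) → ℝ}
    (hg : Measurable g) (hg0 : ∀ x, 0 ≤ g x) {L M₀ : ℝ} (hL : 0 < L) (hM₀ : 0 ≤ M₀)
    (hgM : ∫⁻ x, ENNReal.ofReal (g x) ∂(S.Q n) ≤ ENNReal.ofReal M₀) :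
    S.P n {ω | 3 * M₀ * n ≤ ∑ i, min (g (S.X n i ω)) L}
      ≤ ENNReal.ofReal (Real.exp (-(M₀ * n / L))) := by
  set w : (Fin (S.p n) → ℝ) → ℝ≥0∞ := fun x => ENNReal.ofReal (Real.exp (min (g x) L / L))
    with hw
  have hwm : Measurable w := ((hg.min measurable_const).div_const L).exp.ennreal_ofReal
  have hone : ∫⁻ x, w x ∂(S.Q n) ≤ ENNReal.ofReal (Real.exp (2 * M₀ / L)) := by
    calc ∫⁻ x, w x ∂(S.Q n) ≤ ∫⁻ x, ENNReal.ofReal (1 + 2 / L * g x) ∂(S.Q n) := by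
          refine lintegral_mono fun x => ENNReal.ofReal_le_ofReal ?_
          have h0 : 0 ≤ min (g x) L / L := div_nonneg (le_min (hg0 x) hL.le) hL.le
          have h1 : min (g x) L / L ≤ 1 := (div_le_one hL).2 (min_le_right _ _)
          have h2 := Real.abs_exp_sub_one_le (x := min (g x) L / L)
            (by rw [abs_of_nonneg h0]; exact h1)
          rw [abs_of_nonneg h0] at h2
          have h3 := (le_abs_self _).trans h2
          have h4 : 2 * (min (g x) L / L) ≤ 2 / L * g x := by
            rw [div_mul_eq_mul_div, mul_div_assoc']
            have := min_le_left (g x) L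
            gcongr
          linarith
      _ ≤ ENNReal.ofReal (1 + 2 / L * M₀) :=
          lintegral_ofReal_add_le (g := fun _ => 1) measurable_const zero_le_one (by positivity)
            (by simp) (lintegral_ofReal_mul_le (by positivity) hgM)
      _ ≤ _ := by
          refine ENNReal.ofReal_le_ofReal ?_
          have := Real.add_one_le_exp (2 * M₀ / L)
          rw [div_mul_eq_mul_div]; linarith
  have hprod : ∫⁻ ω, ∏ i, w (S.X n i ω) ∂(S.P n)
      ≤ ENNReal.ofReal (Real.exp (2 * M₀ * n / L)) := by
    rw [S.lintegral_prod_comp n (g := fun z => w z.1) (hwm.comp measurable_fst)]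
    calc ∏ i : Fin n, ∫⁻ ω, w (S.X n i ω) ∂(S.P n)
        ≤ ∏ _i : Fin n, ENNReal.ofReal (Real.exp (2 * M₀ / L)) := by
          refine Finset.prod_le_prod' fun i _ => ?_
          rw [S.lintegral_comp_X hν n i hwm]
          exact hone
      _ = _ := by
          rw [Finset.prod_const, Finset.card_univ, Fintype.card_fin,
            ← ENNReal.ofReal_pow (Real.exp_nonneg _), ← Real.exp_nat_mul]
          congr 2; ring
  have hpm : Measurable fun ω => ∏ i, w (S.X n i ω) :=
    Finset.measurable_fun_prod _ fun i _ => hwm.comp (S.measurable_X n i)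
  have h := meas_ge_le_lintegral_div (μ := S.P n) hpm.aemeasurable
    (ε := ENNReal.ofReal (Real.exp (3 * M₀ * n / L))) (by simp [Real.exp_pos])
    ENNReal.ofReal_ne_top
  refine (measure_mono fun ω hω => ?_).trans (h.trans ((ENNReal.div_le_div_right hprod _).trans
    (le_of_eq ?_)))
  · change ENNReal.ofReal _ ≤ ∏ i, w (S.X n i ω)
    rw [hw, ← ENNReal.ofReal_prod_of_nonneg (fun _ _ => Real.exp_nonneg _), ← Real.exp_sum,
      ← Finset.sum_div]
    have : 3 * M₀ * n ≤ ∑ i, min (g (S.X n i ω)) L := hω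
    gcongr
  · rw [← ENNReal.ofReal_div_of_pos (Real.exp_pos _), ← Real.exp_sub]
    congr 2; ring

/-- The bound for the variance function near the true linear predictor at the covariate `x`. -/
noncomputable def varBound (n : ℕ) (x : Fin (S.p n) → ℝ) : ℝ :=
  varSup ν (|x ⬝ᵥ (S.φ n).ofLp| + 1)

lemma varBound_nonneg (n : ℕ) (x : Fin (S.p n) → ℝ) : 0 ≤ S.varBound n x := absSup_nonneg _ _

lemma measurable_varBound (hν : IsExpFamilyBase ν) (n : ℕ) : Measurable (S.varBound n) :=
  hν.measurable_varSup.comp ((measurable_dotProduct _).abs.add_const 1)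

/-- Unless some row has an entry above `x` or a variance bound above `y`, all summands are at most
`x² y ≤ L`. The truncated sums then equal the original ones, and the Chernoff bound applies to each
column. -/
lemma measure_compl_tameEvent_le (hν : IsExpFamilyBase ν) (n : ℕ) {x y L M₀ c₁ c₂ : ℝ}
    (hL : 0 < L) (hM₀ : 0 ≤ M₀) (hc₁ : 0 ≤ c₁) (hc₂ : 0 ≤ c₂)
    (hx : S.scale n * x ≤ 1) (hxyL : x ^ 2 * y ≤ L)
    (h1 : ∀ j, S.Q n {z | x < |z j|} ≤ ENNReal.ofReal c₁)
    (h2 : S.Q n {z | y < S.varBound n z} ≤ ENNReal.ofReal c₂)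
    (h3 : ∀ j, ∫⁻ z, ENNReal.ofReal (z j ^ 2 * S.varBound n z) ∂(S.Q n) ≤ ENNReal.ofReal M₀) :
    S.P n (S.tameEvent (3 * M₀) n)ᶜ ≤ ENNReal.ofReal
      (n * (S.p n * c₁) + n * c₂ + S.p n * Real.exp (-(M₀ * n / L))) := by
  have hVm := S.measurable_varBound hν n
  have hgm : ∀ j, Measurable fun z : Fin (S.p n) → ℝ => z j ^ 2 * S.varBound n z := fun j =>
    ((measurable_pi_apply j).pow_const 2).mul hVm
  set T₁ : Set (Fin (S.p n) → ℝ) := ⋃ j, {z | x < |z j|} with hT₁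
  set T₂ : Set (Fin (S.p n) → ℝ) := {z | y < S.varBound n z} with hT₂
  set T₃ : Fin (S.p n) → Set (S.Ω n) := fun j =>
    {ω | 3 * M₀ * n ≤ ∑ i, min (S.X n i ω j ^ 2 * S.varBound n (S.X n i ω)) L} with hT₃
  have b1 : S.P n {ω | ∃ i, S.X n i ω ∈ T₁} ≤ ENNReal.ofReal (n * (S.p n * c₁)) := by
    refine S.measure_exists_index_le hν n (MeasurableSet.iUnion fun j =>
      measurableSet_lt measurable_const (measurable_pi_apply j).abs) ?_
    refine (measure_iUnion_fintype_le _ _).trans ((Finset.sum_le_sum fun j _ => h1 j).trans ?_)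
    rw [Finset.sum_const, Finset.card_univ, Fintype.card_fin, nsmul_eq_mul,
      ENNReal.ofReal_mul (Nat.cast_nonneg _), ENNReal.ofReal_natCast]
  have b2 : S.P n {ω | ∃ i, S.X n i ω ∈ T₂} ≤ ENNReal.ofReal (n * c₂) :=
    S.measure_exists_index_le hν n (measurableSet_lt measurable_const hVm) h2
  have b3 : S.P n (⋃ j, T₃ j) ≤ ENNReal.ofReal (S.p n * Real.exp (-(M₀ * n / L))) := by
    refine (measure_iUnion_fintype_le _ _).trans ((Finset.sum_le_sum fun j _ =>
      S.measure_le_sum_min_le hν n (hgm j)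
        (fun z => mul_nonneg (sq_nonneg _) (S.varBound_nonneg n z)) hL hM₀ (h3 j)).trans ?_)
    rw [Finset.sum_const, Finset.card_univ, Fintype.card_fin, nsmul_eq_mul,
      ENNReal.ofReal_mul (Nat.cast_nonneg _), ENNReal.ofReal_natCast]
  have hsub : (S.tameEvent (3 * M₀) n)ᶜ ⊆
      {ω | ∃ i, S.X n i ω ∈ T₁} ∪ {ω | ∃ i, S.X n i ω ∈ T₂} ∪ ⋃ j, T₃ j := by
    intro ω hω
    by_contra hcon
    simp only [Set.mem_union, not_or, Set.mem_ofPred_eq, not_exists, hT₁, hT₂, hT₃,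
      Set.mem_iUnion, not_lt, not_le] at hcon
    obtain ⟨⟨hX, hV⟩, hsum⟩ := hcon
    refine hω ⟨fun i j => ?_, fun j => ?_⟩
    · exact (mul_le_mul_of_nonneg_left (hX i j) (Real.sqrt_nonneg _)).trans hx
    · refine le_trans (le_of_eq (Finset.sum_congr rfl fun i _ => ?_)) (hsum j).le
      refine (min_eq_left (le_trans ?_ hxyL)).symm
      refine mul_le_mul ?_ (hV i) (S.varBound_nonneg n _) (sq_nonneg _)
      rw [← sq_abs (S.X n i ω j)]
      exact pow_le_pow_left₀ (abs_nonneg _) (hX i j) 2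
  rw [ENNReal.ofReal_add (by positivity) (by positivity),
    ENNReal.ofReal_add (by positivity) (by positivity)]
  exact (measure_mono hsub).trans ((measure_union_le _ _).trans
    (add_le_add ((measure_union_le _ _).trans (add_le_add b1 b2)) b3))

section Moment

variable {S}

lemma MomentCovariates.measure_lt_abs_le {K : ℕ} {A : ℝ} {B : ℝ → ℝ}
    (h : S.MomentCovariates K A B) (n : ℕ) (j : Fin (S.p n)) {x : ℝ} (hx : 0 < x) :
    S.Q n {z | x < |z j|} ≤ ENNReal.ofReal (max A 0 / x ^ (6 * K)) := by
  refine (measure_mono fun z hz => ?_).trans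
    (measure_ge_le_of_moment (measurable_pi_apply j).abs hx (h.abs_moment n j))
  simp only [Set.mem_ofPred_eq] at hz ⊢
  exact hz.le

variable {q k : ℕ} {a₁ a₂ a₃ A : ℝ} {B : ℝ → ℝ}

lemma varBound_le (hν : IsExpFamilyBase ν) (hS : S.SparseRegime q a₁ a₂ a₃) (ha₃ : 0 ≤ a₃)
    (n : ℕ) (z : Fin (S.p n) → ℝ) :
    S.varBound n z ≤ varSup ν 2 + iteratedDeriv 2 (cumulant ν) 0
      + 2 * (q * a₃ + 1) * ∑ l ∈ S.trueModel n, thirdSup ν (2 * (q * a₃ + 1)) (z l) :=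
  hν.varSup_add_one_le (hS.sparse n) ha₃ (by positivity) (by linarith)
    (S.abs_coord_le_norm hS n)
    (fun j hj => by by_contra hne; exact hj (by simpa [trueModel] using hne)) z

lemma MomentCovariates.measure_lt_varBound_le (hν : IsExpFamilyBase ν)
    (h : S.MomentCovariates (2 * k) A B) (hS : S.SparseRegime q a₁ a₂ a₃) (ha₃ : 0 ≤ a₃) (n : ℕ)
    {y : ℝ} (hy : 0 < y) (hy2 : varSup ν 2 + iteratedDeriv 2 (cumulant ν) 0 ≤ y / 2) :
    S.Q n {z | y < S.varBound n z} ≤ ENNReal.ofReal (q * ((max A 0 +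
      max (B (2 * (q * a₃ + 1))) 0) / (y / (4 * (q * a₃ + 1) * (q + 1))) ^ (3 * k))) := by
  set t : ℝ := q * a₃ + 1 with ht
  have ht0 : 0 < t := by positivity
  -- If all terms stay below `y'`, the sum adds at most `y / 2` to the constant part, itself at most
  -- `y / 2`.
  set y' : ℝ := y / (4 * t * (q + 1)) with hy'
  have hy'0 : 0 < y' := by positivity
  have hsub : {z | y < S.varBound n z} ⊆
      ⋃ l ∈ S.trueModel n, {z : Fin (S.p n) → ℝ | y' ≤ thirdSup ν (2 * t) (z l)} := by
    intro z hz
    by_contra hcon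
    simp only [Set.mem_iUnion, Set.mem_ofPred_eq, not_exists, not_le] at hcon hz
    have h1 := varBound_le hν hS ha₃ n z
    have h2 : ∑ l ∈ S.trueModel n, thirdSup ν (2 * t) (z l) ≤ (q + 1) * y' := by
      calc ∑ l ∈ S.trueModel n, thirdSup ν (2 * t) (z l)
          ≤ ∑ _l ∈ S.trueModel n, y' := Finset.sum_le_sum fun l hl => (hcon l hl).le
        _ = (S.trueModel n).card * y' := by rw [Finset.sum_const, nsmul_eq_mul]
        _ ≤ (q + 1) * y' := by
          have : ((S.trueModel n).card : ℝ) ≤ q := by exact_mod_cast hS.sparse n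
          gcongr
          linarith
    have h3 : 2 * t * ((q + 1) * y') = y / 2 := by rw [hy']; field_simp; norm_num
    have h4 := mul_le_mul_of_nonneg_left h2 (by positivity : 0 ≤ 2 * t)
    linarith
  refine (measure_mono hsub).trans ((measure_biUnion_finset_le _ _).trans
    ((Finset.sum_le_sum fun l _ => measure_ge_le_of_moment
      ((hν.measurable_thirdSup (2 * t)).comp (measurable_pi_apply l)) hy'0
      (h.thirdSup_moment hν (by positivity) n l)).trans ?_))
  have hm : 0 ≤ (max A 0 + max (B (2 * t)) 0) / y' ^ (3 * k) :=
    div_nonneg (add_nonneg (le_max_right _ _) (le_max_right _ _)) (by positivity)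
  rw [Finset.sum_const, nsmul_eq_mul, ENNReal.ofReal_mul (Nat.cast_nonneg _),
    ENNReal.ofReal_natCast]
  gcongr
  exact_mod_cast hS.sparse n

/-- Bound `z² V` by `z⁴ + V²`. By `varBound_le`, `V²` reduces to squares of `thirdSup`, which the
moment of order `3k ≥ 2` controls. -/
lemma MomentCovariates.exists_sq_mul_varBound_moment (hν : IsExpFamilyBase ν)
    (h : S.MomentCovariates (2 * k) A B) (hS : S.SparseRegime q a₁ a₂ a₃) (ha₃ : 0 ≤ a₃) :
    ∃ M₀ : ℝ, 0 < M₀ ∧ ∀ n (j : Fin (S.p n)),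
      ∫⁻ z, ENNReal.ofReal (z j ^ 2 * S.varBound n z) ∂(S.Q n) ≤ ENNReal.ofReal M₀ := by
  set t : ℝ := q * a₃ + 1 with ht
  set c₀ : ℝ := varSup ν 2 + iteratedDeriv 2 (cumulant ν) 0 with hc₀
  have hc₀0 : 0 ≤ c₀ := add_nonneg (absSup_nonneg _ _) (hν.iteratedDeriv_two_cumulant_pos 0).le
  set m : ℝ := max A 0 + max (B (2 * t)) 0 with hm
  have hA0 : 0 ≤ max A 0 := le_max_right A 0
  have hm0 : 0 ≤ m := add_nonneg hA0 (le_max_right _ _)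
  have hk : 0 < k := by have := h.pos; omega
  refine ⟨(1 + max A 0) + (2 * c₀ ^ 2 + 8 * t ^ 2 * q * (q * (1 + m))), by positivity,
    fun n j => ?_⟩
  have hZm : ∀ l, Measurable fun z : Fin (S.p n) → ℝ => 1 + thirdSup ν (2 * t) (z l) ^ (3 * k) :=
    fun l => (((hν.measurable_thirdSup _).comp (measurable_pi_apply l)).pow_const _).const_add 1
  have hZ : ∀ l, ∫⁻ z, ENNReal.ofReal (1 + thirdSup ν (2 * t) (z l) ^ (3 * k)) ∂(S.Q n)
      ≤ ENNReal.ofReal (1 + m) := fun l =>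
    lintegral_ofReal_add_le (g := fun _ => 1) measurable_const zero_le_one hm0 (by simp)
      (h.thirdSup_moment hν (by positivity) n l)
  have hcard : ((S.trueModel n).card : ℝ) ≤ q := by exact_mod_cast hS.sparse n
  have hsum : ∫⁻ z, ENNReal.ofReal (2 * c₀ ^ 2 + 8 * t ^ 2 * q *
      ∑ l ∈ S.trueModel n, (1 + thirdSup ν (2 * t) (z l) ^ (3 * k))) ∂(S.Q n)
      ≤ ENNReal.ofReal (2 * c₀ ^ 2 + 8 * t ^ 2 * q * (q * (1 + m))) := by
    refine lintegral_ofReal_add_le (g := fun _ => 2 * c₀ ^ 2) measurable_const (by positivity)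
      (by positivity) (by simp) (lintegral_ofReal_mul_le (by positivity) ?_)
    refine (lintegral_ofReal_sum_le _ hZm (by positivity) hZ).trans
      (ENNReal.ofReal_le_ofReal ?_)
    gcongr
  refine le_trans (lintegral_mono fun z => ENNReal.ofReal_le_ofReal ?_)
    (lintegral_ofReal_add_le (g := fun z => z j ^ 4) ((measurable_pi_apply j).pow_const 4)
      (by positivity) (by positivity) (h.fourth_moment n j) hsum)
  set Z := ∑ l ∈ S.trueModel n, thirdSup ν (2 * t) (z l) with hZdef
  have hV := varBound_le hν hS ha₃ n z
  have hV0 := S.varBound_nonneg n z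
  have h1 : S.varBound n z ^ 2 ≤ 2 * c₀ ^ 2 + 8 * t ^ 2 * Z ^ 2 := by
    have := pow_le_pow_left₀ hV0 hV 2
    nlinarith [sq_nonneg (c₀ - 2 * t * Z)]
  have h2 : Z ^ 2 ≤ q * ∑ l ∈ S.trueModel n, (1 + thirdSup ν (2 * t) (z l) ^ (3 * k)) := by
    refine (sq_sum_le_card_mul_sum_sq (s := S.trueModel n)).trans
      (mul_le_mul hcard (Finset.sum_le_sum fun l _ => ?_)
        (Finset.sum_nonneg fun _ _ => sq_nonneg _) (by positivity))
    exact pow_le_one_add_pow (thirdSup_nonneg _ _ _) (by omega)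
  have h3 := mul_le_mul_of_nonneg_left h2 (by positivity : 0 ≤ 8 * t ^ 2)
  nlinarith [sq_nonneg (z j ^ 2 - S.varBound n z)]

end Moment

end GLMSequence

/-! ### Choice of truncation exponents. -/

namespace GLMSequence

variable {ν : Measure ℝ} {S : GLMSequence ν}

lemma MomentCovariates.kappa_ne_top {K : ℕ} {A : ℝ} {B : ℝ → ℝ} (h : S.MomentCovariates K A B) :
    S.kappa ≠ ⊤ := fun ht => by
  have := h.two_kappa_lt
  rw [ht, ENNReal.mul_top two_ne_zero] at this
  exact not_top_lt this

lemma MomentCovariates.two_mul_toReal_lt {K : ℕ} {A : ℝ} {B : ℝ → ℝ}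
    (h : S.MomentCovariates K A B) : 2 * S.kappa.toReal < K := by
  have := (ENNReal.toReal_lt_toReal (ENNReal.mul_ne_top ENNReal.ofNat_ne_top h.kappa_ne_top)
    (ENNReal.natCast_ne_top K)).2 h.two_kappa_lt
  simpa using this

lemma eventually_kappaSeq_lt_add (hκ : S.kappa ≠ ⊤) {η : ℝ} (hη : 0 < η) :
    ∀ᶠ n in atTop, S.kappaSeq n < S.kappa.toReal + η := by
  refine S.eventually_kappaSeq_lt ?_
  rw [ENNReal.lt_ofReal_iff_toReal_lt hκ]
  linarith

lemma eventually_log_p_le (hκ : S.kappa ≠ ⊤) {η : ℝ} (hη : 0 < η) :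
    ∀ᶠ n : ℕ in atTop, Real.log (S.p n) ≤ (S.kappa.toReal + η) * Real.log n := by
  filter_upwards [eventually_kappaSeq_lt_add hκ hη, eventually_ge_atTop 2] with n hn hn2
  rw [S.log_p_eq hn2]
  exact mul_le_mul_of_nonneg_right hn.le (Real.log_natCast_nonneg n)

lemma tendsto_rpow_mul_exp_neg_rpow (s : ℝ) {c r : ℝ} (hc : 0 < c) (hr : 0 < r) :
    Tendsto (fun n : ℕ => (n : ℝ) ^ s * Real.exp (-(c * (n : ℝ) ^ r))) atTop (𝓝 0) := by
  have h := (tendsto_rpow_mul_exp_neg_mul_atTop_nhds_zero (s / r) c hc).comp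
    ((tendsto_rpow_atTop hr).comp tendsto_natCast_atTop_atTop)
  refine h.congr fun n => ?_
  simp only [Function.comp_apply]
  rw [← Real.rpow_mul (Nat.cast_nonneg n), mul_div_cancel₀ _ hr.ne', neg_mul]

/-- Entries are cut at `n ^ a` and variance bounds at `n ^ b`. The exponents must make both union
bounds smaller than `n ^ (-ρ)`, yet satisfy `2a + b < 1` for the Chernoff term to be exponentially
small in a power of `n`. The hypothesis `hρk` is exactly the room for this. -/
lemma MomentCovariates.exists_tame {q k : ℕ} {a₁ a₂ a₃ A : ℝ} {B : ℝ → ℝ}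
    (hν : IsExpFamilyBase ν) (h : S.MomentCovariates (2 * k) A B)
    (hS : S.SparseRegime q a₁ a₂ a₃) (ha₃ : 0 ≤ a₃) {ρ : ℝ} (hρ : 0 < ρ)
    (hρk : 3 + 3 * ρ + S.kappa.toReal < 6 * k) :
    ∃ M, 0 ≤ M ∧ ∀ᶠ n : ℕ in atTop,
      S.P n (S.tameEvent M n)ᶜ ≤ ENNReal.ofReal ((n : ℝ) ^ (-ρ)) := by
  obtain ⟨M₀, hM₀, hmom⟩ := h.exists_sq_mul_varBound_moment hν hS ha₃
  have hk : 0 < k := by have := h.pos; omega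
  have hk' : (0 : ℝ) < k := by exact_mod_cast hk
  set κ := S.kappa.toReal with hκdef
  have hκ0 : 0 ≤ κ := ENNReal.toReal_nonneg
  -- The two union bounds force `6k (2a + b) = 3 + 3ρ + κ + 4η`; with this `η` half of the available
  -- gap remains.
  set η : ℝ := (6 * k - 3 - 3 * ρ - κ) / 8 with hη
  have hη0 : 0 < η := by rw [hη]; linarith
  set a : ℝ := (1 + ρ + κ + 2 * η) / (12 * k) with ha
  set b : ℝ := (1 + ρ + η) / (3 * k) with hb
  have ha0 : 0 < a := by positivity
  have hb0 : 0 < b := by positivity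
  have e1 : a * (12 * k) = 1 + ρ + κ + 2 * η := div_mul_cancel₀ _ (by positivity)
  have e2 : b * (3 * k) = 1 + ρ + η := div_mul_cancel₀ _ (by positivity)
  have hw : 2 * a + b < 1 := by
    have e3 : (2 * a + b) * (6 * k) = 3 + 3 * ρ + κ + 4 * η := by linarith
    have : (2 * a + b) * (6 * k) < 1 * (6 * k) := by rw [e3, hη]; linarith
    exact lt_of_mul_lt_mul_right this (by positivity)
  set A' := max A 0
  have hA' : 0 ≤ A' := le_max_right A 0
  set m : ℝ := A' + max (B (2 * (q * a₃ + 1))) 0 with hm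
  have hm0 : 0 ≤ m := add_nonneg hA' (le_max_right _ _)
  set c : ℝ := 4 * (q * a₃ + 1) * (q + 1) with hc
  have hc0 : 0 < c := by positivity
  refine ⟨3 * M₀, by positivity, ?_⟩
  have hlog : ∀ᶠ n : ℕ in atTop, Real.log n ≤ 1 / (κ + η + 1) * (n : ℝ) ^ (1 - 2 * a) := by
    have := ((isLittleO_log_rpow_atTop (by linarith : 0 < 1 - 2 * a)).comp_tendsto
      tendsto_natCast_atTop_atTop).bound (c := 1 / (κ + η + 1)) (by positivity)
    filter_upwards [this] with n hn
    simp only [Function.comp_apply] at hn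
    rw [Real.norm_of_nonneg (by positivity : (0 : ℝ) ≤ (n : ℝ) ^ (1 - 2 * a))] at hn
    exact (Real.le_norm_self _).trans hn
  have hlarge : ∀ᶠ n : ℕ in atTop, 2 * (varSup ν 2 + iteratedDeriv 2 (cumulant ν) 0)
      ≤ (n : ℝ) ^ b :=
    ((tendsto_rpow_atTop hb0).comp tendsto_natCast_atTop_atTop).eventually_ge_atTop _
  have hsmall1 : ∀ᶠ n : ℕ in atTop, (A' + q * (m * c ^ (3 * k))) * (n : ℝ) ^ (-η) ≤ 1 / 2 := by
    have h0 := (((tendsto_rpow_neg_atTop hη0).comp tendsto_natCast_atTop_atTop).const_mul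
      (A' + q * (m * c ^ (3 * k))))
    rw [mul_zero] at h0
    exact h0.eventually (eventually_le_nhds (by norm_num))
  have hsmall2 := (tendsto_rpow_mul_exp_neg_rpow (κ + η + ρ) hM₀
    (by linarith : 0 < 1 - (2 * a + b))).eventually
      (eventually_le_nhds (by norm_num : (0 : ℝ) < 1 / 2))
  filter_upwards [hlog, hlarge, hsmall1, hsmall2, eventually_log_p_le h.kappa_ne_top hη0,
    eventually_ge_atTop 1] with n hlogn hlargen hs1 hs2 hlp hn
  have hn' : (0 : ℝ) < n := by exact_mod_cast hn
  have hp' : (0 : ℝ) < S.p n := by exact_mod_cast S.one_le_p n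
  have hp : (S.p n : ℝ) ≤ (n : ℝ) ^ (κ + η) := by
    rw [Real.rpow_def_of_pos hn', ← Real.log_le_iff_le_exp hp']
    linarith
  have hscale : S.scale n * (n : ℝ) ^ a ≤ 1 := by
    have h1 : S.logSize n ≤ (κ + η + 1) * Real.log n := by rw [logSize]; linarith
    have h2 : S.logSize n ≤ (n : ℝ) ^ (1 - 2 * a) := by
      refine h1.trans ((mul_le_mul_of_nonneg_left hlogn (by positivity)).trans (le_of_eq ?_))
      field_simp
    have h3 : S.logSize n / n ≤ ((n : ℝ) ^ (-a)) ^ 2 := by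
      rw [div_le_iff₀ hn', ← Real.rpow_natCast, ← Real.rpow_mul hn'.le,
        ← Real.rpow_add_one hn'.ne']
      refine h2.trans (le_of_eq ?_)
      congr 1; push_cast; ring
    have h4 : S.scale n ≤ (n : ℝ) ^ (-a) := by
      rw [scale, Real.sqrt_le_left (by positivity)]; exact h3
    calc S.scale n * (n : ℝ) ^ a ≤ (n : ℝ) ^ (-a) * (n : ℝ) ^ a := by gcongr
      _ = 1 := by rw [← Real.rpow_add hn']; simp
  refine (S.measure_compl_tameEvent_le hν n (x := (n : ℝ) ^ a) (y := (n : ℝ) ^ b)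
    (L := (n : ℝ) ^ (2 * a + b)) (by positivity) hM₀.le (c₁ := A' / ((n : ℝ) ^ a) ^ (6 * (2 * k)))
    (by positivity) (c₂ := q * (m / ((n : ℝ) ^ b / c) ^ (3 * k)))
    (by positivity) hscale ?_ (fun j => h.measure_lt_abs_le n j (by positivity))
    (h.measure_lt_varBound_le hν hS ha₃ n (by positivity) (by linarith)) (hmom n)).trans
    (ENNReal.ofReal_le_ofReal ?_)
  · rw [← Real.rpow_natCast, ← Real.rpow_mul hn'.le, ← Real.rpow_add hn']
    refine le_of_eq ?_
    congr 1; push_cast; ring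
  · have t1 : n * (S.p n * (A' / ((n : ℝ) ^ a) ^ (6 * (2 * k)))) ≤ A' * (n : ℝ) ^ (-η) *
        (n : ℝ) ^ (-ρ) := by
      have hpow : ((n : ℝ) ^ a) ^ (6 * (2 * k)) = (n : ℝ) ^ (1 + ρ + κ + 2 * η) := by
        rw [← Real.rpow_natCast, ← Real.rpow_mul hn'.le, ← e1]
        congr 1; push_cast; ring
      rw [hpow]
      calc n * (S.p n * (A' / (n : ℝ) ^ (1 + ρ + κ + 2 * η)))
          ≤ n * ((n : ℝ) ^ (κ + η) * (A' / (n : ℝ) ^ (1 + ρ + κ + 2 * η))) := by gcongr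
        _ = A' * ((n : ℝ) ^ (1 : ℝ) * (n : ℝ) ^ (κ + η) * (n : ℝ) ^ (-(1 + ρ + κ + 2 * η))) := by
            rw [Real.rpow_neg hn'.le, Real.rpow_one]; ring
        _ = A' * (n : ℝ) ^ (-η) * (n : ℝ) ^ (-ρ) := by
            rw [← Real.rpow_add hn', ← Real.rpow_add hn', mul_assoc, ← Real.rpow_add hn']
            congr 2; ring
    have t2 : n * (q * (m / ((n : ℝ) ^ b / c) ^ (3 * k)))
        = q * (m * c ^ (3 * k)) * (n : ℝ) ^ (-η) * (n : ℝ) ^ (-ρ) := by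
      have hpow : ((n : ℝ) ^ b) ^ (3 * k) = (n : ℝ) ^ (1 + ρ + η) := by
        rw [← Real.rpow_natCast, ← Real.rpow_mul hn'.le, ← e2]
        congr 1; push_cast; ring
      have h1 : (n : ℝ) ^ (-η) * (n : ℝ) ^ (-ρ) = n / (n : ℝ) ^ (1 + ρ + η) := by
        rw [← Real.rpow_add hn', ← Real.rpow_one_sub' hn'.le (by linarith)]
        congr 1; ring
      rw [div_pow, hpow, mul_assoc (_ * _), h1]
      field_simp
    have t3 : S.p n * Real.exp (-(M₀ * n / (n : ℝ) ^ (2 * a + b))) ≤ 1 / 2 * (n : ℝ) ^ (-ρ) := by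
      have h1 : M₀ * n / (n : ℝ) ^ (2 * a + b) = M₀ * (n : ℝ) ^ (1 - (2 * a + b)) := by
        rw [Real.rpow_sub hn', Real.rpow_one]; ring
      rw [h1]
      set e := Real.exp (-(M₀ * (n : ℝ) ^ (1 - (2 * a + b))))
      calc S.p n * e ≤ (n : ℝ) ^ (κ + η) * e := by
            have : 0 ≤ e := Real.exp_nonneg _
            gcongr
        _ = ((n : ℝ) ^ (κ + η + ρ) * e) * (n : ℝ) ^ (-ρ) := by
            rw [mul_right_comm, ← Real.rpow_add hn']; congr 2; ring
        _ ≤ 1 / 2 * (n : ℝ) ^ (-ρ) := by gcongr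
    have hr : 0 ≤ (n : ℝ) ^ (-ρ) := by positivity
    have h5 := mul_le_mul_of_nonneg_right hs1 hr
    rw [t2]
    nlinarith

/-- For `κ = 0` the number `p` is below every positive power of `n`, so `p ^ (-β)` uses only part of
the gap between `α` and `1/2`. -/
lemma eventually_rpow_neg_half_le (hκ : S.kappa = 0) {α β : ℝ} (hα : α < 1 / 2) (hβ : 0 < β) :
    ∀ᶠ n : ℕ in atTop, (n : ℝ) ^ (-(1 / 2) : ℝ) ≤ (n : ℝ) ^ (-α) * (S.p n : ℝ) ^ (-β) / 2 := by
  set η : ℝ := (1 / 2 - α) / (2 * β) with hη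
  have hη0 : 0 < η := div_pos (by linarith) (by positivity)
  have e : β * η = (1 / 2 - α) / 2 := by rw [hη]; field_simp
  have hlog := (Real.tendsto_log_atTop.comp tendsto_natCast_atTop_atTop).eventually_ge_atTop
    (Real.log 2 / ((1 / 2 - α) / 2))
  filter_upwards [eventually_log_p_le (S := S) (by simp [hκ]) hη0, hlog, eventually_ge_atTop 1]
    with n hn h2 hn1
  have hn' : (0 : ℝ) < n := by exact_mod_cast hn1
  rw [hκ, ENNReal.toReal_zero, zero_add] at hn
  simp only [Function.comp_apply] at h2
  rw [div_le_iff₀ (by linarith)] at h2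
  rw [S.rpow_mul_rpow_eq_exp hn1, le_div_iff₀ two_pos, Real.rpow_def_of_pos hn',
    ← Real.exp_log (two_pos : (0 : ℝ) < 2), ← Real.exp_add]
  refine Real.exp_le_exp.2 ?_
  have h3 := mul_le_mul_of_nonneg_left hn hβ.le
  rw [← mul_assoc, e] at h3
  simp only [Real.exp_log (two_pos : (0 : ℝ) < 2)]
  linarith

end GLMSequence

/-! ### The selection theorem. -/

theorem mainTheorem3 (ν : Measure ℝ) (hν : IsExpFamilyBase ν) (q : ℕ) (a₁ a₂ a₃ : ℝ)
    (ha₁ : 0 < a₁) (ha₂ : 0 < a₂) (ha₃ : 0 < a₃) :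
    -- bounded covariates
    (∀ A : ℝ, ∃ R : ℝ, 0 < R ∧
      ∀ S : GLMSequence ν, S.SparseRegime q a₁ a₂ a₃ → S.BoundedCovariates A →
      ∀ (f : S.PriorFamily) (F₁ F₂ F₃ : ℝ), 0 < F₁ → 0 < F₂ → 0 < F₃ →
        S.PriorConditions q R F₁ F₂ F₃ f →
      ∀ γ : ℝ, 0 ≤ γ →
        (∀ α β : ℝ, Admissible S.kappaLow S.kappa α β γ →
          ∀ᶠ n : ℕ in atTop,
            1 - (n : ℝ) ^ (-α) * (S.p n : ℝ) ^ (-β)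
              ≤ (S.P n).real (S.selectsTrueModel q γ f n)) ∧
        ((S.kappa = 0 ∨ 1 - (S.kappa⁻¹).toReal / 2 < γ) →
          Tendsto (fun n => (S.P n).real (S.selectsTrueModel q γ f n)) atTop (𝓝 1))) ∧
    -- covariates with bounded moments
    (∀ (K : ℕ) (A : ℝ) (B : ℝ → ℝ), ∃ R : ℝ, 0 < R ∧
      ∀ S : GLMSequence ν, S.SparseRegime q a₁ a₂ a₃ → S.MomentCovariates K A B →
      ∀ (f : S.PriorFamily) (F₁ F₂ F₃ : ℝ), 0 < F₁ → 0 < F₂ → 0 < F₃ →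
        S.PriorConditions q R F₁ F₂ F₃ f →
      ∀ γ : ℝ, 0 ≤ γ →
        (∀ α β : ℝ, Admissible S.kappaLow S.kappa α β γ →
          ∀ᶠ n : ℕ in atTop,
            1 - 4 * (K : ℝ) ^ (K + 1) * (n : ℝ) ^ (-((K : ℝ) - 2 * S.kappa.toReal) / 2)
                - (n : ℝ) ^ (-α) * (S.p n : ℝ) ^ (-β)
              ≤ (S.P n).real (S.selectsTrueModel q γ f n)) ∧
        ((S.kappa = 0 ∨ 1 - (S.kappa⁻¹).toReal / 2 < γ) →
          Tendsto (fun n => (S.P n).real (S.selectsTrueModel q γ f n)) atTop (𝓝 1))) := by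

  -- The choice of `R` only has to put the unit cube around the true parameter inside the ball of
  -- radius `R + 1`.
  have hRle : (q : ℝ) * (a₃ + 1) ≤ (q * (a₃ + 1) + 1) + 1 := by linarith
  have hRpos : 0 < (q : ℝ) * (a₃ + 1) + 1 := by positivity
  refine ⟨fun A => ⟨q * (a₃ + 1) + 1, hRpos, ?_⟩, fun K A B => ⟨q * (a₃ + 1) + 1, hRpos, ?_⟩⟩
  · intro S hS hA f F₁ F₂ F₃ hF₁ hF₂ hF₃ hf γ hγ
    have hA' : S.BoundedCovariates (max A 0) := fun n j =>
      (hA n j).mono fun x hx => hx.trans (le_max_left _ _)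
    obtain ⟨M, hM, htame⟩ := hA'.exists_tame hν ha₃.le hS (le_max_right A 0)
    have main : ∀ α β : ℝ, Admissible S.kappaLow S.kappa α β γ → ∀ᶠ n : ℕ in atTop,
        1 - (n : ℝ) ^ (-α) * (S.p n : ℝ) ^ (-β)
          ≤ (S.P n).real (S.selectsTrueModel q γ f n) := by
      intro α β hadm
      filter_upwards [S.eventually_le_measureReal_selectsTrueModel hν ha₁ ha₃.le hS
        (by positivity) hA'.fourth_moment hf hRle hF₁ hF₂ hγ hM hadm (δ := fun _ => 0)
        (fun _ => le_rfl) htame, eventually_ge_atTop 1] with n hn hn1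
      have hpos : 0 ≤ (n : ℝ) ^ (-α) * (S.p n : ℝ) ^ (-β) := by positivity
      by_cases hE : 0 ≤ α * Real.log n + β * Real.log (S.p n)
      · linarith [hn hE]
      -- If the exponent is negative, the rate is at least one and the bound is void.
      · have := S.one_le_rpow_mul_rpow hn1 hE
        have := measureReal_nonneg (μ := S.P n) (s := S.selectsTrueModel q γ f n)
        linarith
    refine ⟨main, fun h => ?_⟩
    obtain ⟨α, β, hα, hβ, hadm⟩ := S.exists_admissible h
    exact S.tendsto_measureReal_of_le (S.tendsto_rpow_mul_rpow hα hβ) (main α β hadm)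
  · intro S hS hmom f F₁ F₂ F₃ hF₁ hF₂ hF₃ hf γ hγ
    have hK := hmom.pos
    have hκK := hmom.two_mul_toReal_lt
    obtain ⟨k, rfl⟩ : ∃ k, K = 2 * k := hmom.even.two_dvd
    have hk : (1 : ℝ) ≤ k := by exact_mod_cast (by omega : 1 ≤ k)
    set κ := S.kappa.toReal with hκdef
    have hconst : (1 : ℝ) ≤ 4 * ((2 * k : ℕ) : ℝ) ^ (2 * k + 1) := by
      have : (1 : ℝ) ≤ ((2 * k : ℕ) : ℝ) ^ (2 * k + 1) :=
        one_le_pow₀ (by exact_mod_cast hK)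
      linarith
    have main : ∀ α β : ℝ, Admissible S.kappaLow S.kappa α β γ → ∀ᶠ n : ℕ in atTop,
        1 - 4 * ((2 * k : ℕ) : ℝ) ^ (2 * k + 1) * (n : ℝ) ^ (-(((2 * k : ℕ) : ℝ) - 2 * κ) / 2)
            - (n : ℝ) ^ (-α) * (S.p n : ℝ) ^ (-β)
          ≤ (S.P n).real (S.selectsTrueModel q γ f n) := by
      intro α β hadm
      have trivial_case : ∀ n : ℕ, 1 ≤ n → ¬ 0 ≤ α * Real.log n + β * Real.log (S.p n) →
          1 - 4 * ((2 * k : ℕ) : ℝ) ^ (2 * k + 1) * (n : ℝ) ^ (-(((2 * k : ℕ) : ℝ) - 2 * κ) / 2)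
            - (n : ℝ) ^ (-α) * (S.p n : ℝ) ^ (-β)
          ≤ (S.P n).real (S.selectsTrueModel q γ f n) := by
        intro n hn1 hE
        have h1 := S.one_le_rpow_mul_rpow hn1 hE
        have h2 := measureReal_nonneg (μ := S.P n) (s := S.selectsTrueModel q γ f n)
        have h3 : 0 ≤ 4 * ((2 * k : ℕ) : ℝ) ^ (2 * k + 1)
          * (n : ℝ) ^ (-(((2 * k : ℕ) : ℝ) - 2 * κ) / 2) := by positivity
        linarith
      by_cases hκ : S.kappa = 0
      · obtain ⟨-, hα, hβ⟩ := hadm.1 hκ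
        have hκ0 : κ = 0 := by rw [hκdef, hκ, ENNReal.toReal_zero]
        -- For `κ = 0` and `k = 1` the value `ρ = k` would violate the strict condition on
        -- exponents. Since `α < 1/2`, the weaker `ρ = 1/2` suffices: `n ^ (-1/2)` fits into the
        -- unused half of the rate.
        obtain ⟨M, hM, htame⟩ := hmom.exists_tame hν hS ha₃.le (ρ := 1 / 2) (by norm_num)
          (by rw [← hκdef, hκ0]; linarith)
        filter_upwards [S.eventually_le_measureReal_selectsTrueModel hν ha₁ ha₃.le hS
          (add_nonneg zero_le_one (le_max_right A 0)) hmom.fourth_moment hf hRle hF₁ hF₂ hγ hM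
          hadm (fun _ => by positivity) htame, eventually_ge_atTop 1,
          GLMSequence.eventually_rpow_neg_half_le hκ hα hβ] with n hn hn1 hhalf
        by_cases hE : 0 ≤ α * Real.log n + β * Real.log (S.p n)
        · have h3 : 0 ≤ 4 * ((2 * k : ℕ) : ℝ) ^ (2 * k + 1)
            * (n : ℝ) ^ (-(((2 * k : ℕ) : ℝ) - 2 * κ) / 2) := by positivity
          linarith [hn hE]
        · exact trivial_case n hn1 hE
      · have hκpos : 0 < κ := ENNReal.toReal_pos hκ hmom.kappa_ne_top
        push_cast at hκK
        -- Here `ρ = (K - 2κ) / 2` is the exponent claimed, and `κ > 0` makes the exponent condition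
        -- strict even for `k = 1`.
        obtain ⟨M, hM, htame⟩ := hmom.exists_tame hν hS ha₃.le (ρ := k - κ) (by linarith)
          (by rw [← hκdef]; linarith)
        filter_upwards [S.eventually_le_measureReal_selectsTrueModel hν ha₁ ha₃.le hS
          (add_nonneg zero_le_one (le_max_right A 0)) hmom.fourth_moment hf hRle hF₁ hF₂ hγ hM
          hadm (fun _ => by positivity) htame, eventually_ge_atTop 1] with n hn hn1
        by_cases hE : 0 ≤ α * Real.log n + β * Real.log (S.p n)
        · have e : -(((2 * k : ℕ) : ℝ) - 2 * κ) / 2 = -(k - κ) := by push_cast; ring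
          have h1 : 0 ≤ (n : ℝ) ^ (-(k - κ)) := by positivity
          have h2 := le_mul_of_one_le_left h1 hconst
          have h3 : 0 ≤ (n : ℝ) ^ (-α) * (S.p n : ℝ) ^ (-β) := by positivity
          rw [e]
          linarith [hn hE]
        · exact trivial_case n hn1 hE
    refine ⟨main, fun h => ?_⟩
    obtain ⟨α, β, hα, hβ, hadm⟩ := S.exists_admissible h
    have ht : Tendsto (fun n : ℕ => 4 * ((2 * k : ℕ) : ℝ) ^ (2 * k + 1)
        * (n : ℝ) ^ (-(((2 * k : ℕ) : ℝ) - 2 * κ) / 2)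
        + (n : ℝ) ^ (-α) * (S.p n : ℝ) ^ (-β)) atTop (𝓝 0) := by
      have h1 := ((tendsto_rpow_neg_atTop
        (by linarith : 0 < (((2 * k : ℕ) : ℝ) - 2 * κ) / 2)).comp
          tendsto_natCast_atTop_atTop).const_mul (4 * ((2 * k : ℕ) : ℝ) ^ (2 * k + 1))
      have h2 := h1.add (S.tendsto_rpow_mul_rpow hα hβ)
      rw [mul_zero, add_zero] at h2
      refine h2.congr fun n => ?_
      simp only [Function.comp_apply, neg_div]
    refine S.tendsto_measureReal_of_le ht ?_
    filter_upwards [main α β hadm] with n hn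
    linarith
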